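/- **The CCV $\lambda\mu$-calculus.** Let $x,y,z$ range over ordinary variables and $k,l$ over continuation variables. Terms $M$ and jumps $J$ are given by $$M ::= x \mid \lambda x.\,M \mid MM \mid \lceil M\ x{:=}M\rceil \mid \mu k.\,J,\qquad J ::= [k]M \mid \lceil J\ x{:=}M\rceil .$$ Here $\lceil L\ x{:=}M\rceil$ means "let $x=M$ in $L$", and it binds $x$ in $L$ only; $\lambda x$ and $\mu k$ bind as usual. Variables and abstractions $\lambda x.M$ are called values (letter $V$); all other terms are non-values. Terms and jumps are taken up to $\alpha$-conversion and up to the congruence generated by the equality axioms $$\lceil L\ x{:=}\lceil M\ y{:=}N\rceil\rceil=\lceil\lceil L\ x{:=}M\rceil\ y{:=}N\rceil\ (y\notin FV(L)),$$ $$\lceil(\mu k.J)\ x{:=}M\rceil=\mu k.\lceil J\ x{:=}M\rceil\ (k\notin FV(M)),\qquad [k]\lceil L\ x{:=}M\rceil=\lceil([k]L)\ x{:=}M\rceil .$$ Reduction $\to$ is generated by the following rules, which may be applied to any subterm of any syntax tree representing the given term ($V$ a value, $z$ fresh): * $NM\to\lceil zM\ z{:=}N\rceil$ and $VN\to\lceil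 Vz\ z{:=}N\rceil$, where $N$ is a non-value; * $(\lambda x.M)V\to\lceil M\ x{:=}V\rceil$ and $\lceil M\ x{:=}V\rceil\to M\{V/x\}$; * $\lceil M\ x{:=}\mu k.J\rceil\to\mu k.\,J\{[k]\square\mapsto[k]\lceil M\ x{:=}\square\rceil\}$, where $k\notin FV(M)$ and the capture-avoiding substitution acts recursively on all free occurrences of $k$ in $J$; * $[l]\mu k.J\to J\{l/k\}$; * $\lambda x.Vx\to V$ ($x\notin FV(V)$), $\ \lceil x\ x{:=}M\rceil\to M$, $\ \mu k.[k]M\to M$ ($k\notin FV(M)$). **The target calculus** is the sorted $\lambda$-calculus $$T::=\lambda k.Q\mid WW,\quad Q::=KW\mid TK,\quad W::=x\mid\lambda x.T,\quad K::=k\mid\lambda x.Q,$$ with ordinary $\beta\eta$-reduction. **The CPS translation** is $[\![M]\!]=\lambda k.\,\langle M\rangle[k]$ with $k$ fresh, where, for $V$ ranging over values and $N$ over non-values, $$\begin{aligned} \langle V\rangle[K]&=KV^*, & \langle V_1V_2\rangle[K]&=V_1^*V_2^*K,\\ \langle VN\rangle[K]&=\langle N\rangle[\lambda y.V^*yK],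 & \langle NV\rangle[K]&=\langle N\rangle[\lambda x.xV^*K],\\ \langle N_1N_2\rangle[K]&=\langle N_1\rangle[\lambda x.\langle N_2\rangle[\lambda y.xyK]], & \langle\lceil L\ x{:=}M\rceil\rangle[K]&=\langle M\rangle[\lambda x.\langle L\rangle[K]],\\ \langle\mu k.J\rangle[K]&=(\lambda k.\langle J\rangle)K, & \langle[k]M\rangle&=\langle M\rangle[k],\\ \langle\lceil J\ x{:=}M\rceil\rangle&=\langle M\rangle[\lambda x.\langle J\rangle], & x^*=x,\quad(\lambda x.M)^*&=\lambda xk.\langle M\rangle[k], \end{aligned}$$ with bound variables renamed so that no free variable of $K$ is captured. The translation is defined on syntax trees; trees that are identified by the second equality axiom have $\beta$-equal, but not necessarily identical, translations. In either calculus a term is *normalizable* if some finite (possibly empty) reduction sequence from it ends in a term that cannot be reduced. **Theorem.** Let $M$ be a term of the CCV $\lambda\mu$-calculus. Then $M$ is normalizable if and only if $[\![M]\!]$ is normalizable with respect to $\beta\eta$-reduction in the target calculus. Here $[\![M]\!]$ is computed from any syntax tree that represents $M$. -/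

import Mathlib

/-!
Variables are de Bruijn indices, so that terms are taken up to renaming of bound variables.
Ordinary variables and continuation variables have two separate index spaces: a binder of an
ordinary variable shifts the ordinary indices only, and a binder of a continuation variable
shifts the continuation indices only.
-/

namespace CCV

/-- Weak normalizability: some reduction sequence (possibly empty) from `a` ends in an element
that cannot be reduced. -/
def Normalizable {α : Type} (r : α → α → Prop) (a : α) : Prop :=
  ∃ b, Relation.ReflTransGen r a b ∧ ∀ c, ¬ r b c

/-- Extend a renaming under a binder. -/
def up (f : ℕ → ℕ) : ℕ → ℕ
  | 0 => 0
  | n + 1 => f n + 1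

/-! ### The source calculus: syntax -/

/-- The two syntactic categories of the source calculus. -/
inductive Kind
  | term
  | jump

/-- Terms `M ::= x | λx.M | M M | ⌈M x:=M⌋ | μk.J` and jumps `J ::= [k]M | ⌈J x:=M⌋`,
as syntax trees.  `lett L M` is `⌈L x:=M⌋`, that is, `let x = M in L`: it binds the ordinary
variable `0` in its first argument `L`, which is a term or a jump. -/
inductive Tm : Kind → Type
  | var (x : ℕ) : Tm .term
  | lam (M : Tm .term) : Tm .term
  | app (M N : Tm .term) : Tm .term
  | lett {s : Kind} (L : Tm s) (M : Tm .term) : Tm s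
  | mu (J : Tm .jump) : Tm .term
  | jmp (k : ℕ) (M : Tm .term) : Tm .jump

namespace Tm

/-- Renaming of free variables, `f` on ordinary and `g` on continuation variables. -/
def ren : {s : Kind} → (ℕ → ℕ) → (ℕ → ℕ) → Tm s → Tm s
  | _, f, _, var x => var (f x)
  | _, f, g, lam M => lam (ren (up f) g M)
  | _, f, g, app M N => app (ren f g M) (ren f g N)
  | _, f, g, lett L M => lett (ren (up f) g L) (ren f g M)
  | _, f, g, mu J => mu (ren f (up g) J)
  | _, f, g, jmp k M => jmp (g k) (ren f g M)

/-- Weakening by a fresh ordinary variable `0`. -/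
def wkO {s : Kind} (M : Tm s) : Tm s := M.ren Nat.succ id

/-- Weakening by a fresh continuation variable `0`. -/
def wkC {s : Kind} (M : Tm s) : Tm s := M.ren id Nat.succ

/-- Extend a substitution under a binder of an ordinary variable. -/
def upSubst (σ : ℕ → Tm .term) : ℕ → Tm .term
  | 0 => var 0
  | n + 1 => (σ n).wkO

/-- Capture-avoiding simultaneous substitution for the ordinary variables. -/
def subst : {s : Kind} → (ℕ → Tm .term) → Tm s → Tm s
  | _, σ, var x => σ x
  | _, σ, lam M => lam (subst (upSubst σ) M)
  | _, σ, app M N => app (subst σ M) (subst σ N)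
  | _, σ, lett L M => lett (subst (upSubst σ) L) (subst σ M)
  | _, σ, mu J => mu (subst (fun n => (σ n).wkC) J)
  | _, σ, jmp k M => jmp k (subst σ M)

/-- The assignment `0 ↦ V`, `n + 1 ↦ n`. -/
def inst (V : Tm .term) : ℕ → Tm .term
  | 0 => V
  | n + 1 => var n

/-- `M{V/x}` where `x` is the ordinary variable `0`, which disappears. -/
def substO {s : Kind} (M : Tm s) (V : Tm .term) : Tm s := M.subst (inst V)

/-- The assignment `0 ↦ l`, `n + 1 ↦ n`. -/
def instC (l : ℕ) : ℕ → ℕ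
  | 0 => l
  | n + 1 => n

/-- `J{l/k}` where `k` is the continuation variable `0`, which disappears. -/
def substC {s : Kind} (J : Tm s) (l : ℕ) : Tm s := J.ren id (instC l)

/-- The capture-avoiding context substitution `P{[k]□ ↦ [k]⌈M x:=□⌋}`, performed recursively
on all free occurrences of `k`; the variable `x` is the ordinary variable `0` of `M`. -/
def ctxSubst : {s : Kind} → ℕ → Tm .term → Tm s → Tm s
  | _, _, _, var x => var x
  | _, k, M, lam P => lam (ctxSubst k (M.ren (up Nat.succ) id) P)
  | _, k, M, app P Q => app (ctxSubst k M P) (ctxSubst k M Q)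
  | _, k, M, lett P Q => lett (ctxSubst k (M.ren (up Nat.succ) id) P) (ctxSubst k M Q)
  | _, k, M, mu J => mu (ctxSubst (k + 1) M.wkC J)
  | _, k, M, jmp l Q =>
      if l = k then jmp l (lett M (ctxSubst k M Q)) else jmp l (ctxSubst k M Q)

/-- Values are the variables and the lambda abstractions. -/
def IsValue : Tm .term → Prop
  | var _ => True
  | lam _ => True
  | _ => False

/-! ### The source calculus: identification and reduction -/

/-- The smallest compatible relation that contains `R` (one use of `R`, anywhere in a term). -/
inductive Compat (R : ∀ s : Kind, Tm s → Tm s → Prop) : ∀ s : Kind, Tm s → Tm s → Prop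
  | base {s : Kind} {P Q : Tm s} : R s P Q → Compat R s P Q
  | lam {M M' : Tm .term} : Compat R .term M M' → Compat R .term (lam M) (lam M')
  | appL {M M' N : Tm .term} : Compat R .term M M' → Compat R .term (app M N) (app M' N)
  | appR {M N N' : Tm .term} : Compat R .term N N' → Compat R .term (app M N) (app M N')
  | lettL {s : Kind} {L L' : Tm s} {M : Tm .term} :
      Compat R s L L' → Compat R s (lett L M) (lett L' M)
  | lettR {s : Kind} {L : Tm s} {M M' : Tm .term} :
      Compat R .term M M' → Compat R s (lett L M) (lett L M')
  | mu {J J' : Tm .jump} : Compat R .jump J J' → Compat R .term (mu J) (mu J')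
  | jmp {k : ℕ} {M M' : Tm .term} : Compat R .term M M' → Compat R .jump (jmp k M) (jmp k M')

/-- The equality axioms
`⌈L x:=⌈M y:=N⌋⌋ = ⌈⌈L x:=M⌋ y:=N⌋` (`y` not free in `L`),
`⌈(μk.J) x:=M⌋ = μk.⌈J x:=M⌋` (`k` not free in `M`),
`[k]⌈L x:=M⌋ = ⌈([k]L) x:=M⌋`. -/
inductive EqAx : ∀ s : Kind, Tm s → Tm s → Prop
  | assoc (L M N : Tm .term) :
      EqAx .term (lett L (lett M N)) (lett (lett (L.ren (up Nat.succ) id) M) N)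
  | muLet (J : Tm .jump) (M : Tm .term) :
      EqAx .term (lett (mu J) M) (mu (lett J M.wkC))
  | jmpLet (k : ℕ) (L M : Tm .term) :
      EqAx .jump (jmp k (lett L M)) (lett (jmp k L) M)

/-- The identification of terms: the congruence generated by the equality axioms. -/
def Ident {s : Kind} : Tm s → Tm s → Prop := Relation.EqvGen (Compat EqAx s)

/-- The reduction rules of the CCV calculus. -/
inductive Rule : ∀ s : Kind, Tm s → Tm s → Prop
  /-- `N M → ⌈z M z:=N⌋` -/
  | ad₁ {N : Tm .term} (M : Tm .term) (hN : ¬ N.IsValue) :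
      Rule .term (app N M) (lett (app (var 0) M.wkO) N)
  /-- `V N → ⌈V z z:=N⌋` -/
  | ad₂ {V N : Tm .term} (hV : V.IsValue) (hN : ¬ N.IsValue) :
      Rule .term (app V N) (lett (app V.wkO (var 0)) N)
  /-- `(λx.M) V → ⌈M x:=V⌋` -/
  | betaLam (M : Tm .term) {V : Tm .term} (hV : V.IsValue) :
      Rule .term (app (lam M) V) (lett M V)
  /-- `⌈M x:=V⌋ → M{V/x}` -/
  | betaLet (M : Tm .term) {V : Tm .term} (hV : V.IsValue) :
      Rule .term (lett M V) (M.substO V)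
  /-- `⌈M x:=μk.J⌋ → μk.J{[k]□ ↦ [k]⌈M x:=□⌋}` -/
  | betaMu (M : Tm .term) (J : Tm .jump) :
      Rule .term (lett M (mu J)) (mu (ctxSubst 0 M.wkC J))
  /-- `[l]μk.J → J{l/k}` -/
  | betaJmp (l : ℕ) (J : Tm .jump) :
      Rule .jump (jmp l (mu J)) (J.substC l)
  /-- `λx.V x → V`, `x` not free in `V` -/
  | etaLam {V : Tm .term} (hV : V.IsValue) :
      Rule .term (lam (app V.wkO (var 0))) V
  /-- `⌈x x:=M⌋ → M` -/
  | etaLet (M : Tm .term) : Rule .term (lett (var 0) M) M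
  /-- `μk.[k]M → M`, `k` not free in `M` -/
  | etaMu (M : Tm .term) : Rule .term (mu (jmp 0 M.wkC)) M

/-- One-step reduction of identified terms: a rule may be applied to a subterm of any syntax
tree that represents the term. -/
def Step {s : Kind} (P Q : Tm s) : Prop :=
  ∃ P' Q' : Tm s, Ident P P' ∧ Compat Rule s P' Q' ∧ Ident Q' Q

/-- The number of nodes of a syntax tree. -/
def size : {s : Kind} → Tm s → ℕ
  | _, var _ => 1
  | _, lam M => size M + 1
  | _, app M N => size M + size N + 1
  | _, lett L M => size L + size M + 1
  | _, mu J => size J + 1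
  | _, jmp _ M => size M + 1

theorem size_ren {s : Kind} (P : Tm s) : ∀ f g : ℕ → ℕ, (P.ren f g).size = P.size := by
  induction P <;> intro f g <;> simp [ren, size, *]

theorem size_wkO {s : Kind} (P : Tm s) : P.wkO.size = P.size := size_ren P _ _

theorem size_wkC {s : Kind} (P : Tm s) : P.wkC.size = P.size := size_ren P _ _

end Tm

/-! ### The target calculus -/

/-- The four sorts of the target calculus: terms, jumps, values, continuations. -/
inductive TSort
  | T
  | Q
  | W
  | K

/-- The sorted lambda calculus `T ::= λk.Q | W W`, `Q ::= K W | T K`, `W ::= x | λx.T`,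
`K ::= k | λx.Q`. -/
inductive Tgt : TSort → Type
  | lamT (q : Tgt .Q) : Tgt .T
  | appWW (v w : Tgt .W) : Tgt .T
  | appKW (c : Tgt .K) (w : Tgt .W) : Tgt .Q
  | appTK (t : Tgt .T) (c : Tgt .K) : Tgt .Q
  | var (x : ℕ) : Tgt .W
  | lamW (t : Tgt .T) : Tgt .W
  | cvar (k : ℕ) : Tgt .K
  | lamK (q : Tgt .Q) : Tgt .K

namespace Tgt

/-- Renaming of free variables, `f` on ordinary and `g` on continuation variables. -/
def ren : {s : TSort} → (ℕ → ℕ) → (ℕ → ℕ) → Tgt s → Tgt s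
  | _, f, g, lamT q => lamT (ren f (up g) q)
  | _, f, g, appWW v w => appWW (ren f g v) (ren f g w)
  | _, f, g, appKW c w => appKW (ren f g c) (ren f g w)
  | _, f, g, appTK t c => appTK (ren f g t) (ren f g c)
  | _, f, _, var x => var (f x)
  | _, f, g, lamW t => lamW (ren (up f) g t)
  | _, _, g, cvar k => cvar (g k)
  | _, f, g, lamK q => lamK (ren (up f) g q)

/-- Weakening by a fresh ordinary variable `0`. -/
def wkO {s : TSort} (t : Tgt s) : Tgt s := t.ren Nat.succ id

/-- Weakening by a fresh continuation variable `0`. -/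
def wkC {s : TSort} (t : Tgt s) : Tgt s := t.ren id Nat.succ

/-- Extend a substitution for ordinary variables under a binder `λx`. -/
def upO (σ : ℕ → Tgt .W) : ℕ → Tgt .W
  | 0 => var 0
  | n + 1 => (σ n).wkO

/-- Extend a substitution for continuation variables under a binder `λk`. -/
def upC (τ : ℕ → Tgt .K) : ℕ → Tgt .K
  | 0 => cvar 0
  | n + 1 => (τ n).wkC

/-- Capture-avoiding simultaneous substitution. -/
def subst : {s : TSort} → (ℕ → Tgt .W) → (ℕ → Tgt .K) → Tgt s → Tgt s
  | _, σ, τ, lamT q => lamT (subst (fun n => (σ n).wkC) (upC τ) q)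
  | _, σ, τ, appWW v w => appWW (subst σ τ v) (subst σ τ w)
  | _, σ, τ, appKW c w => appKW (subst σ τ c) (subst σ τ w)
  | _, σ, τ, appTK t c => appTK (subst σ τ t) (subst σ τ c)
  | _, σ, _, var x => σ x
  | _, σ, τ, lamW t => lamW (subst (upO σ) (fun n => (τ n).wkO) t)
  | _, _, τ, cvar k => τ k
  | _, σ, τ, lamK q => lamK (subst (upO σ) (fun n => (τ n).wkO) q)

/-- The assignment `0 ↦ w`, `n + 1 ↦ n`. -/
def instO (w : Tgt .W) : ℕ → Tgt .W
  | 0 => w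
  | n + 1 => var n

/-- The assignment `0 ↦ c`, `n + 1 ↦ n`. -/
def instC (c : Tgt .K) : ℕ → Tgt .K
  | 0 => c
  | n + 1 => cvar n

/-- Substitution for the ordinary variable `0`, which disappears. -/
def substO {s : TSort} (t : Tgt s) (w : Tgt .W) : Tgt s := t.subst (instO w) cvar

/-- Substitution for the continuation variable `0`, which disappears. -/
def substC {s : TSort} (t : Tgt s) (c : Tgt .K) : Tgt s := t.subst var (instC c)

/-- One-step `βη`-reduction: the compatible closure of `(λv.A) B → A{B/v}` and of
`λv.A v → A` (`v` not free in `A`), for all sorts of `A` and `B`. -/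
inductive BetaEta : ∀ s : TSort, Tgt s → Tgt s → Prop
  | betaT (q : Tgt .Q) (c : Tgt .K) : BetaEta .Q (appTK (lamT q) c) (q.substC c)
  | betaW (t : Tgt .T) (w : Tgt .W) : BetaEta .T (appWW (lamW t) w) (t.substO w)
  | betaK (q : Tgt .Q) (w : Tgt .W) : BetaEta .Q (appKW (lamK q) w) (q.substO w)
  | etaT (t : Tgt .T) : BetaEta .T (lamT (appTK t.wkC (cvar 0))) t
  | etaW (w : Tgt .W) : BetaEta .W (lamW (appWW w.wkO (var 0))) w
  | etaK (c : Tgt .K) : BetaEta .K (lamK (appKW c.wkO (var 0))) c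
  | lamT {q q' : Tgt .Q} : BetaEta .Q q q' → BetaEta .T (lamT q) (lamT q')
  | appWWL {v v' w : Tgt .W} : BetaEta .W v v' → BetaEta .T (appWW v w) (appWW v' w)
  | appWWR {v w w' : Tgt .W} : BetaEta .W w w' → BetaEta .T (appWW v w) (appWW v w')
  | appKWL {c c' : Tgt .K} {w : Tgt .W} :
      BetaEta .K c c' → BetaEta .Q (appKW c w) (appKW c' w)
  | appKWR {c : Tgt .K} {w w' : Tgt .W} :
      BetaEta .W w w' → BetaEta .Q (appKW c w) (appKW c w')
  | appTKL {t t' : Tgt .T} {c : Tgt .K} :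
      BetaEta .T t t' → BetaEta .Q (appTK t c) (appTK t' c)
  | appTKR {t : Tgt .T} {c c' : Tgt .K} :
      BetaEta .K c c' → BetaEta .Q (appTK t c) (appTK t c')
  | lamW {t t' : Tgt .T} : BetaEta .T t t' → BetaEta .W (lamW t) (lamW t')
  | lamK {q q' : Tgt .Q} : BetaEta .Q q q' → BetaEta .K (lamK q) (lamK q')

end Tgt

/-! ### The CPS translation -/

open Tm in
mutual

/-- The translation `⌊M⌋[K]` of a term with respect to a continuation `K`. -/
def colon : Tm .term → Tgt .K → Tgt .Q
  | var x, c => .appKW c (.var x)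
  | lam M, c => .appKW c (.lamW (.lamT (colon M.wkC (.cvar 0))))
  | app M N, c =>
      match star M, star N with
      | some v, some w => .appTK (.appWW v w) c
      | some v, none => colon N (.lamK (.appTK (.appWW v.wkO (.var 0)) c.wkO))
      | none, some w => colon M (.lamK (.appTK (.appWW (.var 0) w.wkO) c.wkO))
      | none, none =>
          colon M (.lamK (colon N.wkO
            (.lamK (.appTK (.appWW (.var 1) (.var 0)) c.wkO.wkO))))
  | lett L M, c => colon M (.lamK (colon L c.wkO))
  | mu J, c => .appTK (.lamT (colonJ J)) c
termination_by M => M.size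
decreasing_by all_goals (simp only [size, size_wkO, size_wkC]; omega)

/-- The translation `⌊J⌋` of a jump. -/
def colonJ : Tm .jump → Tgt .Q
  | jmp k M => colon M (.cvar k)
  | lett J M => colon M (.lamK (colonJ J))
termination_by J => J.size
decreasing_by all_goals (simp only [size]; omega)

/-- The translation `V*` of a value; it is `none` exactly on the non-values. -/
def star : Tm .term → Option (Tgt .W)
  | var x => some (.var x)
  | lam M => some (.lamW (.lamT (colon M.wkC (.cvar 0))))
  | _ => none
termination_by M => M.size
decreasing_by all_goals (simp only [size, size_wkC]; omega)

end

/-- The CPS translation `⟦M⟧ = λk.⌊M⌋[k]`, `k` fresh. -/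
def cps (M : Tm .term) : Tgt .T := .lamT (colon M.wkC (.cvar 0))

end CCV

-- The proof runs through an inverse translation `back` from the target to the source. A target jump
-- becomes a pair `(l, M)` standing for `[l]M`, a continuation becomes `[l]□` or `[l]⌈P x:=□⌋`, and
-- `λk.Q` becomes `μk.[l]M`, contracted at once to `M` when `l = k` is not free in `M`. Four facts
-- carry the theorem.
--
-- (1) `red_back_cps`: modulo the identification, `M` reduces to `back (cps M)`. The round trip only
-- names non-value arguments and contracts some `μk.[k]N`.
--
-- (2) `back_step`: a target step from `t` to `u` yields at least one source step from `back t` to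
-- `back u`, or else an identification, and in the latter case `u` has fewer nodes than `t`. (Jumps
-- and continuations need a variant of this statement.)
--
-- (3) `normalSem_back`: an irreducible target term is sent to one that satisfies `IsNormal`, a
-- criterion that is invariant under the identification and excludes every source step.
--
-- (4) `Ident.conv_cps` and `Step.conv_cps`: identified terms and reducts have `βη`-equal
-- translations. As `βη` is confluent (`confluence`), normalizability is invariant under
-- `βη`-equality.
--
-- If `cps M` reduces to an irreducible `t`, then by (1) and (2) `M` reduces to `back t`, which is
-- irreducible by (3). Conversely, let `M` reduce to an irreducible `N`. By (1), `back (cps N)` can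
-- only be identified with `N`, so it is irreducible too. By (2) every target reduction from `cps N`
-- then shrinks the term at each step and must stop. By (4) normalizability passes from `cps N` to
-- `cps M`.

namespace CCV

-- Renaming and simultaneous substitution in the source.

theorem up_comp (f g : ℕ → ℕ) : up (f ∘ g) = up f ∘ up g := by
  funext n; cases n <;> rfl

@[simp] theorem up_id : up id = id := by
  funext n; cases n <;> rfl

namespace Tm

theorem ren_ren {s : Kind} (M : Tm s) : ∀ f g f' g' : ℕ → ℕ,
    (M.ren f g).ren f' g' = M.ren (f' ∘ f) (g' ∘ g) := by
  induction M <;> intro f g f' g' <;> simp_all [ren, up_comp]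

@[simp] theorem ren_id {s : Kind} (M : Tm s) : M.ren id id = M := by
  induction M <;> simp_all [ren]

/-- A continuation `[l]□` or `[l]⌈P x:=□⌋`. -/
abbrev Cont := ℕ × Option (Tm .term)

/-- `M` itself, or `⌈P x:=M⌋`. -/
def plug : Option (Tm .term) → Tm .term → Tm .term
  | none, M => M
  | some P, M => lett P M

/-- Renaming of free variables in a continuation. -/
def renCont (f g : ℕ → ℕ) (κ : Cont) : Cont := (g κ.1, κ.2.map (ren (up f) g))

/-- Extend a continuation assignment under a binder of a continuation variable. -/
def upCont (θ : ℕ → Cont) : ℕ → Cont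
  | 0 => (0, none)
  | n + 1 => renCont id Nat.succ (θ n)

/-- Simultaneous substitution for the ordinary and the continuation variables. -/
def msub : {s : Kind} → (ℕ → Tm .term) → (ℕ → Cont) → Tm s → Tm s
  | _, σ, _, var x => σ x
  | _, σ, θ, lam M => lam (msub (upSubst σ) (renCont Nat.succ id ∘ θ) M)
  | _, σ, θ, app M N => app (msub σ θ M) (msub σ θ N)
  | _, σ, θ, lett L M => lett (msub (upSubst σ) (renCont Nat.succ id ∘ θ) L) (msub σ θ M)
  | _, σ, θ, mu J => mu (msub (wkC ∘ σ) (upCont θ) J)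
  | _, σ, θ, jmp k M => jmp (θ k).1 (plug (θ k).2 (msub σ θ M))

theorem ren_plug (f g : ℕ → ℕ) (o : Option (Tm .term)) (M : Tm .term) :
    (plug o M).ren f g = plug (o.map (ren (up f) g)) (M.ren f g) := by
  cases o <;> rfl

theorem renCont_renCont (f g f' g' : ℕ → ℕ) (κ : Cont) :
    renCont f' g' (renCont f g κ) = renCont (f' ∘ f) (g' ∘ g) κ := by
  obtain ⟨l, _ | P⟩ := κ <;> simp [renCont, ren_ren, up_comp]

theorem upSubst_ren (σ : ℕ → Tm .term) (f : ℕ → ℕ) : upSubst (σ ∘ f) = upSubst σ ∘ up f := by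
  funext n; cases n <;> rfl

theorem upCont_ren (θ : ℕ → Cont) (g : ℕ → ℕ) : upCont (θ ∘ g) = upCont θ ∘ up g := by
  funext n; cases n <;> rfl

theorem ren_upSubst (σ : ℕ → Tm .term) (f g : ℕ → ℕ) :
    upSubst (ren f g ∘ σ) = ren (up f) g ∘ upSubst σ := by
  funext n
  cases n with
  | zero => rfl
  | succ n => simp only [upSubst, Function.comp, wkO, ren_ren]; rfl

theorem ren_upCont (θ : ℕ → Cont) (f g : ℕ → ℕ) :
    upCont (renCont f g ∘ θ) = renCont f (up g) ∘ upCont θ := by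
  funext n
  cases n with
  | zero => rfl
  | succ n => simp only [upCont, Function.comp, renCont_renCont]; rfl

theorem renCont_succ_comm (θ : ℕ → Cont) (f g : ℕ → ℕ) :
    renCont Nat.succ id ∘ renCont f g ∘ θ = renCont (up f) g ∘ renCont Nat.succ id ∘ θ := by
  funext n
  simp only [Function.comp, renCont_renCont]; rfl

theorem ren_wkC_comm (σ : ℕ → Tm .term) (f g : ℕ → ℕ) :
    wkC ∘ ren f g ∘ σ = ren f (up g) ∘ wkC ∘ σ := by
  funext n
  simp only [Function.comp, wkC, ren_ren]; rfl

/-- Renaming, ordinary substitution and context substitution are all instances of `msub`, so the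
commutation laws with renamings are proved for `msub` alone and then specialized. -/
theorem msub_ren {s : Kind} (M : Tm s) : ∀ (σ : ℕ → Tm .term) (θ : ℕ → Cont) (f g : ℕ → ℕ),
    msub σ θ (M.ren f g) = msub (σ ∘ f) (θ ∘ g) M := by
  induction M <;> intro σ θ f g <;>
    simp_all [ren, msub, upSubst_ren, upCont_ren, Function.comp_assoc]

theorem ren_msub {s : Kind} (M : Tm s) : ∀ (σ : ℕ → Tm .term) (θ : ℕ → Cont) (f g : ℕ → ℕ),
    (msub σ θ M).ren f g = msub (ren f g ∘ σ) (renCont f g ∘ θ) M := by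
  induction M <;> intro σ θ f g <;>
    simp_all [ren, msub, ren_upSubst, ren_upCont, renCont_succ_comm, ren_wkC_comm, ren_plug]
  exact ⟨rfl, rfl⟩

@[simp] theorem upSubst_var : upSubst var = var := by
  funext n; cases n <;> rfl

theorem ren_eq_msub {s : Kind} (M : Tm s) (f g : ℕ → ℕ) :
    M.ren f g = msub (var ∘ f) (fun n => (g n, none)) M := by
  have key : ∀ {s : Kind} (M : Tm s), msub var (fun n => (n, none)) M = M := by
    intro s M
    have h1 : renCont Nat.succ id ∘ (fun n => ((n, none) : Cont)) = fun n => (n, none) := rfl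
    have h2 : upCont (fun n => ((n, none) : Cont)) = fun n => (n, none) := by
      funext n; cases n <;> rfl
    have h3 : wkC ∘ var = var := rfl
    induction M <;> simp_all [msub, plug]
  rw [← key (M.ren f g), msub_ren]; rfl

theorem subst_eq_msub {s : Kind} (M : Tm s) : ∀ (σ : ℕ → Tm .term),
    M.subst σ = msub σ (fun n => (n, none)) M := by
  have h1 : renCont Nat.succ id ∘ (fun n => ((n, none) : Cont)) = fun n => (n, none) := rfl
  have h2 : upCont (fun n => ((n, none) : Cont)) = fun n => (n, none) := by
    funext n; cases n <;> rfl
  have h3 : ∀ σ : ℕ → Tm .term, (fun n => (σ n).wkC) = wkC ∘ σ := fun _ => rfl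
  induction M <;> intro σ <;> simp_all [msub, plug, subst]

/-- The assignment `k ↦ [k]⌈P x:=□⌋`, `n ↦ [n]□` for `n ≠ k`. -/
def single (k : ℕ) (P : Tm .term) (n : ℕ) : Cont := (n, if n = k then some P else none)

theorem ctxSubst_eq_msub {s : Kind} (M : Tm s) : ∀ (k : ℕ) (P : Tm .term),
    ctxSubst k P M = msub var (single k P) M := by
  have h1 : ∀ k P, renCont Nat.succ id ∘ single k P = single k (P.ren (up Nat.succ) id) := by
    intro k P; funext n; simp only [Function.comp, renCont, single]; split_ifs <;> rfl
  have h2 : ∀ k P, upCont (single k P) = single (k + 1) P.wkC := by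
    intro k P; funext n
    cases n with
    | zero => simp [upCont, single]
    | succ n =>
      by_cases h : n = k <;> simp [upCont, single, renCont, h, wkC]
  have h3 : wkC ∘ var = var := rfl
  induction M with
  | jmp l Q ih =>
    intro k P
    by_cases h : l = k <;> simp [ctxSubst, msub, single, h, plug, ih]
  | _ => intro k P; simp_all [ctxSubst, msub]

theorem ren_substO {s : Kind} (M : Tm s) (V : Tm .term) (f g : ℕ → ℕ) :
    (M.substO V).ren f g = (M.ren (up f) g).substO (V.ren f g) := by
  simp only [substO, subst_eq_msub, ren_msub, msub_ren]
  congr 1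
  funext n; cases n <;> rfl

theorem ren_substC {s : Kind} (M : Tm s) (l : ℕ) (f g : ℕ → ℕ) :
    (M.substC l).ren f g = (M.ren f (up g)).substC (g l) := by
  simp only [substC, ren_ren]
  congr 1
  funext n; cases n <;> rfl

theorem ren_ctxSubst {s : Kind} (J : Tm s) (M : Tm .term) (f g : ℕ → ℕ) :
    (ctxSubst 0 M.wkC J).ren f (up g) = ctxSubst 0 (M.ren (up f) g).wkC (J.ren f (up g)) := by
  simp only [ctxSubst_eq_msub, ren_msub, msub_ren]
  congr 1
  funext n
  cases n with
  | zero => simp only [Function.comp, renCont, single, wkC, up, if_true, Option.map_some, ren_ren]; rfl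
  | succ n => simp [Function.comp, renCont, single, up]

theorem isValue_ren {V : Tm .term} (f g : ℕ → ℕ) : (V.ren f g).IsValue ↔ V.IsValue := by
  cases V <;> simp [ren, IsValue]

theorem ren_wkO (M : Tm .term) (f g : ℕ → ℕ) : M.wkO.ren (up f) g = (M.ren f g).wkO := by
  simp only [wkO, ren_ren]; rfl

theorem ren_wkC (M : Tm .term) (f g : ℕ → ℕ) : M.wkC.ren f (up g) = (M.ren f g).wkC := by
  simp only [wkC, ren_ren]; rfl

theorem Rule.ren {s : Kind} {P Q : Tm s} (h : Rule s P Q) (f g : ℕ → ℕ) :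
    Rule s (P.ren f g) (Q.ren f g) := by
  cases h with
  | ad₁ M hN =>
    simp only [Tm.ren, ren_wkO]
    exact .ad₁ _ (by rwa [isValue_ren])
  | ad₂ hV hN =>
    simp only [Tm.ren, ren_wkO]
    exact .ad₂ (by rwa [isValue_ren]) (by rwa [isValue_ren])
  | betaLam M hV => exact .betaLam _ (by rwa [isValue_ren])
  | betaLet M hV =>
    rw [ren_substO]
    exact .betaLet _ (by rwa [isValue_ren])
  | betaMu M J =>
    simp only [Tm.ren, ren_ctxSubst]
    exact .betaMu _ _
  | betaJmp l J =>
    rw [ren_substC]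
    exact .betaJmp _ _
  | etaLam hV =>
    simp only [Tm.ren, ren_wkO]
    exact .etaLam (by rwa [isValue_ren])
  | etaLet M => exact .etaLet _
  | etaMu M =>
    simp only [Tm.ren, ren_wkC]
    exact .etaMu _

theorem EqAx.ren {s : Kind} {P Q : Tm s} (h : EqAx s P Q) (f g : ℕ → ℕ) :
    EqAx s (P.ren f g) (Q.ren f g) := by
  cases h with
  | assoc L M N =>
    have := EqAx.assoc (L.ren (up f) g) (M.ren (up f) g) (N.ren f g)
    simp only [Tm.ren, ren_ren, ← up_comp] at this ⊢
    exact this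
  | muLet J M =>
    simp only [Tm.ren, ren_wkC]
    exact .muLet _ _
  | jmpLet k L M => exact .jmpLet _ _ _

theorem Compat.ren {R : ∀ s : Kind, Tm s → Tm s → Prop}
    (hR : ∀ {s : Kind} {P Q : Tm s}, R s P Q → ∀ f g : ℕ → ℕ, R s (P.ren f g) (Q.ren f g))
    {s : Kind} {P Q : Tm s} (h : Compat R s P Q) : ∀ f g : ℕ → ℕ,
    Compat R s (P.ren f g) (Q.ren f g) := by
  induction h with
  | base h => exact fun f g => .base (hR h f g)
  | lam _ ih => exact fun f g => .lam (ih _ _)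
  | appL _ ih => exact fun f g => .appL (ih _ _)
  | appR _ ih => exact fun f g => .appR (ih _ _)
  | lettL _ ih => exact fun f g => .lettL (ih _ _)
  | lettR _ ih => exact fun f g => .lettR (ih _ _)
  | mu _ ih => exact fun f g => .mu (ih _ _)
  | jmp _ ih => exact fun f g => .jmp (ih _ _)

/-! ### The identification as a congruence -/

theorem Ident.refl {s : Kind} (P : Tm s) : Ident P P := Relation.EqvGen.refl P

theorem Ident.symm {s : Kind} {P Q : Tm s} (h : Ident P Q) : Ident Q P := Relation.EqvGen.symm _ _ h

theorem Ident.trans {s : Kind} {P Q R : Tm s} (h : Ident P Q) (h' : Ident Q R) : Ident P R :=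
  Relation.EqvGen.trans _ _ _ h h'

theorem Ident.of_eq {s : Kind} {P Q : Tm s} (h : P = Q) : Ident P Q := h ▸ Ident.refl P

theorem Ident.of_eqAx {s : Kind} {P Q : Tm s} (h : EqAx s P Q) : Ident P Q :=
  Relation.EqvGen.rel _ _ (.base h)

theorem Ident.map {s s' : Kind} (F : Tm s → Tm s')
    (hF : ∀ P Q, Compat EqAx s P Q → Compat EqAx s' (F P) (F Q)) {P Q : Tm s} (h : Ident P Q) :
    Ident (F P) (F Q) := by
  induction h with
  | rel _ _ h => exact Relation.EqvGen.rel _ _ (hF _ _ h)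
  | refl => exact Ident.refl _
  | symm _ _ _ ih => exact ih.symm
  | trans _ _ _ _ _ ih ih' => exact ih.trans ih'

/-- A function that preserves single uses of an equality axiom and of a reduction rule. -/
structure IsContext {s s' : Kind} (F : Tm s → Tm s') : Prop where
  ident : ∀ P Q, Compat EqAx s P Q → Compat EqAx s' (F P) (F Q)
  rule : ∀ P Q, Compat Rule s P Q → Compat Rule s' (F P) (F Q)

theorem isContext_lam : IsContext lam := ⟨fun _ _ => .lam, fun _ _ => .lam⟩

theorem isContext_appL (N : Tm .term) : IsContext (fun M => app M N) :=
  ⟨fun _ _ => .appL, fun _ _ => .appL⟩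

theorem isContext_appR (M : Tm .term) : IsContext (app M) := ⟨fun _ _ => .appR, fun _ _ => .appR⟩

theorem isContext_lettL {s : Kind} (M : Tm .term) : IsContext (fun L : Tm s => lett L M) :=
  ⟨fun _ _ => .lettL, fun _ _ => .lettL⟩

theorem isContext_lettR {s : Kind} (L : Tm s) : IsContext (lett L) :=
  ⟨fun _ _ => .lettR, fun _ _ => .lettR⟩

theorem isContext_mu : IsContext mu := ⟨fun _ _ => .mu, fun _ _ => .mu⟩

theorem isContext_jmp (k : ℕ) : IsContext (jmp k) := ⟨fun _ _ => .jmp, fun _ _ => .jmp⟩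

theorem isContext_plug (o : Option (Tm .term)) : IsContext (plug o) := by
  cases o with
  | none => exact ⟨fun _ _ h => h, fun _ _ h => h⟩
  | some P => exact isContext_lettR P

/-- Counting renamings among the contexts lets weakening and its inverse `lowerC` be applied along a
reduction in the same way as a term constructor. -/
theorem isContext_ren {s : Kind} (f g : ℕ → ℕ) : IsContext (ren (s := s) f g) :=
  ⟨fun _ _ h => h.ren EqAx.ren f g, fun _ _ h => h.ren Rule.ren f g⟩

theorem Ident.ctx {s s' : Kind} {F : Tm s → Tm s'} (hF : IsContext F) {P Q : Tm s}
    (h : Ident P Q) : Ident (F P) (F Q) := h.map F hF.ident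

theorem Ident.lett {s : Kind} {L L' : Tm s} {M M' : Tm .term} (h : Ident L L') (h' : Ident M M') :
    Ident (lett L M) (lett L' M') :=
  (h.ctx (isContext_lettL M)).trans (h'.ctx (isContext_lettR L'))

theorem Ident.app {M M' N N' : Tm .term} (h : Ident M M') (h' : Ident N N') :
    Ident (app M N) (app M' N') :=
  (h.ctx (isContext_appL N)).trans (h'.ctx (isContext_appR M'))

/-! ### Reduction modulo the identification -/

theorem Step.of_rule {s : Kind} {P Q : Tm s} (h : Rule s P Q) : Step P Q :=
  ⟨P, Q, Ident.refl P, .base h, Ident.refl Q⟩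

theorem Step.ctx {s s' : Kind} {F : Tm s → Tm s'} (hF : IsContext F) {P Q : Tm s}
    (h : Step P Q) : Step (F P) (F Q) := by
  obtain ⟨P', Q', h1, h2, h3⟩ := h
  exact ⟨_, _, h1.ctx hF, hF.rule _ _ h2, h3.ctx hF⟩

theorem Step.ident_left {s : Kind} {P Q R : Tm s} (h : Ident P Q) (h' : Step Q R) : Step P R := by
  obtain ⟨P', Q', h1, h2, h3⟩ := h'
  exact ⟨_, _, h.trans h1, h2, h3⟩

theorem Step.ident_right {s : Kind} {P Q R : Tm s} (h : Step P Q) (h' : Ident Q R) : Step P R := by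
  obtain ⟨P', Q', h1, h2, h3⟩ := h
  exact ⟨_, _, h1, h2, h3.trans h'⟩

/-- At least one reduction step, or, provided that `p` holds, an identification. -/
def Sim (p : Prop) {s : Kind} (P Q : Tm s) : Prop :=
  Relation.TransGen Step P Q ∨ (p ∧ Ident P Q)

theorem Sim.of_ident {p : Prop} {s : Kind} {P Q : Tm s} (hp : p) (h : Ident P Q) : Sim p P Q :=
  .inr ⟨hp, h⟩

theorem Sim.of_step {p : Prop} {s : Kind} {P Q : Tm s} (h : Step P Q) : Sim p P Q :=
  .inl (.single h)

theorem Sim.of_rule {p : Prop} {s : Kind} {P Q : Tm s} (h : Rule s P Q) : Sim p P Q :=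
  .of_step (.of_rule h)

theorem Sim.mono {p q : Prop} (hpq : p → q) {s : Kind} {P Q : Tm s} (h : Sim p P Q) :
    Sim q P Q := h.imp_right (fun h => ⟨hpq h.1, h.2⟩)

theorem Sim.ctx {p : Prop} {s s' : Kind} {F : Tm s → Tm s'} (hF : IsContext F) {P Q : Tm s}
    (h : Sim p P Q) : Sim p (F P) (F Q) :=
  h.imp (fun h => Relation.TransGen.lift F (fun _ _ => Step.ctx hF) _ _ h)
    (fun h => ⟨h.1, h.2.ctx hF⟩)

/-- `Step` is defined modulo the identification, so a nonempty sequence absorbs identifications at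
its ends. An empty one cannot, which is why `Sim` keeps the two alternatives apart. -/
theorem transGen_ident_left {s : Kind} {P Q R : Tm s} (h : Ident P Q)
    (h' : Relation.TransGen Step Q R) : Relation.TransGen Step P R := by
  induction h' with
  | single h' => exact .single (h'.ident_left h)
  | tail _ h'' ih => exact .tail ih h''

theorem transGen_ident_right {s : Kind} {P Q R : Tm s} (h : Relation.TransGen Step P Q)
    (h' : Ident Q R) : Relation.TransGen Step P R := by
  cases h with
  | single h => exact .single (h.ident_right h')
  | tail h h'' => exact .tail h (h''.ident_right h')

theorem Sim.ident_left {p : Prop} {s : Kind} {P Q R : Tm s} (h : Ident P Q) (h' : Sim p Q R) :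
    Sim p P R :=
  h'.imp (transGen_ident_left h) (fun h' => ⟨h'.1, h.trans h'.2⟩)

theorem Sim.ident_right {p : Prop} {s : Kind} {P Q R : Tm s} (h : Sim p P Q) (h' : Ident Q R) :
    Sim p P R :=
  h.imp (transGen_ident_right · h') (fun h => ⟨h.1, h.2.trans h'⟩)

/-- The composite is a mere identification only if both parts are. A genuine step can be given the
label `False`, so that composing with it always produces a reduction. -/
theorem Sim.trans {p q : Prop} {s : Kind} {P Q R : Tm s} (h : Sim p P Q) (h' : Sim q Q R) :
    Sim (p ∧ q) P R := by
  rcases h with h | ⟨hp, h⟩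
  · rcases h' with h' | ⟨hq, h'⟩
    · exact .inl (h.trans h')
    · exact .inl (transGen_ident_right h h')
  · rcases h' with h' | ⟨hq, h'⟩
    · exact .inl (transGen_ident_left h h')
    · exact .inr ⟨⟨hp, hq⟩, h.trans h'⟩

/-- Finitely many reduction steps, up to the identification. -/
abbrev Red {s : Kind} (P Q : Tm s) : Prop := Sim True P Q

theorem Red.refl {s : Kind} (P : Tm s) : Red P P := .of_ident trivial (.refl P)

theorem Red.trans {s : Kind} {P Q R : Tm s} (h : Red P Q) (h' : Red Q R) : Red P R :=
  (Sim.trans h h').mono (fun _ => trivial)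

end Tm

end CCV

namespace CCV

namespace Tm

/-! ### Occurrences of free variables -/

/-- The number of free occurrences of the continuation variable `k`. -/
def cntC : {s : Kind} → ℕ → Tm s → ℕ
  | _, _, var _ => 0
  | _, k, lam M => cntC k M
  | _, k, app M N => cntC k M + cntC k N
  | _, k, lett L M => cntC k L + cntC k M
  | _, k, mu J => cntC (k + 1) J
  | _, k, jmp l M => (if l = k then 1 else 0) + cntC k M

/-- The number of free occurrences of the ordinary variable `k`. -/
def cntO : {s : Kind} → ℕ → Tm s → ℕ
  | _, k, var x => if x = k then 1 else 0
  | _, k, lam M => cntO (k + 1) M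
  | _, k, app M N => cntO k M + cntO k N
  | _, k, lett L M => cntO (k + 1) L + cntO k M
  | _, k, mu J => cntO k J
  | _, k, jmp _ M => cntO k M

theorem up_eq_succ_iff {f : ℕ → ℕ} {k k' : ℕ} (h : ∀ n, f n = k' ↔ n = k) (n : ℕ) :
    up f n = k' + 1 ↔ n = k + 1 := by
  cases n <;> simp [up, h]

theorem up_eq_zero_iff (f : ℕ → ℕ) (n : ℕ) : up f n = 0 ↔ n = 0 := by
  cases n <;> simp [up]

theorem cntC_ren {s : Kind} (M : Tm s) : ∀ (f : ℕ → ℕ) {g : ℕ → ℕ} {k k' : ℕ},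
    (∀ n, g n = k' ↔ n = k) → cntC k' (M.ren f g) = cntC k M := by
  induction M with
  | mu J ih => exact fun f g k k' h => ih _ (up_eq_succ_iff h)
  | jmp l M ih => intro f g k k' h; simp only [ren, cntC, ih _ h, h]
  | var => intros; rfl
  | lam M ih => exact fun f g k k' h => ih _ h
  | app M N ih ih' => intro f g k k' h; simp only [ren, cntC, ih _ h, ih' _ h]
  | lett M N ih ih' => intro f g k k' h; simp only [ren, cntC, ih _ h, ih' _ h]

theorem cntO_ren {s : Kind} (M : Tm s) : ∀ {f : ℕ → ℕ} (g : ℕ → ℕ) {k k' : ℕ},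
    (∀ n, f n = k' ↔ n = k) → cntO k' (M.ren f g) = cntO k M := by
  induction M with
  | mu J ih => exact fun g k k' h => ih _ h
  | jmp l M ih => exact fun g k k' h => ih _ h
  | var => intro f g k k' h; simp only [ren, cntO, h]
  | lam M ih => exact fun g k k' h => ih _ (up_eq_succ_iff h)
  | app M N ih ih' => intro f g k k' h; simp only [ren, cntO, ih _ h, ih' _ h]
  | lett M N ih ih' =>
    intro f g k k' h; simp only [ren, cntO, ih _ (up_eq_succ_iff h), ih' _ h]

/-- The hypothesis lets `g` take the value `k` at indices that are not free in `M`. This is needed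
for `instC l`, which is not injective: it sends both `0` and `l + 1` to `l`. -/
theorem cntC_ren_eq_zero {s : Kind} (M : Tm s) : ∀ (f g : ℕ → ℕ) (k : ℕ),
    (∀ n, g n = k → cntC n M = 0) → cntC k (M.ren f g) = 0 := by
  induction M with
  | mu J ih =>
    intro f g k h
    refine ih _ _ _ fun n hn => ?_
    cases n with
    | zero => simp [up] at hn
    | succ n => exact h n (by simpa [up] using hn)
  | jmp l M ih =>
    intro f g k h
    simp only [ren, cntC, Nat.add_eq_zero_iff] at h ⊢
    refine ⟨?_, ih _ _ _ fun n hn => (h n hn).2⟩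
    split_ifs with hl
    · simpa using (h l hl).1
    · rfl
  | var => intros; rfl
  | lam M ih => exact fun f g k h => ih _ _ _ h
  | app M N ih ih' =>
    intro f g k h
    simp only [ren, cntC, Nat.add_eq_zero_iff] at h ⊢
    exact ⟨ih _ _ _ fun n hn => (h n hn).1, ih' _ _ _ fun n hn => (h n hn).2⟩
  | lett M N ih ih' =>
    intro f g k h
    simp only [ren, cntC, Nat.add_eq_zero_iff] at h ⊢
    exact ⟨ih _ _ _ fun n hn => (h n hn).1, ih' _ _ _ fun n hn => (h n hn).2⟩

theorem cntO_ren_eq_zero {s : Kind} (M : Tm s) : ∀ (f g : ℕ → ℕ) (k : ℕ),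
    (∀ n, f n ≠ k) → cntO k (M.ren f g) = 0 := by
  have hup : ∀ {f : ℕ → ℕ} {k : ℕ}, (∀ n, f n ≠ k) → ∀ n, up f n ≠ k + 1 := by
    intro f k h n
    cases n with
    | zero => simp [up]
    | succ n => simpa [up] using h n
  induction M with
  | var => intro f g k h; simp [ren, cntO, h]
  | lam M ih => exact fun f g k h => ih _ _ _ (hup h)
  | app M N ih ih' => intro f g k h; simp only [ren, cntO, ih _ _ _ h, ih' _ _ _ h]
  | lett M N ih ih' => intro f g k h; simp only [ren, cntO, ih _ _ _ (hup h), ih' _ _ _ h]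
  | mu J ih => exact fun f g k h => ih _ _ _ h
  | jmp l M ih => exact fun f g k h => ih _ _ _ h

@[simp] theorem cntC_wkC_zero {s : Kind} (M : Tm s) : cntC 0 M.wkC = 0 :=
  cntC_ren_eq_zero _ _ _ _ fun _ h => absurd h (Nat.succ_ne_zero _)

@[simp] theorem cntC_wkC_succ {s : Kind} (k : ℕ) (M : Tm s) : cntC (k + 1) M.wkC = cntC k M :=
  cntC_ren _ _ (by simp)

@[simp] theorem cntO_wkC {s : Kind} (k : ℕ) (M : Tm s) : cntO k M.wkC = cntO k M :=
  cntO_ren _ _ (by simp)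

@[simp] theorem cntO_wkO_zero {s : Kind} (M : Tm s) : cntO 0 M.wkO = 0 :=
  cntO_ren_eq_zero _ _ _ _ Nat.succ_ne_zero

@[simp] theorem cntC_ren_id {s : Kind} (k : ℕ) (f : ℕ → ℕ) (M : Tm s) :
    cntC k (M.ren f id) = cntC k M := cntC_ren _ _ (by simp)

@[simp] theorem cntC_wkO {s : Kind} (k : ℕ) (M : Tm s) : cntC k M.wkO = cntC k M :=
  cntC_ren_id _ _ _

theorem ren_eq_self {s : Kind} (M : Tm s) : ∀ (g : ℕ → ℕ),
    (∀ n, cntC n M ≠ 0 → g n = n) → M.ren id g = M := by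
  induction M with
  | mu J ih =>
    intro g h
    simp only [ren, mu.injEq]
    refine ih _ fun n hn => ?_
    cases n with
    | zero => rfl
    | succ n => simp [up, h n hn]
  | jmp l M ih =>
    intro g h
    simp only [cntC, ne_eq, Nat.add_eq_zero_iff, not_and_or] at h
    simp only [ren, jmp.injEq]
    exact ⟨h l (by simp), ih _ fun n hn => h n (.inr hn)⟩
  | var => intros; rfl
  | lam M ih => intro g h; simpa [ren] using ih _ h
  | app M N ih ih' =>
    intro g h
    simp only [cntC, ne_eq, Nat.add_eq_zero_iff, not_and_or] at h
    simp only [ren, app.injEq]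
    exact ⟨ih _ fun n hn => h n (.inl hn), ih' _ fun n hn => h n (.inr hn)⟩
  | lett M N ih ih' =>
    intro g h
    simp only [cntC, ne_eq, Nat.add_eq_zero_iff, not_and_or] at h
    simp only [ren, up_id, lett.injEq]
    exact ⟨ih _ fun n hn => h n (.inl hn), ih' _ fun n hn => h n (.inr hn)⟩

/-- Removal of the continuation variable `0`, supposed not to be free. -/
def lowerC {s : Kind} (M : Tm s) : Tm s := M.ren id Nat.pred

@[simp] theorem lowerC_wkC {s : Kind} (M : Tm s) : M.wkC.lowerC = M := by
  simp only [lowerC, wkC, ren_ren]; exact ren_id M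

/-- `Nat.pred` sends both `0` and `1` to `0`, so lowering loses information unless `0` does not
occur. -/
theorem wkC_lowerC {s : Kind} {M : Tm s} (h : cntC 0 M = 0) : M.lowerC.wkC = M := by
  simp only [lowerC, wkC, ren_ren]
  refine ren_eq_self M _ fun n hn => ?_
  cases n with
  | zero => exact absurd h hn
  | succ n => rfl

/-- The number of occurrences of the continuation variable `k` in the body of a continuation. -/
def cntOpt (k : ℕ) : Option (Tm .term) → ℕ
  | none => 0
  | some P => cntC k P

theorem cntC_plug (k : ℕ) (o : Option (Tm .term)) (M : Tm .term) :
    cntC k (plug o M) = cntOpt k o + cntC k M := by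
  cases o <;> simp [plug, cntOpt, cntC]

theorem cntOpt_ren (o : Option (Tm .term)) (f : ℕ → ℕ) {g : ℕ → ℕ} {k k' : ℕ}
    (h : ∀ n, g n = k' ↔ n = k) : cntOpt k' (o.map (ren f g)) = cntOpt k o := by
  cases o with
  | none => rfl
  | some P => exact cntC_ren P _ h

theorem cntC_upSubst {σ : ℕ → Tm .term} {k : ℕ} (h : ∀ x, cntC k (σ x) = 0) (x : ℕ) :
    cntC k (upSubst σ x) = 0 := by
  cases x with
  | zero => rfl
  | succ x => simpa [upSubst] using h x

theorem cntOpt_upCont_zero (θ : ℕ → Cont) (n : ℕ) : cntOpt 0 (upCont θ n).2 = 0 := by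
  cases n with
  | zero => rfl
  | succ n =>
    simp only [upCont, renCont]
    rcases (θ n).2 with _ | P
    · rfl
    · exact cntC_ren_eq_zero _ _ _ _ fun _ h => absurd h (Nat.succ_ne_zero _)

theorem cntOpt_upCont_succ (θ : ℕ → Cont) (k n : ℕ) :
    cntOpt (k + 1) (upCont θ (n + 1)).2 = cntOpt k (θ n).2 :=
  cntOpt_ren _ _ (by simp)

theorem cntC_msub {s : Kind} (M : Tm s) : ∀ {σ : ℕ → Tm .term} {θ : ℕ → Cont} {k k' : ℕ},
    (∀ x, cntC k' (σ x) = 0) → (∀ n, (θ n).1 = k' ↔ n = k) → (∀ n, cntOpt k' (θ n).2 = 0) →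
    cntC k' (msub σ θ M) = cntC k M := by
  induction M with
  | var => intro σ θ k k' h _ _; exact h _
  | lam M ih =>
    intro σ θ k k' h h' h''
    exact ih (cntC_upSubst h) h' fun n => (cntOpt_ren _ _ (by simp)).trans (h'' n)
  | app M N ih ih' =>
    intro σ θ k k' h h' h''
    simp only [msub, cntC, ih h h' h'', ih' h h' h'']
  | lett L M ih ih' =>
    intro σ θ k k' h h' h''
    have := ih (σ := upSubst σ) (θ := renCont Nat.succ id ∘ θ) (cntC_upSubst h) h'
      fun n => (cntOpt_ren _ _ (by simp)).trans (h'' n)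
    simp only [msub, cntC, this, ih' h h' h'']
  | mu J ih =>
    intro σ θ k k' h h' h''
    refine ih (fun x => ?_) (fun n => ?_) (fun n => ?_)
    · simpa using h x
    · cases n with
      | zero => simp [upCont]
      | succ n => simpa [upCont, renCont] using h' n
    · cases n with
      | zero => rfl
      | succ n => rw [cntOpt_upCont_succ]; exact h'' n
  | jmp l M ih =>
    intro σ θ k k' h h' h''
    simp only [msub, cntC, cntC_plug, ih h h' h'', h', h'', zero_add]

theorem cntC_msub_eq_zero {s : Kind} (M : Tm s) : ∀ {σ : ℕ → Tm .term} {θ : ℕ → Cont} {k : ℕ},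
    (∀ x, cntC k (σ x) = 0) → (∀ n, cntC n M ≠ 0 → (θ n).1 ≠ k) → (∀ n, cntOpt k (θ n).2 = 0) →
    cntC k (msub σ θ M) = 0 := by
  induction M with
  | var => intro σ θ k h _ _; exact h _
  | lam M ih =>
    intro σ θ k h h' h''
    exact ih (cntC_upSubst h) h' fun n => (cntOpt_ren _ _ (by simp)).trans (h'' n)
  | app M N ih ih' =>
    intro σ θ k h h' h''
    simp only [cntC, ne_eq, Nat.add_eq_zero_iff, not_and_or] at h'
    simp only [msub, cntC, ih h (fun n hn => h' n (.inl hn)) h'',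
      ih' h (fun n hn => h' n (.inr hn)) h'']
  | lett L M ih ih' =>
    intro σ θ k h h' h''
    simp only [cntC, ne_eq, Nat.add_eq_zero_iff, not_and_or] at h'
    have := ih (σ := upSubst σ) (θ := renCont Nat.succ id ∘ θ) (cntC_upSubst h)
      (fun n hn => h' n (.inl hn)) fun n => (cntOpt_ren _ _ (by simp)).trans (h'' n)
    simp only [msub, cntC, this, ih' h (fun n hn => h' n (.inr hn)) h'']
  | mu J ih =>
    intro σ θ k h h' h''
    refine ih (fun x => ?_) (fun n => ?_) (fun n => ?_)
    · simpa using h x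
    · cases n with
      | zero => simp [upCont]
      | succ n => simpa [upCont, renCont, cntC] using h' n
    · cases n with
      | zero => rfl
      | succ n => rw [cntOpt_upCont_succ]; exact h'' n
  | jmp l M ih =>
    intro σ θ k h h' h''
    simp only [cntC, ne_eq, Nat.add_eq_zero_iff, not_and_or] at h'
    simp [msub, cntC, cntC_plug, ih h (fun n hn => h' n (.inr hn)) h'', h'', h' l]

/-- The axioms neither copy nor erase anything. The exact count is needed, and not just freeness,
because the criterion for `μk.J` below asks whether `k` occurs exactly once. -/
theorem EqAx.cntC_eq {s : Kind} {P Q : Tm s} (h : EqAx s P Q) (k : ℕ) : cntC k P = cntC k Q := by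
  cases h <;> simp [cntC, Nat.add_assoc]

theorem EqAx.cntO_eq {s : Kind} {P Q : Tm s} (h : EqAx s P Q) (k : ℕ) : cntO k P = cntO k Q := by
  cases h with
  | assoc L M N =>
    have : cntO (k + 1 + 1) (L.ren (up Nat.succ) id) = cntO (k + 1) L :=
      cntO_ren _ _ (up_eq_succ_iff (by simp))
    simp [cntO, this, Nat.add_assoc]
  | muLet => simp [cntO]
  | jmpLet => simp [cntO]

theorem cntC_eq_of_compat {s : Kind} {P Q : Tm s} (h : Compat EqAx s P Q) :
    ∀ k, cntC k P = cntC k Q := by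
  induction h with
  | base h => exact h.cntC_eq
  | _ => simp_all [cntC]

theorem cntO_eq_of_compat {s : Kind} {P Q : Tm s} (h : Compat EqAx s P Q) :
    ∀ k, cntO k P = cntO k Q := by
  induction h with
  | base h => exact h.cntO_eq
  | _ => simp_all [cntO]

theorem Ident.cntC_eq {s : Kind} {P Q : Tm s} (h : Ident P Q) (k : ℕ) : cntC k P = cntC k Q := by
  induction h with
  | rel _ _ h => exact cntC_eq_of_compat h k
  | refl => rfl
  | symm _ _ _ ih => exact ih.symm
  | trans _ _ _ _ _ ih ih' => exact ih.trans ih'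

/-- Reduction may copy or erase subterms, so only the absence of a variable survives. It guarantees
that a contraction of `μk.[k]M` made by the inverse translation is still made after `M` has been
reduced. -/
theorem Rule.cntC_eq_zero {s : Kind} {P Q : Tm s} (h : Rule s P Q) {k : ℕ} (hP : cntC k P = 0) :
    cntC k Q = 0 := by
  cases h with
  | ad₁ M hN => simp_all [cntC]
  | ad₂ hV hN => simp_all [cntC]
  | betaLam M hV => simp_all [cntC]
  | betaLet M hV =>
    simp only [cntC, Nat.add_eq_zero_iff] at hP
    rw [substO, subst_eq_msub]
    refine cntC_msub_eq_zero _ (fun x => ?_) (fun n hn => ?_) (fun n => rfl)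
    · cases x with
      | zero => exact hP.2
      | succ => rfl
    · rintro rfl; exact hn hP.1
  | betaMu M J =>
    simp only [cntC, Nat.add_eq_zero_iff] at hP
    rw [cntC, ctxSubst_eq_msub]
    refine cntC_msub_eq_zero _ (fun x => rfl) (fun n hn => ?_) (fun n => ?_)
    · rintro rfl; exact hn hP.2
    · unfold single
      split_ifs
      · simpa [cntOpt] using hP.1
      · rfl
  | betaJmp l J =>
    simp only [cntC, Nat.add_eq_zero_iff] at hP
    refine cntC_ren_eq_zero _ _ _ _ fun n hn => ?_
    cases n with
    | zero => simp_all [instC]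
    | succ n =>
      obtain rfl : n = k := hn
      exact hP.2
  | etaLam hV => simp_all [cntC]
  | etaLet => simp_all [cntC]
  | etaMu => simp_all [cntC]

theorem cntC_eq_zero_of_compat {s : Kind} {P Q : Tm s} (h : Compat Rule s P Q) :
    ∀ {k}, cntC k P = 0 → cntC k Q = 0 := by
  induction h with
  | base h => exact h.cntC_eq_zero
  | _ => simp_all [cntC]

theorem Step.cntC_eq_zero {s : Kind} {P Q : Tm s} (h : Step P Q) {k : ℕ} (hP : cntC k P = 0) :
    cntC k Q = 0 := by
  obtain ⟨P', Q', h1, h2, h3⟩ := h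
  rw [h1.cntC_eq] at hP
  rw [← h3.cntC_eq]
  exact cntC_eq_zero_of_compat h2 hP

theorem Sim.cntC_eq_zero {p : Prop} {s : Kind} {P Q : Tm s} (h : Sim p P Q) {k : ℕ}
    (hP : cntC k P = 0) : cntC k Q = 0 := by
  rcases h with h | ⟨-, h⟩
  · induction h with
    | single h => exact h.cntC_eq_zero hP
    | tail _ h ih => exact h.cntC_eq_zero ih
  · rwa [← h.cntC_eq]

end Tm

end CCV

-- Renaming, substitution, size and occurrences in the target.

namespace CCV

namespace Tgt

theorem ren_ren {s : TSort} (t : Tgt s) : ∀ f g f' g' : ℕ → ℕ,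
    (t.ren f g).ren f' g' = t.ren (f' ∘ f) (g' ∘ g) := by
  induction t <;> intro f g f' g' <;> simp_all [ren, up_comp]

theorem ren_wkO {s : TSort} (t : Tgt s) (f g : ℕ → ℕ) : t.wkO.ren (up f) g = (t.ren f g).wkO := by
  simp only [wkO, ren_ren]; rfl

theorem ren_wkC {s : TSort} (t : Tgt s) (f g : ℕ → ℕ) : t.wkC.ren f (up g) = (t.ren f g).wkC := by
  simp only [wkC, ren_ren]; rfl

theorem upO_ren (σ : ℕ → Tgt .W) (f : ℕ → ℕ) : upO (σ ∘ f) = upO σ ∘ up f := by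
  funext n; cases n <;> rfl

theorem upC_ren (τ : ℕ → Tgt .K) (g : ℕ → ℕ) : upC (τ ∘ g) = upC τ ∘ up g := by
  funext n; cases n <;> rfl

theorem ren_upO (σ : ℕ → Tgt .W) (f g : ℕ → ℕ) : upO (ren f g ∘ σ) = ren (up f) g ∘ upO σ := by
  funext n
  cases n with
  | zero => rfl
  | succ n => exact (ren_wkO _ _ _).symm

theorem ren_upC (τ : ℕ → Tgt .K) (f g : ℕ → ℕ) : upC (ren f g ∘ τ) = ren f (up g) ∘ upC τ := by
  funext n
  cases n with
  | zero => rfl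
  | succ n => exact (ren_wkC _ _ _).symm

theorem subst_ren {s : TSort} (t : Tgt s) : ∀ (σ : ℕ → Tgt .W) (τ : ℕ → Tgt .K) (f g : ℕ → ℕ),
    (t.ren f g).subst σ τ = t.subst (σ ∘ f) (τ ∘ g) := by
  induction t <;> intro σ τ f g <;> simp_all [ren, subst, upO_ren, upC_ren] <;> rfl

theorem ren_subst {s : TSort} (t : Tgt s) : ∀ (σ : ℕ → Tgt .W) (τ : ℕ → Tgt .K) (f g : ℕ → ℕ),
    (t.subst σ τ).ren f g = t.subst (ren f g ∘ σ) (ren f g ∘ τ) := by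
  induction t <;> intro σ τ f g <;>
    simp_all [ren, subst, ren_upO, ren_upC, ← ren_wkO, ← ren_wkC] <;> rfl

@[simp] theorem upO_var : upO var = var := by
  funext n; cases n <;> rfl

@[simp] theorem upC_cvar : upC cvar = cvar := by
  funext n; cases n <;> rfl

@[simp] theorem wkC_var (n : ℕ) : (var n).wkC = var n := rfl

@[simp] theorem wkO_cvar (n : ℕ) : (cvar n).wkO = cvar n := rfl

@[simp] theorem subst_id {s : TSort} (t : Tgt s) : t.subst var cvar = t := by
  induction t <;> simp_all [subst]

theorem ren_eq_subst {s : TSort} (t : Tgt s) (f g : ℕ → ℕ) :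
    t.ren f g = t.subst (var ∘ f) (cvar ∘ g) := by
  rw [← subst_ren, subst_id]

theorem subst_wkO {s : TSort} (t : Tgt s) (σ : ℕ → Tgt .W) (τ : ℕ → Tgt .K) :
    t.wkO.subst (upO σ) (fun n => (τ n).wkO) = (t.subst σ τ).wkO := by
  simp only [wkO, subst_ren, ren_subst]; rfl

theorem subst_wkC {s : TSort} (t : Tgt s) (σ : ℕ → Tgt .W) (τ : ℕ → Tgt .K) :
    t.wkC.subst (fun n => (σ n).wkC) (upC τ) = (t.subst σ τ).wkC := by
  simp only [wkC, subst_ren, ren_subst]; rfl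

theorem subst_subst {s : TSort} (t : Tgt s) :
    ∀ (σ σ' : ℕ → Tgt .W) (τ τ' : ℕ → Tgt .K),
    (t.subst σ τ).subst σ' τ' = t.subst (fun n => (σ n).subst σ' τ') (fun n => (τ n).subst σ' τ') := by
  have hO : ∀ (σ σ' : ℕ → Tgt .W) (τ' : ℕ → Tgt .K),
      (fun n => (upO σ n).subst (upO σ') (fun n => (τ' n).wkO)) =
        upO (fun n => (σ n).subst σ' τ') := by
    intro σ σ' τ'; funext n
    cases n with
    | zero => rfl
    | succ n => exact subst_wkO _ _ _
  have hC : ∀ (σ' : ℕ → Tgt .W) (τ τ' : ℕ → Tgt .K),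
      (fun n => (upC τ n).subst (fun n => (σ' n).wkC) (upC τ')) =
        upC (fun n => (τ n).subst σ' τ') := by
    intro σ' τ τ'; funext n
    cases n with
    | zero => rfl
    | succ n => exact subst_wkC _ _ _
  induction t <;> intro σ σ' τ τ' <;> simp_all [subst, subst_wkO, subst_wkC]

theorem subst_substO {s : TSort} (t : Tgt s) (w : Tgt .W) (σ : ℕ → Tgt .W) (τ : ℕ → Tgt .K) :
    (t.substO w).subst σ τ =
      (t.subst (upO σ) (fun n => (τ n).wkO)).substO (w.subst σ τ) := by
  simp only [substO, subst_subst]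
  congr 1
  · funext n
    cases n with
    | zero => rfl
    | succ n =>
      simp only [upO, instO, wkO, subst_ren]
      exact (subst_id _).symm
  · funext n
    simp only [wkO, subst_ren]
    exact (subst_id _).symm

theorem subst_substC {s : TSort} (t : Tgt s) (c : Tgt .K) (σ : ℕ → Tgt .W) (τ : ℕ → Tgt .K) :
    (t.substC c).subst σ τ =
      (t.subst (fun n => (σ n).wkC) (upC τ)).substC (c.subst σ τ) := by
  simp only [substC, subst_subst]
  congr 1
  · funext n
    simp only [wkC, subst_ren]
    exact (subst_id _).symm
  · funext n
    cases n with
    | zero => rfl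
    | succ n =>
      simp only [upC, instC, wkC, subst_ren]
      exact (subst_id _).symm

theorem ren_substO {s : TSort} (t : Tgt s) (w : Tgt .W) (f g : ℕ → ℕ) :
    (t.substO w).ren f g = (t.ren (up f) g).substO (w.ren f g) := by
  simp only [substO, subst_ren, ren_subst]
  congr 1
  funext n; cases n <;> rfl

theorem ren_substC {s : TSort} (t : Tgt s) (c : Tgt .K) (f g : ℕ → ℕ) :
    (t.substC c).ren f g = (t.ren f (up g)).substC (c.ren f g) := by
  simp only [substC, subst_ren, ren_subst]
  congr 1
  funext n; cases n <;> rfl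

@[simp] theorem substO_wkO {s : TSort} (t : Tgt s) (w : Tgt .W) : t.wkO.substO w = t := by
  simp only [wkO, substO, subst_ren]; exact subst_id t

@[simp] theorem substC_wkC {s : TSort} (t : Tgt s) (c : Tgt .K) : t.wkC.substC c = t := by
  simp only [wkC, substC, subst_ren]; exact subst_id t

/-! ### Size and occurrences -/

/-- The number of nodes. -/
def size : {s : TSort} → Tgt s → ℕ
  | _, lamT q => size q + 1
  | _, appWW v w => size v + size w + 1
  | _, appKW c w => size c + size w + 1
  | _, appTK t c => size t + size c + 1
  | _, var _ => 1
  | _, lamW t => size t + 1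
  | _, cvar _ => 1
  | _, lamK q => size q + 1

/-- The number of free occurrences of the continuation variable `k`. -/
def cntC : {s : TSort} → ℕ → Tgt s → ℕ
  | _, k, lamT q => cntC (k + 1) q
  | _, k, appWW v w => cntC k v + cntC k w
  | _, k, appKW c w => cntC k c + cntC k w
  | _, k, appTK t c => cntC k t + cntC k c
  | _, _, var _ => 0
  | _, k, lamW t => cntC k t
  | _, k, cvar l => if l = k then 1 else 0
  | _, k, lamK q => cntC k q

/-- The number of free occurrences of the ordinary variable `k`. -/
def cntO : {s : TSort} → ℕ → Tgt s → ℕ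
  | _, k, lamT q => cntO k q
  | _, k, appWW v w => cntO k v + cntO k w
  | _, k, appKW c w => cntO k c + cntO k w
  | _, k, appTK t c => cntO k t + cntO k c
  | _, k, var x => if x = k then 1 else 0
  | _, k, lamW t => cntO (k + 1) t
  | _, _, cvar _ => 0
  | _, k, lamK q => cntO (k + 1) q

@[simp] theorem size_ren {s : TSort} (t : Tgt s) : ∀ f g : ℕ → ℕ, (t.ren f g).size = t.size := by
  induction t <;> intro f g <;> simp_all [ren, size]

@[simp] theorem size_wkO {s : TSort} (t : Tgt s) : t.wkO.size = t.size := size_ren _ _ _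

@[simp] theorem size_wkC {s : TSort} (t : Tgt s) : t.wkC.size = t.size := size_ren _ _ _

theorem size_subst {s : TSort} (t : Tgt s) : ∀ {σ : ℕ → Tgt .W} {τ : ℕ → Tgt .K} {k m : ℕ},
    (∀ n, (σ n).size = 1) → (∀ n, (τ n).size = if n = k then m + 1 else 1) →
    (t.subst σ τ).size = t.size + cntC k t * m := by
  induction t with
  | lamT q ih =>
    intro σ τ k m h h'
    have := @ih (fun n => (σ n).wkC) (upC τ) (k + 1) m (by simpa using h) (fun n => by
      cases n <;> simp [upC, h', size])
    simp only [subst, size, cntC, this]; ring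
  | lamW q ih =>
    intro σ τ k m h h'
    have := @ih (upO σ) (fun n => (τ n).wkO) k m
      (fun n => by cases n <;> simp [upO, h, size]) (by simpa using h')
    simp only [subst, size, cntC, this]; ring
  | lamK q ih =>
    intro σ τ k m h h'
    have := @ih (upO σ) (fun n => (τ n).wkO) k m
      (fun n => by cases n <;> simp [upO, h, size]) (by simpa using h')
    simp only [subst, size, cntC, this]; ring
  | var x => intro σ τ k m h h'; simp [subst, size, cntC, h]
  | cvar l =>
    intro σ τ k m h h'
    simp only [subst, size, cntC, h']
    split_ifs <;> ring
  | _ =>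
    rename_i ih ih'
    intro σ τ k m h h'
    simp only [subst, size, cntC, ih h h', ih' h h']; ring

/-- Each free occurrence of `0` is a leaf of size one that is replaced by `c`. Hence a `betaT` step
shrinks the term if the bound variable occurs at most once or if `c` is a variable. -/
theorem size_substC {s : TSort} (t : Tgt s) (c : Tgt .K) :
    (t.substC c).size = t.size + cntC 0 t * (c.size - 1) := by
  -- Sizes are positive, so the truncated subtraction is exact.
  have hc : c.size = c.size - 1 + 1 := by cases c <;> simp [size]
  refine size_subst t (fun _ => rfl) fun n => ?_
  cases n with
  | zero => simpa [instC] using hc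
  | succ n => rfl

theorem cntC_ren {s : TSort} (t : Tgt s) : ∀ (f : ℕ → ℕ) {g : ℕ → ℕ} {k k' : ℕ},
    (∀ n, g n = k' ↔ n = k) → cntC k' (t.ren f g) = cntC k t := by
  induction t with
  | lamT q ih => exact fun f g k k' h => ih _ (Tm.up_eq_succ_iff h)
  | cvar l => intro f g k k' h; simp only [ren, cntC, h]
  | var => intros; rfl
  | lamW t ih => exact fun f g k k' h => ih _ h
  | lamK t ih => exact fun f g k k' h => ih _ h
  | _ =>
    rename_i ih ih'
    intro f g k k' h
    simp only [ren, cntC, ih _ h, ih' _ h]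

theorem ren_eq_self {s : TSort} (t : Tgt s) : ∀ (f g : ℕ → ℕ),
    (∀ n, cntO n t ≠ 0 → f n = n) → (∀ n, cntC n t ≠ 0 → g n = n) → t.ren f g = t := by
  have hup : ∀ {s : TSort} (t : Tgt s) (cnt : ℕ → Tgt s → ℕ) (f : ℕ → ℕ),
      (∀ n, cnt (n + 1) t ≠ 0 → f n = n) → ∀ n, cnt n t ≠ 0 → up f n = n := by
    intro s t cnt f h n hn
    cases n with
    | zero => rfl
    | succ n => simp [up, h n hn]
  induction t with
  | lamT q ih => intro f g h h'; simp only [ren, ih _ _ h (hup _ _ _ h')]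
  | lamW q ih => intro f g h h'; simp only [ren, ih _ _ (hup _ _ _ h) h']
  | lamK q ih => intro f g h h'; simp only [ren, ih _ _ (hup _ _ _ h) h']
  | var x => intro f g h h'; simp only [ren, h x (by simp [cntO])]
  | cvar x => intro f g h h'; simp only [ren, h' x (by simp [cntC])]
  | _ =>
    rename_i ih ih'
    intro f g h h'
    simp only [cntC, cntO, ne_eq, Nat.add_eq_zero_iff, not_and_or] at h h'
    simp only [ren, ih _ _ (fun n hn => h n (.inl hn)) (fun n hn => h' n (.inl hn)),
      ih' _ _ (fun n hn => h n (.inr hn)) (fun n hn => h' n (.inr hn))]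

theorem exists_eq_wkO {s : TSort} {t : Tgt s} (h : cntO 0 t = 0) : ∃ t', t = wkO t' := by
  refine ⟨t.ren Nat.pred id, ?_⟩
  rw [wkO, ren_ren, ren_eq_self]
  · intro n hn
    cases n with
    | zero => exact absurd h hn
    | succ n => rfl
  · intros; rfl

theorem exists_eq_wkC {s : TSort} {t : Tgt s} (h : cntC 0 t = 0) : ∃ t', t = wkC t' := by
  refine ⟨t.ren id Nat.pred, ?_⟩
  rw [wkC, ren_ren, ren_eq_self]
  · intros; rfl
  · intro n hn
    cases n with
    | zero => exact absurd h hn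
    | succ n => rfl

/-- `βη`-reduction in finitely many steps. -/
abbrev Reds {s : TSort} (t u : Tgt s) : Prop := Relation.ReflTransGen (BetaEta s) t u

end Tgt

end CCV

namespace CCV

open Tm

/-! ### The inverse translation -/

/-- What a target expression of each sort denotes in the source calculus: a term, a jump `[l]M`
(as the pair `(l, M)`), a value, or a continuation. -/
@[reducible] def Sem : TSort → Type
  | .T => Tm .term
  | .Q => ℕ × Tm .term
  | .W => Tm .term
  | .K => Cont

/-- The term `μk.[l]M`, or its `η`-contractum. -/
def smart (q : ℕ × Tm .term) : Tm .term :=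
  if q.1 = 0 ∧ cntC 0 q.2 = 0 then lowerC q.2 else mu (jmp q.1 q.2)

/-- The inverse translation. -/
def back : {s : TSort} → Tgt s → Sem s
  | _, .lamT q => smart (back q)
  | _, .appWW v w => app (back v) (back w)
  | _, .appKW c w => ((back c).1, plug (back c).2 (back w))
  | _, .appTK t c => ((back c).1, plug (back c).2 (back t))
  | _, .var x => var x
  | _, .lamW t => lam (back t)
  | _, .cvar k => (k, none)
  | _, .lamK q => ((back q).1, some (back q).2)

/-- Renaming. -/
def renSem : (s : TSort) → (ℕ → ℕ) → (ℕ → ℕ) → Sem s → Sem s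
  | .T, f, g, M => ren f g M
  | .Q, f, g, q => (g q.1, ren f g q.2)
  | .W, f, g, M => ren f g M
  | .K, f, g, κ => renCont f g κ

/-- Simultaneous substitution. -/
def msubSem : (s : TSort) → (ℕ → Tm .term) → (ℕ → Cont) → Sem s → Sem s
  | .T, σ, θ, M => msub σ θ M
  | .Q, σ, θ, q => ((θ q.1).1, plug (θ q.1).2 (msub σ θ q.2))
  | .W, σ, θ, M => msub σ θ M
  | .K, _, θ, (l, none) => θ l
  | .K, σ, θ, (l, some P) =>
      ((θ l).1, some (plug (renCont Nat.succ id (θ l)).2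
        (msub (upSubst σ) (renCont Nat.succ id ∘ θ) P)))

/-- Occurrences of a continuation variable. -/
def cntSem (k : ℕ) : (s : TSort) → Sem s → ℕ
  | .T, M => cntC k M
  | .Q, q => (if q.1 = k then 1 else 0) + cntC k q.2
  | .W, M => cntC k M
  | .K, κ => (if κ.1 = k then 1 else 0) + cntOpt k κ.2

/-- Identification. -/
def IdentSem : (s : TSort) → Sem s → Sem s → Prop
  | .T, M, M' => Ident M M'
  | .Q, q, q' => q.1 = q'.1 ∧ Ident q.2 q'.2
  | .W, M, M' => Ident M M'
  | .K, κ, κ' => κ.1 = κ'.1 ∧ ∀ N, Ident (plug κ.2 N) (plug κ'.2 N)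

theorem isValue_back (w : Tgt .W) : (back w).IsValue := by
  cases w <;> trivial

theorem cntC_smart (k : ℕ) (q : ℕ × Tm .term) : cntC k (smart q) = cntSem (k + 1) .Q q := by
  obtain ⟨l, M⟩ := q
  unfold smart
  split_ifs with h
  · obtain ⟨h1, h2⟩ := h
    simp only at h1 h2
    subst h1
    rw [← wkC_lowerC h2]
    simp [cntSem]
  · rfl

/-- The exact agreement serves two ends: it turns the test inside `smart` into a statement about the
target, where it controls sizes and reveals `η`-redexes. -/
theorem cntC_back {s : TSort} (t : Tgt s) : ∀ k, cntSem k s (back t) = Tgt.cntC k t := by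
  induction t with
  | lamT q ih => intro k; rw [Tgt.cntC, ← ih]; exact cntC_smart _ _
  | appWW v w ih ih' => intro k; rw [Tgt.cntC, ← ih, ← ih']; rfl
  | appKW c w ih ih' =>
    intro k; rw [Tgt.cntC, ← ih, ← ih']
    change _ + cntC k (plug _ _) = (if (back c).1 = k then 1 else 0) + _ + cntC k (back w)
    rw [cntC_plug, Nat.add_assoc]
    rfl
  | appTK t c ih ih' =>
    intro k; rw [Tgt.cntC, ← ih, ← ih']
    change _ + cntC k (plug _ _) = cntC k (back t) + ((if (back c).1 = k then 1 else 0) + _)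
    rw [cntC_plug, ← Nat.add_assoc, Nat.add_comm]
    rfl
  | var x => intro k; rfl
  | lamW t ih => exact ih
  | cvar l => intro k; rfl
  | lamK q ih => exact ih

theorem smart_ren (f g : ℕ → ℕ) (q : ℕ × Tm .term) :
    smart (renSem .Q f (up g) q) = (smart q).ren f g := by
  obtain ⟨l, M⟩ := q
  have h : cntC 0 (M.ren f (up g)) = cntC 0 M := cntC_ren M f (up_eq_zero_iff g)
  simp only [smart, renSem, up_eq_zero_iff, h]
  split_ifs with h'
  · simp only [lowerC]
    -- `Nat.pred` does not commute with renamings, but weakening does. Writing `M` as a weakened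
    -- term reduces the claim to the latter.
    conv_lhs => rw [← wkC_lowerC h'.2]
    simp only [wkC, lowerC, ren_ren]
    congr 1
  · rfl

theorem back_ren {s : TSort} (t : Tgt s) : ∀ f g : ℕ → ℕ,
    back (t.ren f g) = renSem s f g (back t) := by
  induction t with
  | lamT q ih => intro f g; simp only [Tgt.ren, back, ih, smart_ren]; rfl
  | appKW c w ih ih' => intro f g; simp only [Tgt.ren, back, ih, ih', renSem, ren_plug, renCont]
  | appTK t c ih ih' => intro f g; simp only [Tgt.ren, back, ih, ih', renSem, ren_plug, renCont]
  | lamK q ih => intro f g; simp [Tgt.ren, back, ih, renSem, renCont]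
  | _ => intro f g; simp_all [Tgt.ren, back, renSem, ren, renCont]

theorem plug_lett (o : Option (Tm .term)) (L M : Tm .term) :
    Ident (plug o (lett L M)) (lett (plug (o.map (ren (up Nat.succ) id)) L) M) := by
  cases o with
  | none => exact .refl _
  | some P => exact .of_eqAx (.assoc _ _ _)

theorem smart_ident {q q' : ℕ × Tm .term} (h : IdentSem .Q q q') :
    Ident (smart q) (smart q') := by
  obtain ⟨l, M⟩ := q
  obtain ⟨l', M'⟩ := q'
  obtain ⟨rfl, h⟩ := h
  simp only [smart]
  rw [h.cntC_eq]
  split_ifs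
  · exact h.ctx (isContext_ren _ _)
  · exact (h.ctx (isContext_jmp _)).ctx isContext_mu

theorem msub_wkC {s : Kind} (M : Tm s) (σ : ℕ → Tm .term) (θ : ℕ → Cont) :
    msub (wkC ∘ σ) (upCont θ) M.wkC = (msub σ θ M).wkC := by
  simp only [wkC, msub_ren, ren_msub]; rfl

/-- Under the binder, `0` is sent to `[0]□`, and nothing else that is substituted mentions `0`. So
the test for contracting `μk.[k]M` has the same answer before and after the substitution. -/
theorem smart_msub (σ : ℕ → Tm .term) (θ : ℕ → Cont) (q : ℕ × Tm .term) :
    smart (msubSem .Q (wkC ∘ σ) (upCont θ) q) = msub σ θ (smart q) := by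
  obtain ⟨l, M⟩ := q
  cases l with
  | succ n => simp [smart, msubSem, upCont, renCont, msub]
  | zero =>
    have h : cntC 0 (msub (wkC ∘ σ) (upCont θ) M) = cntC 0 M :=
      cntC_msub _ (fun x => cntC_wkC_zero _) (fun n => by cases n <;> simp [upCont, renCont])
        (fun n => cntOpt_upCont_zero _ _)
    simp only [smart, msubSem, upCont, plug, h, true_and]
    split_ifs with h'
    · conv_lhs => rw [← wkC_lowerC h', msub_wkC]
      rw [lowerC_wkC]
    · rfl

/-- If `l` is sent to `[l']⌈R y:=□⌋`, then substituting into the continuation `[l]⌈P x:=□⌋` nests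
the lets to the left, and substituting into the jump `[l]⌈P x:=N⌋` nests them to the right. The
associativity axiom bridges the two. -/
theorem plug_msubSem (κ : Cont) (σ : ℕ → Tm .term) (θ : ℕ → Cont) (N : Tm .term) :
    IdentSem .Q ((msubSem .K σ θ κ).1, plug (msubSem .K σ θ κ).2 (msub σ θ N))
      (msubSem .Q σ θ (κ.1, plug κ.2 N)) := by
  obtain ⟨l, _ | P⟩ := κ
  · exact ⟨rfl, .refl _⟩
  · exact ⟨rfl, (plug_lett _ _ _).symm⟩

theorem back_upC (τ : ℕ → Tgt .K) : (fun n => back (Tgt.upC τ n)) = upCont (fun n => back (τ n)) := by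
  funext n
  cases n with
  | zero => rfl
  | succ n => exact back_ren _ _ _

theorem back_upO (σ : ℕ → Tgt .W) :
    (fun n => back (Tgt.upO σ n)) = upSubst (fun n => back (σ n)) := by
  funext n
  cases n with
  | zero => rfl
  | succ n => exact back_ren _ _ _

/-- The equality holds only modulo the identification, because composing continuations reassociates
lets. For continuations it is accordingly stated after plugging in an arbitrary term. -/
theorem back_subst {s : TSort} (t : Tgt s) : ∀ (σ : ℕ → Tgt .W) (τ : ℕ → Tgt .K),
    IdentSem s (back (t.subst σ τ)) (msubSem s (fun n => back (σ n)) (fun n => back (τ n)) (back t)) := by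
  induction t with
  | lamT q ih =>
    intro σ τ
    have h := smart_ident (ih (fun n => (σ n).wkC) (Tgt.upC τ))
    rw [back_upC] at h
    have h' : (fun n => back (σ n).wkC) = wkC ∘ fun n => back (σ n) := by
      funext n; exact back_ren _ _ _
    rw [h', smart_msub] at h
    exact h
  | appWW v w ih ih' => exact fun σ τ => (ih σ τ).app (ih' σ τ)
  | appKW c w ih ih' =>
    intro σ τ
    obtain ⟨h1, h2⟩ := ih σ τ
    obtain ⟨h3, h4⟩ := plug_msubSem (back c) (fun n => back (σ n)) (fun n => back (τ n)) (back w)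
    exact ⟨h1.trans h3, ((ih' σ τ).ctx (isContext_plug _)).trans ((h2 _).trans h4)⟩
  | appTK t c ih' ih =>
    intro σ τ
    obtain ⟨h1, h2⟩ := ih σ τ
    obtain ⟨h3, h4⟩ := plug_msubSem (back c) (fun n => back (σ n)) (fun n => back (τ n)) (back t)
    exact ⟨h1.trans h3, ((ih' σ τ).ctx (isContext_plug _)).trans ((h2 _).trans h4)⟩
  | var x => exact fun σ τ => .refl _
  | lamW t ih =>
    intro σ τ
    have h := ih (Tgt.upO σ) (fun n => (τ n).wkO)
    rw [back_upO] at h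
    have h' : (fun n => back (τ n).wkO) = renCont Nat.succ id ∘ fun n => back (τ n) := by
      funext n; exact back_ren _ _ _
    rw [h'] at h
    exact h.ctx isContext_lam
  | cvar k => exact fun σ τ => ⟨rfl, fun _ => .refl _⟩
  | lamK q ih =>
    intro σ τ
    have h := ih (Tgt.upO σ) (fun n => (τ n).wkO)
    rw [back_upO] at h
    have h' : (fun n => back (τ n).wkO) = renCont Nat.succ id ∘ fun n => back (τ n) := by
      funext n; exact back_ren _ _ _
    rw [h'] at h
    exact ⟨h.1, fun N => h.2.lett (.refl N)⟩

/-! ### Simulation of target reductions in the source -/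

/-- Simulation of jumps, given as pairs. -/
def SimJump (p : Prop) (q q' : ℕ × Tm .term) : Prop :=
  (q.1 = q'.1 ∧ Sim p q.2 q'.2) ∨
    ∃ J : Tm .jump, Sim p q.2 (mu J) ∧ Ident (jmp q'.1 q'.2) (J.substC q.1)

/-- Simulation for each sort. -/
def SimSem (p : Prop) : (s : TSort) → Sem s → Sem s → Prop
  | .T, M, M' => Sim p M M'
  | .Q, q, q' => SimJump p q q'
  | .W, M, M' => Sim p M M'
  | .K, κ, κ' => ∀ N, SimJump p (κ.1, plug κ.2 N) (κ'.1, plug κ'.2 N)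

theorem SimSem.mono {p p' : Prop} (hp : p → p') : {s : TSort} → {x y : Sem s} →
    SimSem p s x y → SimSem p' s x y
  | .T, _, _, h => Sim.mono hp h
  | .Q, _, _, h => h.imp (fun h => ⟨h.1, h.2.mono hp⟩) (fun ⟨J, h, h'⟩ => ⟨J, h.mono hp, h'⟩)
  | .W, _, _, h => Sim.mono hp h
  | .K, _, _, h => fun N => (h N).imp (fun h => ⟨h.1, h.2.mono hp⟩)
      (fun ⟨J, h, h'⟩ => ⟨J, h.mono hp, h'⟩)

theorem Sim.smart {p : Prop} {P : Tm .term} {q : ℕ × Tm .term} (h : Sim p P (mu (jmp q.1 q.2))) :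
    Sim p P (smart q) := by
  unfold CCV.smart
  split_ifs with hq
  · obtain ⟨l, M⟩ := q
    obtain ⟨h1, h2⟩ := hq
    simp only at h1 h2 h ⊢
    subst h1
    rw [← wkC_lowerC h2] at h
    exact (h.trans (q := False) (.of_rule (.etaMu _))).mono And.left
  · exact h

/-- The second alternative of `SimJump` covers a change of the leading continuation variable: `M`
reaches `μk.J`, and `[l]μk.J → J{l/k}` happens only once `[l]` is put in front. If `μ[l]M` is not
contracted, this is a genuine step under `μ`. If it is contracted to `M`, then `M` itself reaches
`μk.J`, and the outer `μ` is simply renamed. -/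
theorem SimJump.smart {p : Prop} {q q' : ℕ × Tm .term} (h : SimJump p q q') :
    Sim p (smart q) (smart q') := by
  obtain ⟨l, M⟩ := q
  obtain ⟨l', M'⟩ := q'
  by_cases hq : l = 0 ∧ cntC 0 M = 0
  · have hs : CCV.smart (l, M) = lowerC M := if_pos hq
    rw [hs]
    obtain ⟨rfl, hM⟩ := hq
    rcases h with ⟨h1, h2⟩ | ⟨J, h1, h2⟩
    · simp only at h1 h2
      subst h1
      have hs' : CCV.smart (0, M') = lowerC M' := if_pos ⟨rfl, h2.cntC_eq_zero hM⟩
      rw [hs']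
      exact h2.ctx (isContext_ren _ _)
    · simp only at h1 h2
      have hJ : cntC 1 J = 0 := h1.cntC_eq_zero hM
      -- The composite moves only the index `1`, which is not free in `J`. Having rewritten `J` in
      -- this way, one may ignore the single index on which `instC 0` and `up Nat.pred` differ.
      have e : J.ren id (up Nat.succ ∘ up Nat.pred) = J := by
        refine ren_eq_self _ _ fun n hn => ?_
        match n with
        | 0 => rfl
        | 1 => exact absurd hJ hn
        | n + 2 => rfl
      have e' : J.substC 0 = J.ren id (up Nat.pred) := by
        conv_lhs => rw [← e]
        simp only [substC, ren_ren]
        congr 1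
        funext n
        match n with
        | 0 => rfl
        | n + 1 => rfl
      refine Sim.smart ((h1.ctx (isContext_ren id Nat.pred)).ident_right ?_)
      rw [e'] at h2
      exact h2.symm.ctx isContext_mu
  · have hs : CCV.smart (l, M) = mu (jmp l M) := if_neg hq
    rw [hs]
    rcases h with ⟨h1, h2⟩ | ⟨J, h1, h2⟩
    · simp only at h1 h2
      subst h1
      exact Sim.smart ((h2.ctx (isContext_jmp _)).ctx isContext_mu)
    · simp only at h1 h2
      have h3 := h1.ctx (isContext_jmp l)
      have h4 := h3.trans (q := False) (.of_rule (.betaJmp l J))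
      exact Sim.smart (((h4.mono And.left).ident_right h2.symm).ctx isContext_mu)

theorem SimJump.plug {p : Prop} (κ : Cont) {M M' : Tm .term} (h : Sim p M M') :
    SimJump p (κ.1, plug κ.2 M) (κ.1, plug κ.2 M') :=
  .inl ⟨rfl, h.ctx (isContext_plug _)⟩

/-- If `q.2` reaches `μk.J`, the axiom for `μ` moves the surrounding let inside the `μ`, and the
axiom for `[k]` moves it outside the resulting jump. -/
theorem SimJump.lett {p : Prop} {q q' : ℕ × Tm .term} (h : SimJump p q q') (N : Tm .term) :
    SimJump p (q.1, lett q.2 N) (q'.1, lett q'.2 N) := by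
  rcases h with ⟨h1, h2⟩ | ⟨J, h1, h2⟩
  · exact .inl ⟨h1, h2.ctx (isContext_lettL N)⟩
  · refine .inr ⟨Tm.lett J N.wkC, (h1.ctx (isContext_lettL N)).ident_right
      (.of_eqAx (.muLet _ _)), ?_⟩
    have e : (Tm.lett J N.wkC).substC q.1 = Tm.lett (J.substC q.1) N := by
      simp only [substC, ren, wkC, ren_ren, up_id]
      congr 1
      exact ren_id N
    rw [e]
    exact (Ident.of_eqAx (.jmpLet _ _ _)).trans (h2.lett (.refl N))

theorem back_substO {s : TSort} (t : Tgt s) (w : Tgt .W) :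
    IdentSem s (back (t.substO w)) (msubSem s (inst (back w)) (fun n => (n, none)) (back t)) := by
  have h := back_subst t (Tgt.instO w) Tgt.cvar
  have e : (fun n => back (Tgt.instO w n)) = inst (back w) := by
    funext n; cases n <;> rfl
  rw [e] at h
  exact h

theorem back_substC {s : TSort} (t : Tgt s) (c : Tgt .K) :
    IdentSem s (back (t.substC c)) (msubSem s var (fun n => back (Tgt.instC c n)) (back t)) :=
  back_subst t Tgt.var (Tgt.instC c)

theorem SimJump.ident_right {p : Prop} {q q' q'' : ℕ × Tm .term} (h : SimJump p q q')
    (h' : IdentSem .Q q'' q') : SimJump p q q'' := by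
  obtain ⟨l, M⟩ := q''
  obtain ⟨l', M'⟩ := q'
  obtain ⟨e, h'⟩ := h'
  simp only at e h'
  subst e
  exact h.imp (fun h => ⟨h.1, h.2.ident_right h'.symm⟩)
    (fun ⟨J, h1, h2⟩ => ⟨J, h1, (h'.ctx (isContext_jmp _)).trans h2⟩)

/-- Three cases. If `λk.q` is translated to the contracted form, both sides already agree, and the
step shrinks because `k` occurs exactly once. If `c` is a variable, the step is the renaming of
`SimJump`, and it shrinks because a variable replaces variables. If `c` is an abstraction, the rule
for `⌈P x:=μk.J⌋` gives a genuine step. -/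
theorem simJump_betaT (q : Tgt .Q) (c : Tgt .K) :
    SimJump ((q.substC c).size < (Tgt.appTK (.lamT q) c).size)
      (back (.appTK (.lamT q) c)) (back (q.substC c)) := by
  refine SimJump.ident_right ?_ (back_substC q c)
  have hsize := Tgt.size_substC q c
  have hcnt := cntC_back q 0
  simp only [back]
  generalize back q = x at hcnt ⊢
  obtain ⟨l, M⟩ := x
  by_cases hq : l = 0 ∧ cntC 0 M = 0
  · have hs : CCV.smart (l, M) = lowerC M := if_pos hq
    rw [hs]
    obtain ⟨rfl, hM⟩ := hq
    refine .inl ⟨rfl, .of_ident ?_ (.of_eq ?_)⟩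
    -- The leading `[k]` contributes the only occurrence of `k` in `q`.
    · simp only [cntSem, if_true, hM] at hcnt
      simp only [Tgt.size]
      rw [hsize, ← hcnt]
      omega
    · conv_rhs => rw [← wkC_lowerC hM]
      simp only [msubSem, Tgt.instC, wkC, msub_ren]
      congr 1
      conv_lhs => rw [← ren_id M.lowerC, ren_eq_msub]
      rfl
  · have hs : CCV.smart (l, M) = mu (jmp l M) := if_neg hq
    rw [hs]
    cases c with
    | cvar k =>
      refine .inr ⟨jmp l M, .of_ident ?_ (.refl _), .of_eq ?_⟩
      · simp only [Tgt.size] at hsize ⊢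
        omega
      · have e : (fun n => back (Tgt.instC (.cvar k) n)) = fun n => (instC k n, none) := by
          funext n; cases n <;> rfl
        rw [e, substC, ren_eq_msub]
        rfl
    | lamK r =>
      refine .inr ⟨ctxSubst 0 (wkC (back r).2) (jmp l M), .of_rule (.betaMu _ _), .of_eq ?_⟩
      -- The context substitution keeps the name `k`, and the jump in front then renames it.
      -- Together they send `k` to `[l']⌈P x:=□⌋`, the continuation denoted by `lamK r`.
      have e : renCont id (instC (back r).1) ∘ single 0 (wkC (back r).2) =
          fun n => back (Tgt.instC (.lamK r) n) := by
        funext n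
        cases n with
        | zero =>
          simp only [Function.comp, renCont, single, instC, wkC, if_true, Option.map_some, up_id,
            ren_ren, Tgt.instC, back]
          congr 2
          exact ren_id _
        | succ n => rfl
      change _ = (ctxSubst 0 (wkC (back r).2) (jmp l M)).ren id (instC (back r).1)
      rw [ctxSubst_eq_msub, ren_msub, e]
      rfl

/-- The label records that an identification without a source step is possible only if the target
shrinks. The rules `betaW`, `betaK`, `etaW` and `etaK` always give genuine steps, and `etaT` is
invisible in the source because `smart` has already performed it. A surrounding constructor adds the
same amount to both sizes, so the label passes through contexts. -/
theorem back_step {s : TSort} {t u : Tgt s} (h : Tgt.BetaEta s t u) :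
    SimSem (u.size < t.size) s (back t) (back u) := by
  induction h with
  | betaT q c => exact simJump_betaT q c
  | betaW t w =>
    have h1 : Sim False (app (lam (back t)) (back w)) (lett (back t) (back w)) :=
      .of_rule (.betaLam _ (isValue_back w))
    have h2 : Sim False (lett (back t) (back w)) ((back t).substO (back w)) :=
      .of_rule (.betaLet _ (isValue_back w))
    rw [substO, subst_eq_msub] at h2
    exact ((h1.trans h2).mono (fun h => h.1.elim)).ident_right (back_substO t w).symm
  | betaK q w =>
    refine SimJump.ident_right
      (q' := msubSem .Q (inst (back w)) (fun n => (n, none)) (back q))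
      (.inl ⟨rfl, ?_⟩) (back_substO q w)
    have h2 : Rule .term (lett (back q).2 (back w)) ((back q).2.substO (back w)) :=
      .betaLet _ (isValue_back w)
    rw [substO, subst_eq_msub] at h2
    exact .of_rule h2
  | etaT t =>
    refine .of_ident (by simp only [Tgt.size, Tgt.size_wkC]; omega) (.of_eq ?_)
    have e : back (Tgt.wkC t) = wkC (back t) := back_ren _ _ _
    simp only [back, plug, e, smart, cntC_wkC_zero, true_and, if_true, lowerC_wkC]
  | etaW w =>
    have e : back (Tgt.wkO w) = wkO (back w) := back_ren _ _ _
    simp only [back, e]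
    exact .of_rule (.etaLam (isValue_back w))
  | etaK c =>
    intro N
    have e : back (Tgt.wkO c) = renCont Nat.succ id (back c) := back_ren _ _ _
    simp only [back, e]
    generalize back c = κ
    obtain ⟨l, _ | P⟩ := κ
    · exact .inl ⟨rfl, .of_rule (.etaLet N)⟩
    -- When `c` is itself an abstraction, its expansion denotes `⌈⌈P y:=x⌋ x:=□⌋`, and the inner let
    -- substitutes a variable for a variable.
    · refine .inl ⟨rfl, ?_⟩
      have h : Rule .term (lett (P.ren (up Nat.succ) id) (var 0)) _ := .betaLet _ trivial
      have e : (P.ren (up Nat.succ) id).substO (var 0) = P := by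
        rw [substO, subst_eq_msub, msub_ren]
        conv_rhs => rw [← ren_id P, ren_eq_msub]
        congr 1
        funext n; cases n <;> rfl
      rw [e] at h
      exact (Sim.of_rule h).ctx (isContext_lettL N)
  | lamT _ ih =>
    exact SimJump.smart (SimSem.mono (s := .Q) (fun h => by simpa [Tgt.size] using h) ih)
  | appWWL _ ih =>
    exact Sim.ctx (isContext_appL _) (ih.mono fun h => by simpa [Tgt.size] using h)
  | appWWR _ ih =>
    exact Sim.ctx (isContext_appR _) (ih.mono fun h => by simpa [Tgt.size] using h)
  | appKWL _ ih =>
    exact SimSem.mono (s := .Q) (fun h => by simpa [Tgt.size] using h) (ih _)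
  | appKWR _ ih => exact SimJump.plug _ (ih.mono fun h => by simpa [Tgt.size] using h)
  | appTKL _ ih => exact SimJump.plug _ (ih.mono fun h => by simpa [Tgt.size] using h)
  | appTKR _ ih =>
    exact SimSem.mono (s := .Q) (fun h => by simpa [Tgt.size] using h) (ih _)
  | lamW _ ih => exact Sim.ctx isContext_lam (ih.mono fun h => by simpa [Tgt.size] using h)
  | lamK _ ih =>
    exact fun N => SimJump.lett (SimSem.mono (s := .Q) (fun h => by simpa [Tgt.size] using h) ih) N

end CCV

namespace CCV

namespace Tm

/-! ### A description of the irreducible terms -/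

/-- The possible shapes of a term after its outermost `let`s are stripped. -/
inductive Head
  | value
  | app
  | mu

/-- The shape of a term after its outermost `let`s are stripped. -/
def head : {s : Kind} → Tm s → Head
  | _, var _ => .value
  | _, lam _ => .value
  | _, app _ _ => .app
  | _, lett L _ => head L
  | _, mu _ => .mu
  | _, jmp _ _ => .app

/-- The expression is the variable `0`, apart from leading `μk` and `[k]`. -/
def IsZero : {s : Kind} → Tm s → Prop
  | _, var x => x = 0
  | _, lam _ => False
  | _, app _ _ => False
  | _, lett _ _ => False
  | _, mu J => IsZero J
  | _, jmp _ M => IsZero M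

/-- The continuation variable at the head of a jump. -/
def headC : {s : Kind} → Tm s → ℕ
  | _, lett J _ => headC J
  | _, jmp k _ => k
  | _, _ => 0

/-- `some (some x)` for the variable `x`, `some none` for an abstraction. -/
def outer : {s : Kind} → Tm s → Option (Option ℕ)
  | _, var x => some (some x)
  | _, lam _ => some none
  | _, _ => none

theorem eq_var_iff {M : Tm .term} {x : ℕ} : M = var x ↔ outer M = some (some x) := by
  cases M <;> simp [outer]

theorem isValue_iff {M : Tm .term} : M.IsValue ↔ outer M ≠ none := by
  cases M <;> simp [outer, IsValue]

/-- The body of an `η`-redex `λx.V x`. -/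
def IsEtaBody : {s : Kind} → Tm s → Prop
  | _, app M N => N = var 0 ∧ cntO 0 M = 0
  | _, _ => False

/-- A criterion for irreducibility. -/
def IsNormal : {s : Kind} → Tm s → Prop
  | _, var _ => True
  | _, lam M => IsNormal M ∧ ¬ IsEtaBody M
  | _, app M N => (∃ x, M = var x) ∧ N.IsValue ∧ IsNormal N
  | _, lett L M => IsNormal L ∧ IsNormal M ∧ head M = .app ∧ ¬ IsZero L
  | _, mu J => IsNormal J ∧ ¬ (headC J = 0 ∧ cntC 0 J = 1)
  | _, jmp _ M => IsNormal M ∧ head M ≠ .mu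

theorem head_ren {s : Kind} (P : Tm s) : ∀ f g : ℕ → ℕ, head (P.ren f g) = head P := by
  induction P <;> intro f g <;> simp_all [ren, head]

theorem headC_ren {s : Kind} (P : Tm s) : ∀ f g : ℕ → ℕ,
    headC (P.ren f (up g)) = up g (headC P) := by
  induction P <;> intro f g <;> simp_all [ren, headC, up]

theorem isZero_ren {s : Kind} (P : Tm s) : ∀ f g : ℕ → ℕ, IsZero (P.ren (up f) g) ↔ IsZero P := by
  induction P <;> intro f g <;> simp_all [ren, IsZero, up_eq_zero_iff]

theorem isEtaBody_ren {s : Kind} (P : Tm s) (f g : ℕ → ℕ) :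
    IsEtaBody (P.ren (up f) g) ↔ IsEtaBody P := by
  cases P with
  | app M N =>
    simp only [ren, IsEtaBody, cntO_ren M g (up_eq_zero_iff f)]
    cases N <;> simp [ren, up_eq_zero_iff]
  | _ => exact Iff.rfl

theorem isNormal_ren {s : Kind} (P : Tm s) : ∀ f g : ℕ → ℕ,
    IsNormal (P.ren f g) ↔ IsNormal P := by
  induction P with
  | var => intros; exact Iff.rfl
  | lam M ih => intro f g; simp only [ren, IsNormal, ih, isEtaBody_ren]
  | app M N ih ih' =>
    intro f g
    simp only [ren, IsNormal, ih', isValue_ren]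
    cases M <;> simp [ren]
  | lett L M ih ih' =>
    intro f g; simp only [ren, IsNormal, ih, ih', head_ren, isZero_ren]
  | mu J ih =>
    intro f g
    simp only [ren, IsNormal, ih, headC_ren, up_eq_zero_iff, cntC_ren J f (up_eq_zero_iff g)]
  | jmp k M ih => intro f g; simp only [ren, IsNormal, ih, head_ren]

theorem not_isZero_of_head {M : Tm .term} (h : head M = .app) : ¬ IsZero M := by
  cases M <;> simp_all [head, IsZero]

/-- The data on which the criterion depends are the same for the two expressions. -/
structure SameShape {s : Kind} (P Q : Tm s) : Prop where
  isNormal : IsNormal P ↔ IsNormal Q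
  head : head P = head Q
  isZero : IsZero P ↔ IsZero Q
  headC : headC P = headC Q
  outer : outer P = outer Q
  isEtaBody : IsEtaBody P ↔ IsEtaBody Q

/-- The criterion is made insensitive to the axioms: `head` and `headC` look through lets, and
`IsZero` looks through `μ` and `[k]`, since `⌈(μk.[l]x) x:=M⌋` is identified with `μk.[l]⌈x x:=M⌋`
and so hides an `η`-redex. -/
theorem EqAx.sameShape {s : Kind} {P Q : Tm s} (h : EqAx s P Q) : SameShape P Q := by
  cases h with
  | assoc L M N =>
    have hC : Tm.headC (L.ren (up Nat.succ) id) = Tm.headC L := by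
      have h := headC_ren L (up Nat.succ) id
      rwa [up_id] at h
    have hH : Tm.head (L.ren (up Nat.succ) id) = Tm.head L := head_ren _ _ _
    refine ⟨?_, hH.symm, Iff.rfl, hC.symm, rfl, Iff.rfl⟩
    simp only [IsNormal, isNormal_ren, isZero_ren, Tm.head]
    constructor
    · rintro ⟨h1, ⟨h2, h3, h4, h5⟩, h6, h7⟩
      exact ⟨⟨h1, h2, h6, h7⟩, h3, h4, not_false⟩
    · rintro ⟨⟨h1, h2, h6, h7⟩, h3, h4, -⟩
      exact ⟨h1, ⟨h2, h3, h4, not_isZero_of_head h6⟩, h6, h7⟩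
  | muLet J M =>
    refine ⟨?_, rfl, Iff.rfl, rfl, rfl, Iff.rfl⟩
    have h : IsNormal M.wkC ↔ IsNormal M := isNormal_ren _ _ _
    have h' : Tm.head M.wkC = Tm.head M := head_ren _ _ _
    simp only [IsNormal, h, h', IsZero, Tm.headC, cntC, cntC_wkC_zero, add_zero]
    tauto
  | jmpLet k L M =>
    refine ⟨?_, rfl, Iff.rfl, rfl, rfl, Iff.rfl⟩
    simp only [IsNormal, IsZero, Tm.head]
    tauto

theorem Compat.sameShape {s : Kind} {P Q : Tm s} (h : Compat EqAx s P Q) : SameShape P Q := by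
  induction h with
  | base h => exact h.sameShape
  | lam h ih =>
    exact ⟨by simp only [IsNormal, ih.isNormal, ih.isEtaBody], rfl, Iff.rfl, rfl, rfl, Iff.rfl⟩
  | appL h ih =>
    refine ⟨?_, rfl, Iff.rfl, rfl, rfl, ?_⟩
    · simp only [IsNormal, eq_var_iff, ih.outer]
    · simp only [IsEtaBody, cntO_eq_of_compat h]
  | appR h ih =>
    refine ⟨?_, rfl, Iff.rfl, rfl, rfl, ?_⟩
    · simp only [IsNormal, isValue_iff, ih.outer, ih.isNormal]
    · simp only [IsEtaBody, eq_var_iff, ih.outer]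
  | lettL h ih =>
    exact ⟨by simp only [IsNormal, ih.isNormal, ih.isZero], ih.head, Iff.rfl, ih.headC, rfl, Iff.rfl⟩
  | lettR h ih =>
    exact ⟨by simp only [IsNormal, ih.isNormal, ih.head], rfl, Iff.rfl, rfl, rfl, Iff.rfl⟩
  | mu h ih =>
    exact ⟨by simp only [IsNormal, ih.isNormal, ih.headC, cntC_eq_of_compat h], rfl, ih.isZero, rfl,
      rfl, Iff.rfl⟩
  | jmp h ih =>
    exact ⟨by simp only [IsNormal, ih.isNormal, ih.head], rfl, ih.isZero, rfl, rfl, Iff.rfl⟩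

theorem Ident.isNormal_iff {s : Kind} {P Q : Tm s} (h : Ident P Q) : IsNormal P ↔ IsNormal Q := by
  induction h with
  | rel _ _ h => exact (Compat.sameShape h).isNormal
  | refl => exact Iff.rfl
  | symm _ _ _ ih => exact ih.symm
  | trans _ _ _ _ _ ih ih' => exact ih.trans ih'

theorem Rule.not_isNormal {s : Kind} {P Q : Tm s} (h : Rule s P Q) : ¬ IsNormal P := by
  cases h with
  | ad₁ M hN => rintro ⟨⟨x, rfl⟩, -⟩; exact hN trivial
  | ad₂ hV hN => rintro ⟨-, h, -⟩; exact hN h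
  | betaLam M hV => rintro ⟨⟨x, h⟩, -⟩; cases h
  | @betaLet M V hV => rintro ⟨-, -, h, -⟩; cases V <;> simp_all [head, IsValue]
  | betaMu M J => rintro ⟨-, -, h, -⟩; cases h
  | betaJmp l J => rintro ⟨-, h⟩; exact h rfl
  | etaLam hV => rintro ⟨-, h⟩; exact h ⟨rfl, cntO_wkO_zero _⟩
  | etaLet M => rintro ⟨-, -, -, h⟩; exact h rfl
  | etaMu M => rintro ⟨-, h⟩; exact h ⟨rfl, by simp [cntC]⟩

theorem Compat.not_isNormal {s : Kind} {P Q : Tm s} (h : Compat Rule s P Q) : ¬ IsNormal P := by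
  induction h with
  | base h => exact h.not_isNormal
  | lam _ ih => exact fun h => ih h.1
  | appL _ ih =>
    rintro ⟨⟨x, rfl⟩, -⟩
    exact ih trivial
  | appR _ ih => exact fun h => ih h.2.2
  | lettL _ ih => exact fun h => ih h.1
  | lettR _ ih => exact fun h => ih h.2.1
  | mu _ ih => exact fun h => ih h.1
  | jmp _ ih => exact fun h => ih h.1

theorem IsNormal.not_step {s : Kind} {P Q : Tm s} (h : IsNormal P) : ¬ Step P Q := by
  rintro ⟨P', Q', h1, h2, -⟩
  exact Compat.not_isNormal h2 (h1.isNormal_iff.1 h)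

end Tm

open Tm

/-! ### The inverse translation preserves normal forms -/

/-- The expression that `back` yields for each sort satisfies the criterion. -/
def NormalSem : (s : TSort) → Sem s → Prop
  | .T, M => IsNormal M
  | .Q, q => IsNormal (jmp q.1 q.2)
  | .W, M => IsNormal M
  | .K, κ => ∀ P, κ.2 = some P → IsNormal P ∧ ¬ IsZero P ∧ head P ≠ .mu

/-- If `smart` does not contract `μk.[k]M`, then `k` is free in `M` and occurs at least twice in the
body. -/
theorem isNormal_smart {q : ℕ × Tm .term} (h : NormalSem .Q q) : IsNormal (smart q) := by
  unfold smart
  split_ifs with hq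
  · exact (isNormal_ren _ _ _).2 h.1
  · refine ⟨h, fun h' => hq ⟨h'.1, ?_⟩⟩
    have h1 : q.1 = 0 := h'.1
    have h2 := h'.2
    simpa [cntC, h1] using h2

theorem isZero_back {w : Tgt .W} (h : back w = var 0) : w = .var 0 := by
  cases w with
  | var x => cases h; rfl
  | lamW t => cases h

/-- Occurrences of an ordinary variable. -/
def cntSemO (k : ℕ) : (s : TSort) → Sem s → ℕ
  | .T, M => cntO k M
  | .Q, q => cntO k q.2
  | .W, M => cntO k M
  | .K, (_, none) => 0
  | .K, (_, some P) => cntO (k + 1) P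

theorem cntO_smart (k : ℕ) (q : ℕ × Tm .term) : cntO k (smart q) = cntO k q.2 := by
  unfold smart
  split_ifs
  · exact cntO_ren _ _ (by simp)
  · rfl

theorem cntO_plug (k : ℕ) (κ : Cont) (M : Tm .term) :
    cntO k (plug κ.2 M) = cntSemO k .K κ + cntO k M := by
  obtain ⟨l, _ | P⟩ := κ
  · simp [plug, cntSemO]
  · rfl

theorem cntO_back {s : TSort} (t : Tgt s) : ∀ k, cntSemO k s (back t) = Tgt.cntO k t := by
  induction t with
  | lamT q ih => intro k; rw [Tgt.cntO, ← ih]; exact cntO_smart _ _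
  | appWW v w ih ih' => intro k; rw [Tgt.cntO, ← ih, ← ih']; rfl
  | appKW c w ih ih' => intro k; rw [Tgt.cntO, ← ih, ← ih']; exact cntO_plug _ _ _
  | appTK t c ih ih' =>
    intro k; rw [Tgt.cntO, ← ih, ← ih', Nat.add_comm]; exact cntO_plug _ _ _
  | var x => intro k; rfl
  | lamW t ih => exact fun k => ih _
  | cvar l => intro k; rfl
  | lamK q ih => exact fun k => ih _

/-- Only the contracted form could be an application. It would come from `λk.(v w) k` with `k` not
free in `v w`, which is an `etaT`-redex. -/
theorem not_isEtaBody_smart {q : Tgt .Q} (h : ∀ u, ¬ Tgt.BetaEta .T (.lamT q) u) :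
    ¬ IsEtaBody (smart (back q)) := by
  unfold smart
  split_ifs with hq
  · obtain ⟨h1, h2⟩ := hq
    cases q with
    | appKW c w =>
      cases c with
      | cvar k => cases w <;> exact id
      | lamK q => exact absurd (.lamT (.betaK q w)) (h _)
    | appTK t c =>
      cases t with
      | lamT q => exact absurd (.lamT (.betaT q c)) (h _)
      | appWW v w =>
        cases c with
        | cvar k =>
          obtain rfl : k = 0 := h1
          obtain ⟨t, ht⟩ := Tgt.exists_eq_wkC
            ((cntC_back (.appWW v w) 0).symm.trans h2)
          rw [ht] at h
          exact absurd (.etaT t) (h _)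
        | lamK q => exact id
  · exact id

/-- Each violation of the criterion is traced to a target redex: an applied abstraction to `betaW`,
a let of a value to `betaK`, a let of a `μ` or a jump to a `μ` to `betaT`, a body `V x` to `etaW`,
and a let with body `x` to `etaK`. -/
theorem normalSem_back {s : TSort} (t : Tgt s) : (∀ u, ¬ Tgt.BetaEta s t u) →
    NormalSem s (back t) := by
  induction t with
  | lamT q ih => exact fun h => isNormal_smart (ih fun u hu => h _ (.lamT hu))
  | appWW v w ih ih' =>
    intro h
    refine ⟨?_, isValue_back w, ih' fun u hu => h _ (.appWWR hu)⟩
    cases v with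
    | var x => exact ⟨x, rfl⟩
    | lamW t => exact absurd (.betaW t w) (h _)
  | appKW c w ih ih' =>
    intro h
    cases c with
    | cvar k =>
      refine ⟨ih' fun u hu => h _ (.appKWR hu), ?_⟩
      cases w <;> simp [back, plug, head]
    | lamK q => exact absurd (.betaK q w) (h _)
  | appTK t c ih ih' =>
    intro h
    have ht := ih fun u hu => h _ (.appTKL hu)
    have hc := ih' fun u hu => h _ (.appTKR hu)
    cases t with
    | lamT q => exact absurd (.betaT q c) (h _)
    | appWW v w =>
      cases c with
      | cvar k => exact ⟨ht, by simp [back, plug, head]⟩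
      | lamK q =>
        obtain ⟨h1, h2⟩ := hc _ rfl
        exact ⟨⟨h1, ht, rfl, h2.1⟩, h2.2⟩
  | var x => exact fun _ => trivial
  | lamW t ih =>
    intro h
    refine ⟨ih fun u hu => h _ (.lamW hu), fun he => ?_⟩
    cases t with
    | appWW v w =>
      obtain ⟨h1, h2⟩ := he
      cases isZero_back h1
      obtain ⟨v', rfl⟩ := Tgt.exists_eq_wkO ((cntO_back v 0).symm.trans h2)
      exact h _ (.etaW v')
    | lamT q => exact not_isEtaBody_smart (fun u hu => h _ (.lamW hu)) he
  | cvar k => intro _ P hP; cases hP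
  | lamK q ih =>
    intro h P hP
    have hq := ih fun u hu => h _ (.lamK hu)
    cases hP
    refine ⟨hq.1, fun hz => ?_, hq.2⟩
    cases q with
    | appKW c w =>
      cases c with
      | cvar k =>
        cases w with
        | var x =>
          obtain rfl : x = 0 := hz
          exact h _ (.etaK (.cvar k))
        | lamW t => exact hz
      | lamK q => exact h _ (.lamK (.betaK q w))
    | appTK t c =>
      cases t with
      | lamT q => exact h _ (.lamK (.betaT q c))
      | appWW v w => cases c <;> exact hz

end CCV

namespace CCV

open Tm

/-! ### The translation commutes with substitution -/

/-- The target continuation that corresponds to a source continuation. -/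
def contTgt : Cont → Tgt .K
  | (l, none) => .cvar l
  | (l, some P) => .lamK (colon P (.cvar l))

/-- Closure properties of a relation between source and target assignments, under which the
translation commutes with the application of related assignments. -/
structure Compatible (C : (ℕ → ℕ) → (ℕ → ℕ) → (ℕ → Tm .term) → (ℕ → Cont) →
    (ℕ → Tgt .W) → (ℕ → Tgt .K) → Prop) : Prop where
  star : ∀ {f g σ θ σ' θ'}, C f g σ θ σ' θ' → ∀ n, star (σ n) = some (σ' (f n))
  cont : ∀ {f g σ θ σ' θ'}, C f g σ θ σ' θ' → ∀ n, θ' (g n) = contTgt (θ n)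
  liftO : ∀ {f g σ θ σ' θ'}, C f g σ θ σ' θ' →
    C (up f) g (upSubst σ) (renCont Nat.succ id ∘ θ) (Tgt.upO σ') (fun n => (θ' n).wkO)
  liftC : ∀ {f g σ θ σ' θ'}, C f g σ θ σ' θ' →
    C f (up g) (wkC ∘ σ) (upCont θ) (fun n => (σ' n).wkC) (Tgt.upC θ')

theorem colon_plug (κ : Cont) (M : Tm .term) :
    colon (plug κ.2 M) (.cvar κ.1) = colon M (contTgt κ) := by
  obtain ⟨l, _ | P⟩ := κ
  · rfl
  · simp only [plug, colon, contTgt, Tgt.wkO_cvar]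

theorem msub_wkO {s : Kind} (M : Tm s) (σ : ℕ → Tm .term) (θ : ℕ → Cont) :
    msub (upSubst σ) (renCont Nat.succ id ∘ θ) M.wkO = (msub σ θ M).wkO := by
  simp only [wkO, msub_ren, ren_msub]; rfl

theorem colon_star {M : Tm .term} {v : Tgt .W} (h : star M = some v) (c : Tgt .K) :
    colon M c = .appKW c v := by
  cases M <;> simp only [star, Option.some.injEq, reduceCtorEq] at h
  · subst h; rw [colon]
  · subst h; rw [colon]

theorem star_eq_none {M : Tm .term} (h : ¬ M.IsValue) : star M = none := by
  cases M <;> simp_all [star, IsValue]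

theorem exists_star {M : Tm .term} (h : M.IsValue) : ∃ v, star M = some v := by
  cases M <;> simp_all [star, IsValue]

/-- The induction is on size because the translation recurses on weakened subterms. The relation is
abstract because the argument is used twice: for renamings first, and then for substitutions, whose
closure under binders presupposes the result for renamings. The preliminary renaming by `f` and `g`
gives `c` variables that are absent from `M`. -/
theorem Compatible.commute {C : (ℕ → ℕ) → (ℕ → ℕ) → (ℕ → Tm .term) → (ℕ → Cont) →
    (ℕ → Tgt .W) → (ℕ → Tgt .K) → Prop} (hC : Compatible C) (m : ℕ) :
    (∀ M : Tm .term, M.size < m → ∀ {f g σ θ σ' θ'}, C f g σ θ σ' θ' →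
      CCV.star (msub σ θ M) = (CCV.star (M.ren f g)).map (Tgt.subst σ' θ') ∧
      ∀ c : Tgt .K, colon (msub σ θ M) (c.subst σ' θ') = (colon (M.ren f g) c).subst σ' θ') ∧
    (∀ J : Tm .jump, J.size < m → ∀ {f g σ θ σ' θ'}, C f g σ θ σ' θ' →
      colonJ (msub σ θ J) = (colonJ (J.ren f g)).subst σ' θ') := by
  induction m with
  | zero => exact ⟨fun _ h => absurd h (by omega), fun _ h => absurd h (by omega)⟩
  | succ m ih =>
    obtain ⟨ihT, ihJ⟩ := ih
    constructor
    · intro M hM f g σ θ σ' θ' hσ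
      cases M with
      | var x =>
        have h := hC.star hσ x
        refine ⟨by simp only [msub, ren, h, CCV.star, Option.map_some, Tgt.subst], fun c => ?_⟩
        simp only [msub, ren, colon_star h, colon, Tgt.subst]
      | lam M =>
        have h := (ihT M.wkC (by simp only [size, size_wkC] at hM ⊢; omega)
          (hC.liftC (hC.liftO hσ))).2 (.cvar 0)
        have h1 : (M.ren (up f) g).wkC = M.wkC.ren (up f) (up g) := by
          simp only [wkC, ren_ren]; rfl
        rw [msub_wkC, ← h1] at h
        refine ⟨?_, fun c => ?_⟩ <;>
        · simp only [msub, ren, CCV.star, colon, Option.map_some, Tgt.subst]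
          rw [← h]
          rfl
      | app M N =>
        simp only [size] at hM
        obtain ⟨hM1, hM2⟩ := ihT M (by omega) hσ
        obtain ⟨hN1, hN2⟩ := ihT N (by omega) hσ
        have hN3 := (ihT N.wkO (by rw [size_wkO]; omega) (hC.liftO hσ)).2
        have e : N.wkO.ren (up f) g = (N.ren f g).wkO := ren_wkO _ _ _
        rw [msub_wkO, e] at hN3
        refine ⟨by simp [msub, ren, CCV.star], fun c => ?_⟩
        simp only [msub, ren, colon, hM1, hN1]
        rcases CCV.star (M.ren f g) with _ | v <;> rcases CCV.star (N.ren f g) with _ | w <;>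
          simp only [Option.map_none, Option.map_some]
        · rw [← hM2]
          simp only [Tgt.subst, ← hN3, Tgt.subst_wkO]
          rfl
        · rw [← hM2]
          simp only [Tgt.subst, Tgt.subst_wkO]
          rfl
        · rw [← hN2]
          simp only [Tgt.subst, Tgt.subst_wkO]
          rfl
        · rfl
      | lett L M =>
        simp only [size] at hM
        refine ⟨by simp [msub, ren, CCV.star], fun c => ?_⟩
        have h1 := (ihT L (by omega) (hC.liftO hσ)).2 c.wkO
        have h2 := (ihT M (by omega) hσ).2
        simp only [msub, ren, colon]
        rw [← h2, Tgt.subst, ← h1, Tgt.subst_wkO]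
      | mu J =>
        simp only [size] at hM
        refine ⟨by simp [msub, ren, CCV.star], fun c => ?_⟩
        have h1 := ihJ J (by omega) (hC.liftC hσ)
        simp only [msub, ren, colon, h1, Tgt.subst]
    · intro J hJ f g σ θ σ' θ' hσ
      cases J with
      | jmp k M =>
        simp only [size] at hJ
        have h := (ihT M (by omega) hσ).2 (.cvar (g k))
        simp only [msub, ren, colonJ, ← h, colon_plug, Tgt.subst, hC.cont hσ]
      | lett J M =>
        simp only [size] at hJ
        have h1 := ihJ J (by omega) (hC.liftO hσ)
        have h2 := (ihT M (by omega) hσ).2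
        simp only [msub, ren, colonJ]
        rw [← h2, Tgt.subst, ← h1]

/-- The assignments rename, after a preliminary renaming by `f` and `g`. -/
def RenLike (f g : ℕ → ℕ) (σ : ℕ → Tm .term) (θ : ℕ → Cont) (σ' : ℕ → Tgt .W)
    (θ' : ℕ → Tgt .K) : Prop :=
  ∃ a b : ℕ → ℕ, σ = var ∘ a ∧ (θ = fun n => (b n, none)) ∧ (∀ n, σ' (f n) = .var (a n)) ∧
    ∀ n, θ' (g n) = .cvar (b n)

theorem compatible_renLike : Compatible RenLike where
  star := by
    rintro f g σ θ σ' θ' ⟨a, b, rfl, rfl, h, h'⟩ n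
    simp [CCV.star, h]
  cont := by
    rintro f g σ θ σ' θ' ⟨a, b, rfl, rfl, h, h'⟩ n
    exact h' n
  liftO := by
    rintro f g σ θ σ' θ' ⟨a, b, rfl, rfl, h, h'⟩
    refine ⟨up a, b, ?_, rfl, fun n => ?_, fun n => ?_⟩
    · funext n; cases n <;> rfl
    · cases n with
      | zero => rfl
      | succ n => simp only [up, Tgt.upO, h]; rfl
    · simp only [h']; rfl
  liftC := by
    rintro f g σ θ σ' θ' ⟨a, b, rfl, rfl, h, h'⟩
    refine ⟨a, up b, rfl, ?_, fun n => ?_, fun n => ?_⟩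
    · funext n; cases n <;> rfl
    · simp only [h]; rfl
    · cases n with
      | zero => rfl
      | succ n => simp only [up, Tgt.upC, h']; rfl

section
variable {f g a b : ℕ → ℕ} {σ' : ℕ → Tgt .W} {θ' : ℕ → Tgt .K}

theorem colon_ren_subst (hσ : ∀ n, σ' (f n) = .var (a n)) (hθ : ∀ n, θ' (g n) = .cvar (b n))
    (M : Tm .term) (c : Tgt .K) :
    (colon (M.ren f g) c).subst σ' θ' = colon (M.ren a b) (c.subst σ' θ') := by
  rw [ren_eq_msub M a b]
  exact (((compatible_renLike.commute _).1 M (Nat.lt_succ_self _)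
    ⟨a, b, rfl, rfl, hσ, hθ⟩).2 c).symm

theorem colonJ_ren_subst (hσ : ∀ n, σ' (f n) = .var (a n)) (hθ : ∀ n, θ' (g n) = .cvar (b n))
    (J : Tm .jump) : (colonJ (J.ren f g)).subst σ' θ' = colonJ (J.ren a b) := by
  rw [ren_eq_msub J a b]
  exact ((compatible_renLike.commute _).2 J (Nat.lt_succ_self _)
    ⟨a, b, rfl, rfl, hσ, hθ⟩).symm

end

theorem star_ren (M : Tm .term) (f g : ℕ → ℕ) :
    star (M.ren f g) = (star M).map (Tgt.ren f g) := by
  have h := ((compatible_renLike.commute _).1 M (Nat.lt_succ_self _)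
    (f := id) (g := id) (σ := var ∘ f) (θ := fun n => (g n, none)) (σ' := .var ∘ f)
    (θ' := .cvar ∘ g) ⟨f, g, rfl, rfl, fun _ => rfl, fun _ => rfl⟩).1
  rw [← ren_eq_msub, ren_id] at h
  rw [h]
  congr 1
  funext t
  exact (Tgt.ren_eq_subst t f g).symm

theorem colon_ren (M : Tm .term) (c : Tgt .K) (f g : ℕ → ℕ) :
    (colon M c).ren f g = colon (M.ren f g) (c.ren f g) := by
  rw [Tgt.ren_eq_subst, Tgt.ren_eq_subst]
  conv_lhs => rw [← ren_id M]
  exact colon_ren_subst (f := id) (g := id) (σ' := .var ∘ f) (θ' := .cvar ∘ g) (fun _ => rfl) (fun _ => rfl) M c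

theorem contTgt_ren (κ : Cont) (f g : ℕ → ℕ) :
    contTgt (renCont f g κ) = (contTgt κ).ren f g := by
  obtain ⟨l, _ | P⟩ := κ
  · rfl
  · simp only [renCont, contTgt, Option.map_some, Tgt.ren, colon_ren]

/-- The assignments substitute, after a preliminary renaming by `f` and `g`. -/
def SubstLike (f g : ℕ → ℕ) (σ : ℕ → Tm .term) (θ : ℕ → Cont) (σ' : ℕ → Tgt .W)
    (θ' : ℕ → Tgt .K) : Prop :=
  (∀ n, star (σ n) = some (σ' (f n))) ∧ ∀ n, θ' (g n) = contTgt (θ n)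

theorem compatible_substLike : Compatible SubstLike where
  star := And.left
  cont := And.right
  liftO := by
    rintro f g σ θ σ' θ' ⟨h, h'⟩
    refine ⟨fun n => ?_, fun n => ?_⟩
    · cases n with
      | zero => simp [upSubst, star, up, Tgt.upO]
      | succ n => simp only [upSubst, wkO, star_ren, h, up]; rfl
    · simp only [h', Function.comp, contTgt_ren]; rfl
  liftC := by
    rintro f g σ θ σ' θ' ⟨h, h'⟩
    refine ⟨fun n => ?_, fun n => ?_⟩
    · simp only [Function.comp, wkC, star_ren, h]; rfl
    · cases n with
      | zero => rfl
      | succ n => simp only [up, Tgt.upC, h', upCont, contTgt_ren]; rfl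

section
variable {σ : ℕ → Tm .term} {θ : ℕ → Cont} {σ' : ℕ → Tgt .W} {θ' : ℕ → Tgt .K}

theorem colon_msub (hσ : ∀ n, star (σ n) = some (σ' n)) (hθ : ∀ n, θ' n = contTgt (θ n))
    (M : Tm .term) (c : Tgt .K) :
    (colon M c).subst σ' θ' = colon (msub σ θ M) (c.subst σ' θ') := by
  have h := ((compatible_substLike.commute _).1 M (Nat.lt_succ_self _)
    (f := id) (g := id) ⟨hσ, hθ⟩).2 c
  rw [h, ren_id]

theorem colonJ_msub (hσ : ∀ n, star (σ n) = some (σ' n)) (hθ : ∀ n, θ' n = contTgt (θ n))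
    (J : Tm .jump) : (colonJ J).subst σ' θ' = colonJ (msub σ θ J) := by
  have h := (compatible_substLike.commute _).2 J (Nat.lt_succ_self _)
    (f := id) (g := id) ⟨hσ, hθ⟩
  rw [h, ren_id]

end

/-- The substituted variable is fresh for `M` but may occur in `c`, so the substitution acts on the
continuation only. -/
theorem colon_wkC_substC (M : Tm .term) (c c' : Tgt .K) :
    (colon M.wkC c).substC c' = colon M (c.substC c') := by
  conv_rhs => rw [← ren_id M]
  exact colon_ren_subst (f := id) (g := Nat.succ) (σ' := .var) (θ' := Tgt.instC c')
    (fun _ => rfl) (fun _ => rfl) M c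

theorem colon_wkO_substO (M : Tm .term) (c : Tgt .K) (w : Tgt .W) :
    (colon M.wkO c).substO w = colon M (c.substO w) := by
  conv_rhs => rw [← ren_id M]
  exact colon_ren_subst (f := Nat.succ) (g := id) (σ' := Tgt.instO w) (θ' := .cvar)
    (fun _ => rfl) (fun _ => rfl) M c

theorem star_inst {V : Tm .term} {v : Tgt .W} (h : star V = some v) (n : ℕ) :
    star (inst V n) = some (Tgt.instO v n) := by
  cases n with
  | zero => exact h
  | succ n => simp [inst, star, Tgt.instO]

theorem colon_substO {V : Tm .term} {v : Tgt .W} (h : star V = some v) (M : Tm .term)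
    (c : Tgt .K) : (colon M c.wkO).substO v = colon (M.substO V) c := by
  rw [substO, subst_eq_msub, Tgt.substO, colon_msub (θ' := .cvar) (θ := fun n => (n, none)) (star_inst h) (fun _ => rfl)]
  exact congrArg _ (Tgt.substO_wkO c v)

/-! ### A term reduces to the inverse translation of its translation -/

theorem back_wkO (c : Tgt .K) : back c.wkO = renCont Nat.succ id (back c) := back_ren _ _ _

theorem back_wkO_W (w : Tgt .W) : back w.wkO = (back w).wkO := back_ren _ _ _

theorem plug_back_lett (c : Tgt .K) (L N : Tm .term) :
    Ident (plug (back c).2 (lett L N)) (lett (plug (back c.wkO).2 L) N) := by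
  rw [back_wkO]
  exact plug_lett _ _ _

/-- A non-value operator or operand is named by a let, and associativity moves the continuation
inside that let, as the translation does. A `μ` may be contracted by `smart`, which is an `η`-step.
-/
theorem red_back_colon (m : ℕ) :
    (∀ M : Tm .term, M.size < m → (∀ v, star M = some v → Red M (back v)) ∧
      ∀ c, (back (colon M c)).1 = (back c).1 ∧
        Red (plug (back c).2 M) (back (colon M c)).2) ∧
    (∀ J : Tm .jump, J.size < m → Red J (jmp (back (colonJ J)).1 (back (colonJ J)).2)) := by
  induction m with
  | zero => exact ⟨fun _ h => absurd h (by omega), fun _ h => absurd h (by omega)⟩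
  | succ m ih =>
    obtain ⟨ihT, ihJ⟩ := ih
    constructor
    · intro M hM
      cases M with
      | var x =>
        refine ⟨fun v h => ?_, fun c => ?_⟩
        · simp only [star, Option.some.injEq] at h
          subst h; exact .refl _
        · simp only [colon, back]; exact ⟨trivial, .refl _⟩
      | lam M =>
        have h : Red M (smart (back (colon M.wkC (.cvar 0)))) := by
          obtain ⟨h1, h2⟩ := (ihT M.wkC (by simp only [size, size_wkC] at hM ⊢; omega)).2 (.cvar 0)
          have h3 : cntC 0 (back (colon M.wkC (.cvar 0))).2 = 0 :=
            h2.cntC_eq_zero (cntC_wkC_zero M)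
          -- The bound continuation variable is fresh for the weakened `M` and stays absent under
          -- reduction, so `smart` takes its contracting branch and no `μ` appears.
          rw [smart, if_pos ⟨h1, h3⟩]
          have h4 : Red M.wkC.lowerC _ := h2.ctx (isContext_ren id Nat.pred)
          rwa [lowerC_wkC] at h4
        refine ⟨fun v hv => ?_, fun c => ?_⟩
        · simp only [star, Option.some.injEq] at hv
          subst hv; exact h.ctx isContext_lam
        · simp only [colon, back]
          exact ⟨trivial, (h.ctx isContext_lam).ctx (isContext_plug _)⟩
      | app M N =>
        simp only [size] at hM
        obtain ⟨hM1, hM2⟩ := ihT M (by omega)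
        obtain ⟨hN1, hN2⟩ := ihT N (by omega)
        refine ⟨fun v h => by simp [star] at h, fun c => ?_⟩
        simp only [colon]
        rcases eM : star M with _ | v <;> rcases eN : star N with _ | w <;> simp only
        · have vM : ¬ M.IsValue := fun h => by obtain ⟨v, h⟩ := exists_star h; simp [h] at eM
          have vN : ¬ N.wkO.IsValue := fun h => by
            obtain ⟨v, h⟩ := exists_star ((isValue_ren _ _).1 h); simp [h] at eN
          obtain ⟨h1, h2⟩ := (ihT N.wkO (by rw [size_wkO]; omega)).2
            (.lamK (.appTK (.appWW (.var 1) (.var 0)) c.wkO.wkO))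
          obtain ⟨h3, h4⟩ := hM2 (.lamK (colon N.wkO
            (.lamK (.appTK (.appWW (.var 1) (.var 0)) c.wkO.wkO))))
          refine ⟨h3.trans (h1.trans (by simp [back, back_wkO, renCont])), ?_⟩
          have h5 : Red (app M N) _ := .of_rule (.ad₁ N vM)
          have h6 : Red (app (var 0) N.wkO) _ := .of_rule (.ad₂ (V := var 0) trivial vN)
          have h7 := (Red.trans h5 (h6.ctx (isContext_lettL M))).ctx (isContext_plug (back c).2)
          refine Red.trans (h7.ident_right (plug_back_lett _ _ _)) (Red.trans ?_ h4)
          exact (h2.ident_left (plug_back_lett _ _ _)).ctx (isContext_lettL M)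
        · have vM : ¬ M.IsValue := fun h => by obtain ⟨v, h⟩ := exists_star h; simp [h] at eM
          obtain ⟨h3, h4⟩ := hM2 (.lamK (.appTK (.appWW (.var 0) w.wkO) c.wkO))
          refine ⟨h3.trans (by simp [back, back_wkO, renCont]), ?_⟩
          have h5 : Red (app M N) _ := .of_rule (.ad₁ N vM)
          have h6 : Red N.wkO (back w).wkO := (hN1 w eN).ctx (isContext_ren _ _)
          have h7 := (Red.trans h5 ((h6.ctx (isContext_appR _)).ctx (isContext_lettL M))).ctx
            (isContext_plug (back c).2)
          refine Red.trans (h7.ident_right (plug_back_lett _ _ _)) ?_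
          simp only [back, back_wkO_W] at h4
          exact h4
        · have vN : ¬ N.IsValue := fun h => by obtain ⟨v, h⟩ := exists_star h; simp [h] at eN
          obtain ⟨h3, h4⟩ := hN2 (.lamK (.appTK (.appWW v.wkO (.var 0)) c.wkO))
          refine ⟨h3.trans (by simp [back, back_wkO, renCont]), ?_⟩
          have h5 : Red (app M N) (app (back v) N) := (hM1 v eM).ctx (isContext_appL N)
          have h6 : Red (app (back v) N) _ := .of_rule (.ad₂ (isValue_back v) vN)
          have h7 := (Red.trans h5 h6).ctx (isContext_plug (back c).2)
          refine Red.trans (h7.ident_right (plug_back_lett _ _ _)) ?_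
          simp only [back, back_wkO_W] at h4
          exact h4
        · refine ⟨rfl, Red.trans ?_ (.refl _)⟩
          exact (Red.trans ((hM1 v eM).ctx (isContext_appL N))
            ((hN1 w eN).ctx (isContext_appR _))).ctx (isContext_plug _)
      | lett L M =>
        simp only [size] at hM
        refine ⟨fun v h => by simp [star] at h, fun c => ?_⟩
        have e : back c.wkO = renCont Nat.succ id (back c) := back_ren _ _ _
        obtain ⟨h1, h2⟩ := (ihT L (by omega)).2 c.wkO
        obtain ⟨h3, h4⟩ := (ihT M (by omega)).2 (.lamK (colon L c.wkO))
        simp only [colon]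
        rw [e] at h1 h2
        refine ⟨h3.trans h1, Red.trans ?_ h4⟩
        exact (h2.ctx (isContext_lettL M)).ident_left (plug_lett _ _ _)
      | mu J =>
        simp only [size] at hM
        refine ⟨fun v h => by simp [star] at h, fun c => ?_⟩
        simp only [colon, back]
        exact ⟨trivial, (Sim.smart ((ihJ J (by omega)).ctx isContext_mu)).ctx (isContext_plug _)⟩
    · intro J hJ
      cases J with
      | jmp k M =>
        simp only [size] at hJ
        obtain ⟨h1, h2⟩ := (ihT M (by omega)).2 (.cvar k)
        simp only [colonJ]
        rw [h1]
        exact h2.ctx (isContext_jmp k)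
      | lett J M =>
        simp only [size] at hJ
        obtain ⟨h1, h2⟩ := (ihT M (by omega)).2 (.lamK (colonJ J))
        simp only [colonJ]
        rw [h1]
        have h3 := (ihJ J (by omega)).ctx (isContext_lettL M)
        refine Red.trans (h3.ident_right (Ident.of_eqAx (.jmpLet _ _ _)).symm) ?_
        exact h2.ctx (isContext_jmp _)

theorem red_back_cps (M : Tm .term) : Red M (back (cps M)) := by
  obtain ⟨h1, h2⟩ := ((red_back_colon _).1 M.wkC (Nat.lt_succ_self _)).2 (.cvar 0)
  have h3 : cntC 0 (back (colon M.wkC (.cvar 0))).2 = 0 := h2.cntC_eq_zero (cntC_wkC_zero M)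
  rw [cps, back, smart, if_pos ⟨h1, h3⟩]
  have h4 : Red M.wkC.lowerC _ := h2.ctx (isContext_ren id Nat.pred)
  rwa [lowerC_wkC] at h4

end CCV

namespace CCV

-- `βη`-equality as a congruence on the target.

namespace Tgt

/-- `βη`-equality. -/
abbrev Conv {s : TSort} (t u : Tgt s) : Prop := Relation.EqvGen (BetaEta s) t u

theorem Conv.of_step {s : TSort} {t u : Tgt s} (h : BetaEta s t u) : Conv t u := .rel _ _ h

theorem Conv.refl {s : TSort} (t : Tgt s) : Conv t t := Relation.EqvGen.refl t

theorem Conv.of_eq {s : TSort} {t u : Tgt s} (h : t = u) : Conv t u := h ▸ Conv.refl t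

theorem Conv.symm {s : TSort} {t u : Tgt s} (h : Conv t u) : Conv u t := Relation.EqvGen.symm _ _ h

theorem Conv.trans {s : TSort} {t u v : Tgt s} (h : Conv t u) (h' : Conv u v) : Conv t v :=
  Relation.EqvGen.trans _ _ _ h h'

theorem Conv.map {s s' : TSort} (F : Tgt s → Tgt s')
    (hF : ∀ t u, BetaEta s t u → BetaEta s' (F t) (F u)) {t u : Tgt s} (h : Conv t u) :
    Conv (F t) (F u) := by
  induction h with
  | rel _ _ h => exact .of_step (hF _ _ h)
  | refl => exact .refl _
  | symm _ _ _ ih => exact ih.symm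
  | trans _ _ _ _ _ ih ih' => exact ih.trans ih'

theorem BetaEta.ren {s : TSort} {t u : Tgt s} (h : BetaEta s t u) : ∀ f g : ℕ → ℕ,
    BetaEta s (t.ren f g) (u.ren f g) := by
  induction h with
  | betaT q c => intro f g; rw [ren_substC]; exact .betaT _ _
  | betaW q c => intro f g; rw [ren_substO]; exact .betaW _ _
  | betaK q c => intro f g; rw [ren_substO]; exact .betaK _ _
  | etaT t => intro f g; simp only [Tgt.ren, ren_wkC]; exact .etaT _
  | etaW t => intro f g; simp only [Tgt.ren, ren_wkO]; exact .etaW _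
  | etaK t => intro f g; simp only [Tgt.ren, ren_wkO]; exact .etaK _
  | lamT _ ih => exact fun f g => .lamT (ih _ _)
  | appWWL _ ih => exact fun f g => .appWWL (ih _ _)
  | appWWR _ ih => exact fun f g => .appWWR (ih _ _)
  | appKWL _ ih => exact fun f g => .appKWL (ih _ _)
  | appKWR _ ih => exact fun f g => .appKWR (ih _ _)
  | appTKL _ ih => exact fun f g => .appTKL (ih _ _)
  | appTKR _ ih => exact fun f g => .appTKR (ih _ _)
  | lamW _ ih => exact fun f g => .lamW (ih _ _)
  | lamK _ ih => exact fun f g => .lamK (ih _ _)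

theorem Conv.wkO {s : TSort} {t u : Tgt s} (h : Conv t u) : Conv t.wkO u.wkO :=
  h.map _ fun _ _ h => h.ren _ _

theorem Conv.lamK {q q' : Tgt .Q} (h : Conv q q') : Conv (lamK q) (lamK q') :=
  h.map _ fun _ _ => .lamK

theorem Conv.lamT {q q' : Tgt .Q} (h : Conv q q') : Conv (lamT q) (lamT q') :=
  h.map _ fun _ _ => .lamT

theorem Conv.lamW {t t' : Tgt .T} (h : Conv t t') : Conv (lamW t) (lamW t') :=
  h.map _ fun _ _ => .lamW

theorem Conv.appTKL {t t' : Tgt .T} (h : Conv t t') (c : Tgt .K) :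
    Conv (appTK t c) (appTK t' c) :=
  h.map (fun t => appTK t c) fun _ _ => .appTKL

theorem Conv.appTKR (t : Tgt .T) {c c' : Tgt .K} (h : Conv c c') :
    Conv (appTK t c) (appTK t c') :=
  h.map _ fun _ _ => .appTKR

theorem Conv.appKWL {c c' : Tgt .K} (h : Conv c c') (w : Tgt .W) :
    Conv (appKW c w) (appKW c' w) :=
  h.map (fun c => appKW c w) fun _ _ => .appKWL

theorem Conv.appKWR (c : Tgt .K) {w w' : Tgt .W} (h : Conv w w') :
    Conv (appKW c w) (appKW c w') :=
  h.map _ fun _ _ => .appKWR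

end Tgt

open Tm Tgt

/-! ### The translation respects the identification and the reduction rules, up to `βη` -/

theorem colon_congr (m : ℕ) : ∀ M : Tm .term, M.size < m → ∀ {c c' : Tgt .K}, Conv c c' →
    Conv (colon M c) (colon M c') := by
  induction m with
  | zero => exact fun _ h => absurd h (by omega)
  | succ m ih =>
    intro M hM c c' h
    cases M with
    | var x => simp only [colon]; exact h.appKWL _
    | lam M => simp only [colon]; exact h.appKWL _
    | app M N =>
      simp only [Tm.size] at hM
      simp only [colon]
      rcases star M with _ | v <;> rcases star N with _ | w <;> simp only
      · exact ih M (by omega) (ih N.wkO (by rw [Tm.size_wkO]; omega) (h.wkO.wkO.appTKR _).lamK).lamK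
      · exact ih M (by omega) (h.wkO.appTKR _).lamK
      · exact ih N (by omega) (h.wkO.appTKR _).lamK
      · exact h.appTKR _
    | lett L M =>
      simp only [Tm.size] at hM
      simp only [colon]
      exact ih M (by omega) (ih L (by omega) h.wkO).lamK
    | mu J => simp only [colon]; exact h.appTKR _

theorem Conv.colon (M : Tm .term) {c c' : Tgt .K} (h : Conv c c') :
    Conv (colon M c) (colon M c') :=
  colon_congr _ M (Nat.lt_succ_self _) h

theorem star_wkO {M : Tm .term} {v : Tgt .W} (h : star M = some v) : star M.wkO = some v.wkO := by
  rw [Tm.wkO, star_ren, h]; rfl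

theorem star_wkC {M : Tm .term} {v : Tgt .W} (h : star M = some v) : star M.wkC = some v.wkC := by
  rw [Tm.wkC, star_ren, h]; rfl

theorem conv_colon_app_value {M : Tm .term} {v : Tgt .W} (h : star M = some v) (N : Tm .term)
    (c : Tgt .K) :
    Conv (colon (app M N) c) (colon N (.lamK (.appTK (.appWW v.wkO (.var 0)) c.wkO))) := by
  rw [colon.eq_3, h]
  rcases e : star N with _ | w <;> simp only
  · exact .refl _
  · rw [colon_star e]
    refine Conv.symm ((Conv.of_step (.betaK _ _)).trans (.of_eq ?_))
    change Tgt.appTK (.appWW (v.wkO.substO w) w) (c.wkO.substO w) = _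
    rw [substO_wkO, substO_wkO]

/-- Up to `β`, the clause for two non-values holds for every application. Since reduction can turn a
non-value into a value, this uniform form is what makes the congruence rules for applications
provable without tracking which clause applies. -/
theorem conv_colon_app (M N : Tm .term) (c : Tgt .K) :
    Conv (colon (app M N) c) (colon M (.lamK (colon N.wkO
      (.lamK (.appTK (.appWW (.var 1) (.var 0)) c.wkO.wkO))))) := by
  rcases e : star M with _ | v
  · rw [colon.eq_3, e]
    rcases e' : star N with _ | w <;> simp only
    · exact .refl _
    · refine Conv.colon _ (Conv.lamK ?_)
      rw [colon_star (star_wkO e')]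
      refine Conv.symm ((Conv.of_step (.betaK _ _)).trans (.of_eq ?_))
      change Tgt.appTK (.appWW (.var 0) _) (c.wkO.wkO.substO _) = _
      rw [substO_wkO]
      rfl
  · refine (conv_colon_app_value e N c).trans ?_
    rw [colon_star e]
    refine Conv.symm ((Conv.of_step (.betaK _ _)).trans (.of_eq ?_))
    rw [colon_wkO_substO]
    congr 1
    change Tgt.lamK (.appTK (.appWW v.wkO (.var 0)) (c.wkO.wkO.subst _ _)) = _
    congr 2
    have h := subst_wkO c.wkO (instO v) cvar
    rw [show c.wkO.subst (instO v) cvar = c from substO_wkO c v] at h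
    exact h

/-- `βη`-equality of the translations. -/
def ConvSem : {s : Kind} → Tm s → Tm s → Prop
  | .term, M, M' => ∀ c, Conv (colon M c) (colon M' c)
  | .jump, J, J' => Conv (colonJ J) (colonJ J')

theorem colon_ren_up (M : Tm .term) (c : Tgt .K) :
    (colon M c.wkO).ren (up Nat.succ) id = colon (M.ren (up Nat.succ) id) c.wkO.wkO := by
  rw [colon_ren]
  congr 1
  exact Tgt.ren_wkO c _ _

/-- Only the axiom for `μ` needs `β`; for the other two the translations coincide. -/
theorem EqAx.convSem {s : Kind} {P Q : Tm s} (h : EqAx s P Q) : ConvSem P Q := by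
  cases h with
  | assoc L M N =>
    intro c
    simp only [colon]
    rw [Tgt.wkO, Tgt.ren, colon_ren_up]
    exact .refl _
  | muLet J M =>
    intro c
    simp only [colon, colonJ]
    refine Conv.trans (Conv.colon _ (Conv.lamK (.of_step (.betaT _ _)))) ?_
    refine Conv.symm ((Conv.of_step (.betaT _ _)).trans (.of_eq ?_))
    rw [colon_wkC_substC]
    congr 1
    simp only [Tgt.substC, Tgt.subst, upO_var]
    congr 2
    funext n; cases n <;> rfl
  | jmpLet k L M =>
    change Conv _ _
    simp only [colon, colonJ]
    exact .refl _

theorem Rule.convSem {s : Kind} {P Q : Tm s} (h : Rule s P Q) : ConvSem P Q := by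
  cases h with
  | @ad₁ N M hN =>
    intro c
    refine (conv_colon_app _ _ c).trans ?_
    rw [colon.eq_4]
    refine Conv.colon _ (Conv.lamK (Conv.symm ?_))
    exact conv_colon_app_value (v := .var 0) (by simp [star]) _ _
  | @ad₂ V N hV hN =>
    intro c
    obtain ⟨v, hv⟩ := exists_star hV
    rw [colon.eq_3, hv, star_eq_none hN, colon.eq_4, colon.eq_3, star_wkO hv]
    simp only [star]
    exact .refl _
  | @betaLam M V hV =>
    intro c
    obtain ⟨v, hv⟩ := exists_star hV
    rw [colon.eq_3, hv]
    simp only [star]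
    -- The value is substituted below the binder `λk` of the translated abstraction, hence its
    -- weakening by a continuation variable.
    have h1 : (colon M.wkC (.cvar 0)).subst (fun n => (instO v n).wkC) cvar =
        colon (M.substO V).wkC (.cvar 0) := by
      rw [colon_msub (θ' := cvar) (σ := fun n => (inst V n).wkC) (θ := fun n => (n, none))
        (fun n => star_wkC (star_inst hv n)) (fun _ => rfl)]
      congr 1
      simp only [Tm.substO, subst_eq_msub, Tm.wkC, ren_msub, msub_ren]
      rfl
    have h2 := BetaEta.betaW (.lamT (colon M.wkC (.cvar 0))) v
    simp only [Tgt.substO, Tgt.subst, upC_cvar, h1] at h2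
    refine Conv.trans (Conv.appTKL (.of_step h2) c) ?_
    refine Conv.trans (.of_step (.betaT _ _)) ?_
    rw [colon_wkC_substC, colon.eq_4, colon_star hv]
    refine Conv.symm ((Conv.of_step (.betaK _ _)).trans ?_)
    rw [colon_substO hv]
    exact .refl _
  | @betaLet M V hV =>
    intro c
    obtain ⟨v, hv⟩ := exists_star hV
    rw [colon.eq_4, colon_star hv, ← colon_substO hv]
    exact .of_step (.betaK _ _)
  | betaMu M J =>
    intro c
    simp only [colon]
    refine Conv.trans (.of_step (.betaT _ _))
      (Conv.symm ((Conv.of_step (.betaT _ _)).trans (.of_eq ?_)))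
    rw [ctxSubst_eq_msub, ← colonJ_msub (σ' := .var)
      (θ' := fun n => contTgt (single 0 M.wkC n)) (fun n => by simp [star]) (fun _ => rfl)]
    simp only [Tgt.substC, subst_subst]
    congr 1
    funext n
    cases n with
    | zero =>
      simp only [single, if_true, contTgt, Tgt.subst, upO_var, Tgt.instC]
      congr 1
      have h := colon_ren_subst (f := id) (g := Nat.succ) (a := id) (b := id) (σ' := .var)
        (θ' := fun n => (Tgt.instC c n).wkO) (fun _ => rfl) (fun _ => rfl) M (.cvar 0)
      rw [Tm.ren_id] at h
      exact h
    | succ n => rfl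
  | betaJmp l J =>
    change Conv _ _
    simp only [colonJ, colon]
    refine Conv.trans (.of_step (.betaT _ _)) (.of_eq ?_)
    have h := colonJ_ren_subst (f := id) (g := id) (a := id) (b := Tm.instC l) (σ' := .var)
        (θ' := Tgt.instC (.cvar l)) (fun _ => rfl) (fun n => by cases n <;> rfl) J
    rw [Tm.ren_id] at h
    exact h
  | @etaLam V hV =>
    intro c
    obtain ⟨v, hv⟩ := exists_star hV
    rw [colon_star hv, colon.eq_2]
    refine Conv.appKWR _ ?_
    rw [show (app V.wkO (var 0)).wkC = app V.wkO.wkC (var 0) from rfl, colon.eq_3,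
      star_wkC (star_wkO hv)]
    simp only [star]
    exact Conv.trans (Conv.lamW (.of_step (.etaT (.appWW v.wkO (.var 0))))) (.of_step (.etaW v))
  | etaLet M =>
    intro c
    simp only [colon]
    exact Conv.colon _ (.of_step (.etaK c))
  | etaMu M =>
    intro c
    simp only [colon, colonJ]
    refine Conv.trans (.of_step (.betaT _ _)) (.of_eq ?_)
    rw [colon_wkC_substC]
    rfl

/-- The claim is strengthened to all renamings because the translation of `λx.M` and the uniform
clause for applications use weakened subterms. -/
theorem Compat.convSem {R : ∀ s : Kind, Tm s → Tm s → Prop}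
    (hR : ∀ {s : Kind} {P Q : Tm s}, R s P Q → ∀ f g : ℕ → ℕ, R s (P.ren f g) (Q.ren f g))
    (hR' : ∀ {s : Kind} {P Q : Tm s}, R s P Q → ConvSem P Q)
    {s : Kind} {P Q : Tm s} (h : Compat R s P Q) : ∀ f g : ℕ → ℕ,
    ConvSem (P.ren f g) (Q.ren f g) := by
  induction h with
  | base h => exact fun f g => hR' (hR h f g)
  | lam _ ih =>
    intro f g c
    have h := ih (up f) (Nat.succ ∘ g) (.cvar 0)
    simp only [Tm.ren, colon, Tm.wkC, Tm.ren_ren]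
    exact Conv.appKWR _ h.lamT.lamW
  | appL _ ih =>
    intro f g c
    exact (conv_colon_app _ _ c).trans ((ih f g _).trans (conv_colon_app _ _ c).symm)
  | appR _ ih =>
    intro f g c
    refine (conv_colon_app _ _ c).trans (Conv.trans (Conv.colon _ (Conv.lamK ?_))
      (conv_colon_app _ _ c).symm)
    simp only [Tm.wkO, Tm.ren_ren]
    exact ih _ _ _
  | @lettL s L L' M _ ih =>
    intro f g
    cases s with
    | term =>
      intro c
      simp only [Tm.ren, colon]
      exact Conv.colon _ (Conv.lamK (ih _ _ _))
    | jump =>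
      change Conv _ _
      simp only [Tm.ren, colonJ]
      exact Conv.colon _ (Conv.lamK (ih _ _))
  | @lettR s L M M' _ ih =>
    intro f g
    cases s with
    | term =>
      intro c
      simp only [Tm.ren, colon]
      exact ih _ _ _
    | jump =>
      change Conv _ _
      simp only [Tm.ren, colonJ]
      exact ih _ _ _
  | mu _ ih =>
    intro f g c
    simp only [Tm.ren, colon]
    exact Conv.appTKL (Conv.lamT (ih _ _)) _
  | jmp _ ih =>
    intro f g
    change Conv _ _
    simp only [Tm.ren, colonJ]
    exact ih _ _ _

theorem conv_cps_of_forall {M M' : Tm .term}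
    (h : ∀ f g : ℕ → ℕ, ConvSem (M.ren f g) (M'.ren f g)) : Conv (cps M) (cps M') :=
  Conv.lamT (h id Nat.succ (.cvar 0))

theorem Ident.conv_cps {M M' : Tm .term} (h : Ident M M') : Conv (cps M) (cps M') := by
  induction h with
  | rel _ _ h => exact conv_cps_of_forall (Compat.convSem EqAx.ren EqAx.convSem h)
  | refl => exact .refl _
  | symm _ _ _ ih => exact ih.symm
  | trans _ _ _ _ _ ih ih' => exact ih.trans ih'

theorem Step.conv_cps {M M' : Tm .term} (h : Step M M') : Conv (cps M) (cps M') := by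
  obtain ⟨P, Q, h1, h2, h3⟩ := h
  exact (Ident.conv_cps h1).trans ((conv_cps_of_forall (Compat.convSem Rule.ren Rule.convSem h2)).trans
    (Ident.conv_cps h3))

end CCV

namespace CCV

namespace Tgt

/-! ### Confluence of `βη`-reduction -/

/-- Parallel `βη`-reduction. -/
inductive Par : ∀ s : TSort, Tgt s → Tgt s → Prop
  | var (x : ℕ) : Par .W (var x) (var x)
  | cvar (k : ℕ) : Par .K (cvar k) (cvar k)
  | lamT {q q' : Tgt .Q} : Par .Q q q' → Par .T (lamT q) (lamT q')
  | lamW {t t' : Tgt .T} : Par .T t t' → Par .W (lamW t) (lamW t')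
  | lamK {q q' : Tgt .Q} : Par .Q q q' → Par .K (lamK q) (lamK q')
  | appTK {t t' : Tgt .T} {c c' : Tgt .K} :
      Par .T t t' → Par .K c c' → Par .Q (appTK t c) (appTK t' c')
  | appWW {v v' w w' : Tgt .W} :
      Par .W v v' → Par .W w w' → Par .T (appWW v w) (appWW v' w')
  | appKW {c c' : Tgt .K} {w w' : Tgt .W} :
      Par .K c c' → Par .W w w' → Par .Q (appKW c w) (appKW c' w')
  | betaT {q q' : Tgt .Q} {c c' : Tgt .K} :
      Par .Q q q' → Par .K c c' → Par .Q (appTK (lamT q) c) (q'.substC c')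
  | betaW {t t' : Tgt .T} {w w' : Tgt .W} :
      Par .T t t' → Par .W w w' → Par .T (appWW (lamW t) w) (t'.substO w')
  | betaK {q q' : Tgt .Q} {w w' : Tgt .W} :
      Par .Q q q' → Par .W w w' → Par .Q (appKW (lamK q) w) (q'.substO w')
  | etaT {t t' : Tgt .T} : Par .T t t' → Par .T (lamT (appTK t.wkC (cvar 0))) t'
  | etaW {w w' : Tgt .W} : Par .W w w' → Par .W (lamW (appWW w.wkO (var 0))) w'
  | etaK {c c' : Tgt .K} : Par .K c c' → Par .K (lamK (appKW c.wkO (var 0))) c'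

theorem Par.refl {s : TSort} (t : Tgt s) : Par s t t := by
  induction t with
  | var => exact .var _
  | cvar => exact .cvar _
  | lamT _ ih => exact .lamT ih
  | lamW _ ih => exact .lamW ih
  | lamK _ ih => exact .lamK ih
  | appTK _ _ ih ih' => exact .appTK ih ih'
  | appWW _ _ ih ih' => exact .appWW ih ih'
  | appKW _ _ ih ih' => exact .appKW ih ih'

theorem Par.of_step {s : TSort} {t u : Tgt s} (h : BetaEta s t u) : Par s t u := by
  induction h with
  | betaT q c => exact .betaT (.refl _) (.refl _)
  | betaW q c => exact .betaW (.refl _) (.refl _)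
  | betaK q c => exact .betaK (.refl _) (.refl _)
  | etaT => exact .etaT (.refl _)
  | etaW => exact .etaW (.refl _)
  | etaK => exact .etaK (.refl _)
  | lamT _ ih => exact .lamT ih
  | appWWL _ ih => exact .appWW ih (.refl _)
  | appWWR _ ih => exact .appWW (.refl _) ih
  | appKWL _ ih => exact .appKW ih (.refl _)
  | appKWR _ ih => exact .appKW (.refl _) ih
  | appTKL _ ih => exact .appTK ih (.refl _)
  | appTKR _ ih => exact .appTK (.refl _) ih
  | lamW _ ih => exact .lamW ih
  | lamK _ ih => exact .lamK ih

theorem Reds.map {s s' : TSort} (F : Tgt s → Tgt s')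
    (hF : ∀ t u, BetaEta s t u → BetaEta s' (F t) (F u)) {t u : Tgt s} (h : Reds t u) :
    Reds (F t) (F u) := by
  induction h with
  | refl => exact .refl
  | tail _ h ih => exact ih.tail (hF _ _ h)

theorem Reds.appTK {t t' : Tgt .T} {c c' : Tgt .K} (h : Reds t t') (h' : Reds c c') :
    Reds (appTK t c) (appTK t' c') :=
  (h.map (fun t => Tgt.appTK t c) fun _ _ => .appTKL).trans (h'.map _ fun _ _ => .appTKR)

theorem Reds.appWW {t t' : Tgt .W} {c c' : Tgt .W} (h : Reds t t') (h' : Reds c c') :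
    Reds (appWW t c) (appWW t' c') :=
  (h.map (fun t => Tgt.appWW t c) fun _ _ => .appWWL).trans (h'.map _ fun _ _ => .appWWR)

theorem Reds.appKW {t t' : Tgt .K} {c c' : Tgt .W} (h : Reds t t') (h' : Reds c c') :
    Reds (appKW t c) (appKW t' c') :=
  (h.map (fun t => Tgt.appKW t c) fun _ _ => .appKWL).trans (h'.map _ fun _ _ => .appKWR)

theorem Par.reds {s : TSort} {t u : Tgt s} (h : Par s t u) : Reds t u := by
  induction h with
  | var => exact .refl
  | cvar => exact .refl
  | lamT _ ih => exact ih.map _ fun _ _ => .lamT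
  | lamW _ ih => exact ih.map _ fun _ _ => .lamW
  | lamK _ ih => exact ih.map _ fun _ _ => .lamK
  | appTK _ _ ih ih' => exact ih.appTK ih'
  | appWW _ _ ih ih' => exact ih.appWW ih'
  | appKW _ _ ih ih' => exact ih.appKW ih'
  | betaT _ _ ih ih' => exact ((ih.map _ fun _ _ => .lamT).appTK ih').tail (.betaT _ _)
  | betaW _ _ ih ih' => exact ((ih.map _ fun _ _ => .lamW).appWW ih').tail (.betaW _ _)
  | betaK _ _ ih ih' => exact ((ih.map _ fun _ _ => .lamK).appKW ih').tail (.betaK _ _)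
  | etaT _ ih => exact .head (.etaT _) ih
  | etaW _ ih => exact .head (.etaW _) ih
  | etaK _ ih => exact .head (.etaK _) ih

theorem Par.ren {s : TSort} {t u : Tgt s} (h : Par s t u) : ∀ f g : ℕ → ℕ,
    Par s (t.ren f g) (u.ren f g) := by
  induction h with
  | var => exact fun f g => .var _
  | cvar => exact fun f g => .cvar _
  | lamT _ ih => exact fun f g => .lamT (ih _ _)
  | lamW _ ih => exact fun f g => .lamW (ih _ _)
  | lamK _ ih => exact fun f g => .lamK (ih _ _)
  | appTK _ _ ih ih' => exact fun f g => .appTK (ih _ _) (ih' _ _)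
  | appWW _ _ ih ih' => exact fun f g => .appWW (ih _ _) (ih' _ _)
  | appKW _ _ ih ih' => exact fun f g => .appKW (ih _ _) (ih' _ _)
  | betaT _ _ ih ih' => intro f g; rw [ren_substC]; exact .betaT (ih _ _) (ih' _ _)
  | betaW _ _ ih ih' => intro f g; rw [ren_substO]; exact .betaW (ih _ _) (ih' _ _)
  | betaK _ _ ih ih' => intro f g; rw [ren_substO]; exact .betaK (ih _ _) (ih' _ _)
  | etaT _ ih => intro f g; simp only [Tgt.ren, ren_wkC]; exact .etaT (ih _ _)
  | etaW _ ih => intro f g; simp only [Tgt.ren, ren_wkO]; exact .etaW (ih _ _)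
  | etaK _ ih => intro f g; simp only [Tgt.ren, ren_wkO]; exact .etaK (ih _ _)

theorem par_upO {σ σ' : ℕ → Tgt .W} (h : ∀ n, Par .W (σ n) (σ' n)) (n : ℕ) :
    Par .W (upO σ n) (upO σ' n) := by
  cases n with
  | zero => exact .var _
  | succ n => exact (h n).ren _ _

theorem par_upC {τ τ' : ℕ → Tgt .K} (h : ∀ n, Par .K (τ n) (τ' n)) (n : ℕ) :
    Par .K (upC τ n) (upC τ' n) := by
  cases n with
  | zero => exact .cvar _
  | succ n => exact (h n).ren _ _

theorem Par.subst {s : TSort} {t u : Tgt s} (h : Par s t u) : ∀ {σ σ' : ℕ → Tgt .W}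
    {τ τ' : ℕ → Tgt .K}, (∀ n, Par .W (σ n) (σ' n)) → (∀ n, Par .K (τ n) (τ' n)) →
    Par s (t.subst σ τ) (u.subst σ' τ') := by
  induction h with
  | var => exact fun h _ => h _
  | cvar => exact fun _ h => h _
  | lamT _ ih => exact fun h h' => .lamT (ih (fun n => (h n).ren _ _) (par_upC h'))
  | lamW _ ih => exact fun h h' => .lamW (ih (par_upO h) (fun n => (h' n).ren _ _))
  | lamK _ ih => exact fun h h' => .lamK (ih (par_upO h) (fun n => (h' n).ren _ _))
  | appTK _ _ ih ih' => exact fun h h' => .appTK (ih h h') (ih' h h')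
  | appWW _ _ ih ih' => exact fun h h' => .appWW (ih h h') (ih' h h')
  | appKW _ _ ih ih' => exact fun h h' => .appKW (ih h h') (ih' h h')
  | betaT _ _ ih ih' =>
    intro σ σ' τ τ' h h'
    rw [subst_substC]
    exact .betaT (ih (fun n => (h n).ren _ _) (par_upC h')) (ih' h h')
  | betaW _ _ ih ih' =>
    intro σ σ' τ τ' h h'
    rw [subst_substO]
    exact .betaW (ih (par_upO h) (fun n => (h' n).ren _ _)) (ih' h h')
  | betaK _ _ ih ih' =>
    intro σ σ' τ τ' h h'
    rw [subst_substO]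
    exact .betaK (ih (par_upO h) (fun n => (h' n).ren _ _)) (ih' h h')
  | etaT _ ih =>
    intro σ σ' τ τ' h h'
    simp only [Tgt.subst, subst_wkC]
    exact .etaT (ih h h')
  | etaW _ ih =>
    intro σ σ' τ τ' h h'
    simp only [Tgt.subst, subst_wkO]
    exact .etaW (ih h h')
  | etaK _ ih =>
    intro σ σ' τ τ' h h'
    simp only [Tgt.subst, subst_wkO]
    exact .etaK (ih h h')

theorem Par.substO {s : TSort} {t u : Tgt s} (h : Par s t u) {w w' : Tgt .W}
    (h' : Par .W w w') : Par s (t.substO w) (u.substO w') :=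
  h.subst (fun n => by cases n with
    | zero => exact h'
    | succ n => exact .var _) (fun n => .cvar n)

theorem Par.substC {s : TSort} {t u : Tgt s} (h : Par s t u) {c c' : Tgt .K}
    (h' : Par .K c c') : Par s (t.substC c) (u.substC c') :=
  h.subst (fun n => .var n) (fun n => by cases n with
    | zero => exact h'
    | succ n => exact .cvar _)

theorem wkO_injective {s : TSort} : Function.Injective (wkO : Tgt s → Tgt s) := by
  intro t u h
  rw [← substO_wkO t (var 0), h, substO_wkO]

theorem wkC_injective {s : TSort} : Function.Injective (wkC : Tgt s → Tgt s) := by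
  intro t u h
  rw [← substC_wkC t (cvar 0), h, substC_wkC]

theorem cntO_ren {s : TSort} (t : Tgt s) : ∀ {f : ℕ → ℕ} (g : ℕ → ℕ) {k k' : ℕ},
    (∀ n, f n = k' ↔ n = k) → cntO k' (t.ren f g) = cntO k t := by
  induction t with
  | lamW q ih => exact fun g k k' h => ih _ (Tm.up_eq_succ_iff h)
  | lamK q ih => exact fun g k k' h => ih _ (Tm.up_eq_succ_iff h)
  | var l => intro f g k k' h; simp only [Tgt.ren, cntO, h]
  | cvar => intros; rfl
  | lamT t ih => exact fun g k k' h => ih _ h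
  | _ =>
    rename_i ih ih'
    intro f g k k' h
    simp only [Tgt.ren, cntO, ih _ h, ih' _ h]

theorem cntO_ren_eq_zero {s : TSort} (t : Tgt s) : ∀ (f g : ℕ → ℕ) (k : ℕ),
    (∀ n, f n ≠ k) → cntO k (t.ren f g) = 0 := by
  have hup : ∀ {f : ℕ → ℕ} {k : ℕ}, (∀ n, f n ≠ k) → ∀ n, up f n ≠ k + 1 := by
    intro f k h n
    cases n with
    | zero => simp [up]
    | succ n => simpa [up] using h n
  induction t with
  | lamW q ih => exact fun f g k h => ih _ _ _ (hup h)
  | lamK q ih => exact fun f g k h => ih _ _ _ (hup h)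
  | var l => intro f g k h; simp [Tgt.ren, cntO, h]
  | cvar => intros; rfl
  | lamT t ih => exact fun f g k h => ih _ _ _ h
  | _ =>
    rename_i ih ih'
    intro f g k h
    simp only [Tgt.ren, cntO, ih _ _ _ h, ih' _ _ _ h]

theorem cntC_ren_eq_zero {s : TSort} (t : Tgt s) : ∀ (f g : ℕ → ℕ) (k : ℕ),
    (∀ n, g n ≠ k) → cntC k (t.ren f g) = 0 := by
  have hup : ∀ {f : ℕ → ℕ} {k : ℕ}, (∀ n, f n ≠ k) → ∀ n, up f n ≠ k + 1 := by
    intro f k h n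
    cases n with
    | zero => simp [up]
    | succ n => simpa [up] using h n
  induction t with
  | lamT q ih => exact fun f g k h => ih _ _ _ (hup h)
  | lamK q ih => exact fun f g k h => ih _ _ _ h
  | cvar l => intro f g k h; simp [Tgt.ren, cntC, h]
  | var => intros; rfl
  | lamW t ih => exact fun f g k h => ih _ _ _ h
  | _ =>
    rename_i ih ih'
    intro f g k h
    simp only [Tgt.ren, cntC, ih _ _ _ h, ih' _ _ _ h]

/-- `up f` sends nothing but `0` to `0`, so `0` is already absent before the renaming. This
recognizes the side condition of an `η`-redex through a renaming. -/
theorem exists_of_ren_eq_wkO {s : TSort} {t u : Tgt s} {f g : ℕ → ℕ}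
    (h : t.ren (up f) g = u.wkO) : ∃ t' : Tgt s, t = t'.wkO ∧ u = t'.ren f g := by
  have h1 : cntO 0 t = 0 := by
    rw [← cntO_ren t g (Tm.up_eq_zero_iff f), h]
    exact cntO_ren_eq_zero _ _ _ _ Nat.succ_ne_zero
  obtain ⟨t', rfl⟩ := exists_eq_wkO h1
  rw [ren_wkO] at h
  exact ⟨t', rfl, (wkO_injective h).symm⟩

theorem exists_of_ren_eq_wkC {s : TSort} {t u : Tgt s} {f g : ℕ → ℕ}
    (h : t.ren f (up g) = u.wkC) : ∃ t' : Tgt s, t = t'.wkC ∧ u = t'.ren f g := by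
  have h1 : cntC 0 t = 0 := by
    rw [← cntC_ren t f (Tm.up_eq_zero_iff g), h]
    exact cntC_ren_eq_zero _ _ _ _ Nat.succ_ne_zero
  obtain ⟨t', rfl⟩ := exists_eq_wkC h1
  rw [ren_wkC] at h
  exact ⟨t', rfl, (wkC_injective h).symm⟩

/-- A parallel reduction of a renamed expression comes from the expression. -/
theorem Par.ren_inv {s : TSort} {x u : Tgt s} (h : Par s x u) : ∀ {t : Tgt s} {f g : ℕ → ℕ},
    t.ren f g = x → ∃ u', u = u'.ren f g ∧ Par s t u' := by
  induction h with
  | var x => intro t f g e; exact ⟨t, e.symm, .refl t⟩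
  | cvar x => intro t f g e; exact ⟨t, e.symm, .refl t⟩
  | lamT _ ih =>
    intro t f g e
    cases t <;> cases e
    obtain ⟨u, rfl, h⟩ := ih rfl
    exact ⟨.lamT u, rfl, .lamT h⟩
  | lamW _ ih =>
    intro t f g e
    cases t <;> cases e
    obtain ⟨u, rfl, h⟩ := ih rfl
    exact ⟨.lamW u, rfl, .lamW h⟩
  | lamK _ ih =>
    intro t f g e
    cases t <;> cases e
    obtain ⟨u, rfl, h⟩ := ih rfl
    exact ⟨.lamK u, rfl, .lamK h⟩
  | appTK _ _ ih ih' =>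
    intro t f g e
    cases t <;> cases e
    obtain ⟨u, rfl, h⟩ := ih rfl
    obtain ⟨u', rfl, h'⟩ := ih' rfl
    exact ⟨.appTK u u', rfl, .appTK h h'⟩
  | appWW _ _ ih ih' =>
    intro t f g e
    cases t <;> cases e
    obtain ⟨u, rfl, h⟩ := ih rfl
    obtain ⟨u', rfl, h'⟩ := ih' rfl
    exact ⟨.appWW u u', rfl, .appWW h h'⟩
  | appKW _ _ ih ih' =>
    intro t f g e
    cases t <;> cases e
    obtain ⟨u, rfl, h⟩ := ih rfl
    obtain ⟨u', rfl, h'⟩ := ih' rfl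
    exact ⟨.appKW u u', rfl, .appKW h h'⟩
  | betaT _ _ ih ih' =>
    intro t f g e
    cases t <;> simp only [Tgt.ren, appTK.injEq, reduceCtorEq] at e
    rename_i a b
    obtain ⟨e, rfl⟩ := e
    cases a <;> cases e
    obtain ⟨u, rfl, h⟩ := ih rfl
    obtain ⟨u', rfl, h'⟩ := ih' rfl
    exact ⟨u.substC u', (ren_substC _ _ _ _).symm, .betaT h h'⟩
  | betaW _ _ ih ih' =>
    intro t f g e
    cases t <;> simp only [Tgt.ren, appWW.injEq, reduceCtorEq] at e
    rename_i a b
    obtain ⟨e, rfl⟩ := e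
    cases a <;> cases e
    obtain ⟨u, rfl, h⟩ := ih rfl
    obtain ⟨u', rfl, h'⟩ := ih' rfl
    exact ⟨u.substO u', (ren_substO _ _ _ _).symm, .betaW h h'⟩
  | betaK _ _ ih ih' =>
    intro t f g e
    cases t <;> simp only [Tgt.ren, appKW.injEq, reduceCtorEq] at e
    rename_i a b
    obtain ⟨e, rfl⟩ := e
    cases a <;> cases e
    obtain ⟨u, rfl, h⟩ := ih rfl
    obtain ⟨u', rfl, h'⟩ := ih' rfl
    exact ⟨u.substO u', (ren_substO _ _ _ _).symm, .betaK h h'⟩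
  | etaT _ ih =>
    intro t f g e
    cases t <;> simp only [Tgt.ren, lamT.injEq, reduceCtorEq] at e
    rename_i a
    cases a <;> simp only [Tgt.ren, appTK.injEq, reduceCtorEq] at e
    rename_i a b
    obtain ⟨e, e'⟩ := e
    obtain ⟨a, rfl, rfl⟩ := exists_of_ren_eq_wkC e
    cases b <;> simp only [Tgt.ren, cvar.injEq, reduceCtorEq] at e'
    obtain rfl := (Tm.up_eq_zero_iff _ _).1 e'
    obtain ⟨u, rfl, h⟩ := ih rfl
    exact ⟨u, rfl, .etaT h⟩
  | etaW _ ih =>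
    intro t f g e
    cases t <;> simp only [Tgt.ren, lamW.injEq, reduceCtorEq] at e
    rename_i a
    cases a <;> simp only [Tgt.ren, appWW.injEq, reduceCtorEq] at e
    rename_i a b
    obtain ⟨e, e'⟩ := e
    obtain ⟨a, rfl, rfl⟩ := exists_of_ren_eq_wkO e
    cases b <;> simp only [Tgt.ren, var.injEq, reduceCtorEq] at e'
    obtain rfl := (Tm.up_eq_zero_iff _ _).1 e'
    obtain ⟨u, rfl, h⟩ := ih rfl
    exact ⟨u, rfl, .etaW h⟩
  | etaK _ ih =>
    intro t f g e
    cases t <;> simp only [Tgt.ren, lamK.injEq, reduceCtorEq] at e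
    rename_i a
    cases a <;> simp only [Tgt.ren, appKW.injEq, reduceCtorEq] at e
    rename_i a b
    obtain ⟨e, e'⟩ := e
    obtain ⟨a, rfl, rfl⟩ := exists_of_ren_eq_wkO e
    cases b <;> simp only [Tgt.ren, var.injEq, reduceCtorEq] at e'
    obtain rfl := (Tm.up_eq_zero_iff _ _).1 e'
    obtain ⟨u, rfl, h⟩ := ih rfl
    exact ⟨u, rfl, .etaK h⟩

theorem par_lamT_inv {b : Tgt .Q} {u : Tgt .T} (h : Par .T (lamT b) u) :
    (∃ b', u = lamT b' ∧ Par .Q b b') ∨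
      ∃ a, b = appTK a.wkC (cvar 0) ∧ Par .T a u := by
  cases h with
  | lamT h => exact .inl ⟨_, rfl, h⟩
  | etaT h => exact .inr ⟨_, rfl, h⟩

theorem par_appTK_inv {a : Tgt .T} {b : Tgt .K} {u : Tgt .Q}
    (h : Par .Q (appTK a b) u) :
    (∃ a' b', u = appTK a' b' ∧ Par .T a a' ∧ Par .K b b') ∨
      ∃ r r' b', a = lamT r ∧ u = r'.substC b' ∧ Par .Q r r' ∧ Par .K b b' := by
  cases h with
  | appTK h h' => exact .inl ⟨_, _, rfl, h, h'⟩
  | betaT h h' => exact .inr ⟨_, _, _, rfl, rfl, h, h'⟩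

/-- A parallel reduction of the body of an `η`-redex is an `η`-expansion, or the result of
contracting a `β`-redex. -/
theorem par_etaT_body_inv {a : Tgt .T} {u : Tgt .Q}
    (h : Par .Q (appTK a.wkC (cvar 0)) u) :
    ∃ a', Par .T a a' ∧ (u = appTK a'.wkC (cvar 0) ∨ a' = lamT u) := by
  rcases par_appTK_inv h with ⟨a', b', rfl, h1, h2⟩ | ⟨r, r', b', e, rfl, h1, h2⟩
  · obtain ⟨a'', rfl, h3⟩ := h1.ren_inv rfl
    cases h2
    exact ⟨a'', h3, .inl rfl⟩
  · cases h2
    cases a <;> cases e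
    obtain ⟨r', rfl, h3⟩ := h1.ren_inv rfl
    -- In `(λk.r) k`, the body `r` was shifted past the outer variable. Substituting `cvar 0` undoes
    -- the shift, so the contractum is the body of the original abstraction.
    refine ⟨_, .lamT h3, .inr ?_⟩
    rw [substC, subst_ren]
    congr 1
    conv_lhs => rw [← subst_id r']
    congr 1
    funext n; cases n <;> rfl

theorem par_lamW_inv {b : Tgt .T} {u : Tgt .W} (h : Par .W (lamW b) u) :
    (∃ b', u = lamW b' ∧ Par .T b b') ∨
      ∃ a, b = appWW a.wkO (var 0) ∧ Par .W a u := by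
  cases h with
  | lamW h => exact .inl ⟨_, rfl, h⟩
  | etaW h => exact .inr ⟨_, rfl, h⟩

theorem par_appWW_inv {a : Tgt .W} {b : Tgt .W} {u : Tgt .T}
    (h : Par .T (appWW a b) u) :
    (∃ a' b', u = appWW a' b' ∧ Par .W a a' ∧ Par .W b b') ∨
      ∃ r r' b', a = lamW r ∧ u = r'.substO b' ∧ Par .T r r' ∧ Par .W b b' := by
  cases h with
  | appWW h h' => exact .inl ⟨_, _, rfl, h, h'⟩
  | betaW h h' => exact .inr ⟨_, _, _, rfl, rfl, h, h'⟩

/-- A parallel reduction of the body of an `η`-redex is an `η`-expansion, or the result of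
contracting a `β`-redex. -/
theorem par_etaW_body_inv {a : Tgt .W} {u : Tgt .T}
    (h : Par .T (appWW a.wkO (var 0)) u) :
    ∃ a', Par .W a a' ∧ (u = appWW a'.wkO (var 0) ∨ a' = lamW u) := by
  rcases par_appWW_inv h with ⟨a', b', rfl, h1, h2⟩ | ⟨r, r', b', e, rfl, h1, h2⟩
  · obtain ⟨a'', rfl, h3⟩ := h1.ren_inv rfl
    cases h2
    exact ⟨a'', h3, .inl rfl⟩
  · cases h2
    cases a <;> cases e
    obtain ⟨r', rfl, h3⟩ := h1.ren_inv rfl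
    refine ⟨_, .lamW h3, .inr ?_⟩
    rw [substO, subst_ren]
    congr 1
    conv_lhs => rw [← subst_id r']
    congr 1
    funext n; cases n <;> rfl

theorem par_lamK_inv {b : Tgt .Q} {u : Tgt .K} (h : Par .K (lamK b) u) :
    (∃ b', u = lamK b' ∧ Par .Q b b') ∨
      ∃ a, b = appKW a.wkO (var 0) ∧ Par .K a u := by
  cases h with
  | lamK h => exact .inl ⟨_, rfl, h⟩
  | etaK h => exact .inr ⟨_, rfl, h⟩

theorem par_appKW_inv {a : Tgt .K} {b : Tgt .W} {u : Tgt .Q}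
    (h : Par .Q (appKW a b) u) :
    (∃ a' b', u = appKW a' b' ∧ Par .K a a' ∧ Par .W b b') ∨
      ∃ r r' b', a = lamK r ∧ u = r'.substO b' ∧ Par .Q r r' ∧ Par .W b b' := by
  cases h with
  | appKW h h' => exact .inl ⟨_, _, rfl, h, h'⟩
  | betaK h h' => exact .inr ⟨_, _, _, rfl, rfl, h, h'⟩

/-- A parallel reduction of the body of an `η`-redex is an `η`-expansion, or the result of
contracting a `β`-redex. -/
theorem par_etaK_body_inv {a : Tgt .K} {u : Tgt .Q}
    (h : Par .Q (appKW a.wkO (var 0)) u) :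
    ∃ a', Par .K a a' ∧ (u = appKW a'.wkO (var 0) ∨ a' = lamK u) := by
  rcases par_appKW_inv h with ⟨a', b', rfl, h1, h2⟩ | ⟨r, r', b', e, rfl, h1, h2⟩
  · obtain ⟨a'', rfl, h3⟩ := h1.ren_inv rfl
    cases h2
    exact ⟨a'', h3, .inl rfl⟩
  · cases h2
    cases a <;> cases e
    obtain ⟨r', rfl, h3⟩ := h1.ren_inv rfl
    refine ⟨_, .lamK h3, .inr ?_⟩
    rw [substO, subst_ren]
    congr 1
    conv_lhs => rw [← subst_id r']
    congr 1
    funext n; cases n <;> rfl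

/-- The diamond property at one expression. -/
def Diamond (s : TSort) (t : Tgt s) : Prop :=
  ∀ ⦃u v : Tgt s⦄, Par s t u → Par s t v → ∃ w, Par s u w ∧ Par s v w

/-- The critical case opposes `η` to a reduction inside `λk.a k`. Either the body remains an
`η`-redex, or a `β`-step on `a k` has consumed it and `λk.b'` is itself a reduct of `a`. Both are
closed by the diamond property at the smaller term `a`. -/
theorem diamond_lamT (b : Tgt .Q)
    (ih : ∀ (s : TSort) (t : Tgt s), t.size < (lamT b).size → Diamond s t) :
    Diamond .T (lamT b) := by
  have key : ∀ {u : Tgt .T} {b' : Tgt .Q} {a : Tgt .T}, b = appTK a.wkC (cvar 0) →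
      Par .T a u → Par .Q b b' → ∃ w, Par .T u w ∧ Par .T (lamT b') w := by
    rintro u b' a rfl h h'
    have ha : a.size < (lamT (appTK a.wkC (cvar 0))).size := by
      simp only [size, size_wkC]; omega
    obtain ⟨a', h1, rfl | rfl⟩ := par_etaT_body_inv h'
    · obtain ⟨w, h2, h3⟩ := ih _ a ha h h1
      exact ⟨w, h2, .etaT h3⟩
    · exact ih _ a ha h h1
  intro u v hu hv
  rcases par_lamT_inv hu with ⟨b1, rfl, h1⟩ | ⟨a1, e1, h1⟩ <;>
    rcases par_lamT_inv hv with ⟨b2, rfl, h2⟩ | ⟨a2, e2, h2⟩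
  · obtain ⟨w, h3, h4⟩ := ih _ b (by simp only [size]; omega) h1 h2
    exact ⟨_, .lamT h3, .lamT h4⟩
  · obtain ⟨w, h3, h4⟩ := key e2 h2 h1
    exact ⟨w, h4, h3⟩
  · exact key e1 h1 h2
  · subst e1
    simp only [appTK.injEq, and_true] at e2
    obtain rfl := wkC_injective e2
    exact ih _ a1 (by simp only [size, size_wkC]; omega) h1 h2

/-- The critical case opposes `β` to a reduction of the operator. If the operator reduces as an
abstraction, substitution of parallel reductions closes the diagram. -/
theorem diamond_appTK (a : Tgt .T) (b : Tgt .K)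
    (ih : ∀ (s : TSort) (t : Tgt s), t.size < (appTK a b).size → Diamond s t) :
    Diamond .Q (appTK a b) := by
  have key : ∀ {r r' : Tgt .Q} {a1 : Tgt .T} {b1 b2 : Tgt .K}, a = lamT r →
      Par .T a a1 → Par .K b b1 → Par .Q r r' → Par .K b b2 →
      ∃ w, Par .Q (appTK a1 b1) w ∧ Par .Q (r'.substC b2) w := by
    rintro r r' a1 b1 b2 rfl h1 h2 h3 h4
    rcases par_lamT_inv h1 with ⟨r1, rfl, h5⟩ | ⟨a0, rfl, h5⟩
    · obtain ⟨r2, h6, h7⟩ := ih _ r (by simp only [size]; omega) h5 h3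
      obtain ⟨b3, h8, h9⟩ := ih _ b (by simp only [size]; omega) h2 h4
      exact ⟨_, .betaT h6 h8, h7.substC h9⟩
    -- If the operator is the `η`-redex `λk.a0 k`, then contracting the `β`-redex also amounts to
    -- reducing `a0 b`, a smaller term at which the diamond property is available.
    · have h6 := h3.substC h4
      change Par .Q (appTK (a0.wkC.substC b) b) _ at h6
      rw [substC_wkC] at h6
      exact ih _ (appTK a0 b) (by simp only [size, size_wkC]; omega) (.appTK h5 h2) h6
  intro u v hu hv
  rcases par_appTK_inv hu with ⟨a1, b1, rfl, h1, h2⟩ | ⟨r1, r1', b1, e1, rfl, h1, h2⟩ <;>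
    rcases par_appTK_inv hv with ⟨a2, b2, rfl, h3, h4⟩ | ⟨r2, r2', b2, e2, rfl, h3, h4⟩
  · obtain ⟨w, h5, h6⟩ := ih _ a (by simp only [size]; omega) h1 h3
    obtain ⟨w', h7, h8⟩ := ih _ b (by simp only [size]; omega) h2 h4
    exact ⟨_, .appTK h5 h7, .appTK h6 h8⟩
  · exact key e2 h1 h2 h3 h4
  · obtain ⟨w, h5, h6⟩ := key e1 h3 h4 h1 h2
    exact ⟨w, h6, h5⟩
  · subst e1
    cases e2
    obtain ⟨w, h5, h6⟩ := ih _ r1 (by simp only [size]; omega) h1 h3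
    obtain ⟨w', h7, h8⟩ := ih _ b (by simp only [size]; omega) h2 h4
    exact ⟨_, h5.substC h7, h6.substC h8⟩

theorem diamond_lamW (b : Tgt .T)
    (ih : ∀ (s : TSort) (t : Tgt s), t.size < (lamW b).size → Diamond s t) :
    Diamond .W (lamW b) := by
  have key : ∀ {u : Tgt .W} {b' : Tgt .T} {a : Tgt .W}, b = appWW a.wkO (var 0) →
      Par .W a u → Par .T b b' → ∃ w, Par .W u w ∧ Par .W (lamW b') w := by
    rintro u b' a rfl h h'
    have ha : a.size < (lamW (appWW a.wkO (var 0))).size := by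
      simp only [size, size_wkO]; omega
    obtain ⟨a', h1, rfl | rfl⟩ := par_etaW_body_inv h'
    · obtain ⟨w, h2, h3⟩ := ih _ a ha h h1
      exact ⟨w, h2, .etaW h3⟩
    · exact ih _ a ha h h1
  intro u v hu hv
  rcases par_lamW_inv hu with ⟨b1, rfl, h1⟩ | ⟨a1, e1, h1⟩ <;>
    rcases par_lamW_inv hv with ⟨b2, rfl, h2⟩ | ⟨a2, e2, h2⟩
  · obtain ⟨w, h3, h4⟩ := ih _ b (by simp only [size]; omega) h1 h2
    exact ⟨_, .lamW h3, .lamW h4⟩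
  · obtain ⟨w, h3, h4⟩ := key e2 h2 h1
    exact ⟨w, h4, h3⟩
  · exact key e1 h1 h2
  · subst e1
    simp only [appWW.injEq, and_true] at e2
    obtain rfl := wkO_injective e2
    exact ih _ a1 (by simp only [size, size_wkO]; omega) h1 h2

theorem diamond_appWW (a : Tgt .W) (b : Tgt .W)
    (ih : ∀ (s : TSort) (t : Tgt s), t.size < (appWW a b).size → Diamond s t) :
    Diamond .T (appWW a b) := by
  have key : ∀ {r r' : Tgt .T} {a1 : Tgt .W} {b1 b2 : Tgt .W}, a = lamW r →
      Par .W a a1 → Par .W b b1 → Par .T r r' → Par .W b b2 →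
      ∃ w, Par .T (appWW a1 b1) w ∧ Par .T (r'.substO b2) w := by
    rintro r r' a1 b1 b2 rfl h1 h2 h3 h4
    rcases par_lamW_inv h1 with ⟨r1, rfl, h5⟩ | ⟨a0, rfl, h5⟩
    · obtain ⟨r2, h6, h7⟩ := ih _ r (by simp only [size]; omega) h5 h3
      obtain ⟨b3, h8, h9⟩ := ih _ b (by simp only [size]; omega) h2 h4
      exact ⟨_, .betaW h6 h8, h7.substO h9⟩
    · have h6 := h3.substO h4
      change Par .T (appWW (a0.wkO.substO b) b) _ at h6
      rw [substO_wkO] at h6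
      exact ih _ (appWW a0 b) (by simp only [size, size_wkO]; omega) (.appWW h5 h2) h6
  intro u v hu hv
  rcases par_appWW_inv hu with ⟨a1, b1, rfl, h1, h2⟩ | ⟨r1, r1', b1, e1, rfl, h1, h2⟩ <;>
    rcases par_appWW_inv hv with ⟨a2, b2, rfl, h3, h4⟩ | ⟨r2, r2', b2, e2, rfl, h3, h4⟩
  · obtain ⟨w, h5, h6⟩ := ih _ a (by simp only [size]; omega) h1 h3
    obtain ⟨w', h7, h8⟩ := ih _ b (by simp only [size]; omega) h2 h4
    exact ⟨_, .appWW h5 h7, .appWW h6 h8⟩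
  · exact key e2 h1 h2 h3 h4
  · obtain ⟨w, h5, h6⟩ := key e1 h3 h4 h1 h2
    exact ⟨w, h6, h5⟩
  · subst e1
    cases e2
    obtain ⟨w, h5, h6⟩ := ih _ r1 (by simp only [size]; omega) h1 h3
    obtain ⟨w', h7, h8⟩ := ih _ b (by simp only [size]; omega) h2 h4
    exact ⟨_, h5.substO h7, h6.substO h8⟩

theorem diamond_lamK (b : Tgt .Q)
    (ih : ∀ (s : TSort) (t : Tgt s), t.size < (lamK b).size → Diamond s t) :
    Diamond .K (lamK b) := by
  have key : ∀ {u : Tgt .K} {b' : Tgt .Q} {a : Tgt .K}, b = appKW a.wkO (var 0) →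
      Par .K a u → Par .Q b b' → ∃ w, Par .K u w ∧ Par .K (lamK b') w := by
    rintro u b' a rfl h h'
    have ha : a.size < (lamK (appKW a.wkO (var 0))).size := by
      simp only [size, size_wkO]; omega
    obtain ⟨a', h1, rfl | rfl⟩ := par_etaK_body_inv h'
    · obtain ⟨w, h2, h3⟩ := ih _ a ha h h1
      exact ⟨w, h2, .etaK h3⟩
    · exact ih _ a ha h h1
  intro u v hu hv
  rcases par_lamK_inv hu with ⟨b1, rfl, h1⟩ | ⟨a1, e1, h1⟩ <;>
    rcases par_lamK_inv hv with ⟨b2, rfl, h2⟩ | ⟨a2, e2, h2⟩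
  · obtain ⟨w, h3, h4⟩ := ih _ b (by simp only [size]; omega) h1 h2
    exact ⟨_, .lamK h3, .lamK h4⟩
  · obtain ⟨w, h3, h4⟩ := key e2 h2 h1
    exact ⟨w, h4, h3⟩
  · exact key e1 h1 h2
  · subst e1
    simp only [appKW.injEq, and_true] at e2
    obtain rfl := wkO_injective e2
    exact ih _ a1 (by simp only [size, size_wkO]; omega) h1 h2

theorem diamond_appKW (a : Tgt .K) (b : Tgt .W)
    (ih : ∀ (s : TSort) (t : Tgt s), t.size < (appKW a b).size → Diamond s t) :
    Diamond .Q (appKW a b) := by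
  have key : ∀ {r r' : Tgt .Q} {a1 : Tgt .K} {b1 b2 : Tgt .W}, a = lamK r →
      Par .K a a1 → Par .W b b1 → Par .Q r r' → Par .W b b2 →
      ∃ w, Par .Q (appKW a1 b1) w ∧ Par .Q (r'.substO b2) w := by
    rintro r r' a1 b1 b2 rfl h1 h2 h3 h4
    rcases par_lamK_inv h1 with ⟨r1, rfl, h5⟩ | ⟨a0, rfl, h5⟩
    · obtain ⟨r2, h6, h7⟩ := ih _ r (by simp only [size]; omega) h5 h3
      obtain ⟨b3, h8, h9⟩ := ih _ b (by simp only [size]; omega) h2 h4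
      exact ⟨_, .betaK h6 h8, h7.substO h9⟩
    · have h6 := h3.substO h4
      change Par .Q (appKW (a0.wkO.substO b) b) _ at h6
      rw [substO_wkO] at h6
      exact ih _ (appKW a0 b) (by simp only [size, size_wkO]; omega) (.appKW h5 h2) h6
  intro u v hu hv
  rcases par_appKW_inv hu with ⟨a1, b1, rfl, h1, h2⟩ | ⟨r1, r1', b1, e1, rfl, h1, h2⟩ <;>
    rcases par_appKW_inv hv with ⟨a2, b2, rfl, h3, h4⟩ | ⟨r2, r2', b2, e2, rfl, h3, h4⟩
  · obtain ⟨w, h5, h6⟩ := ih _ a (by simp only [size]; omega) h1 h3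
    obtain ⟨w', h7, h8⟩ := ih _ b (by simp only [size]; omega) h2 h4
    exact ⟨_, .appKW h5 h7, .appKW h6 h8⟩
  · exact key e2 h1 h2 h3 h4
  · obtain ⟨w, h5, h6⟩ := key e1 h3 h4 h1 h2
    exact ⟨w, h6, h5⟩
  · subst e1
    cases e2
    obtain ⟨w, h5, h6⟩ := ih _ r1 (by simp only [size]; omega) h1 h3
    obtain ⟨w', h7, h8⟩ := ih _ b (by simp only [size]; omega) h2 h4
    exact ⟨_, h5.substO h7, h6.substO h8⟩

/-- The induction runs over size and all sorts at once: the terms used in the `η`-cases, `a` and `a0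
b`, are not subterms of the given term. -/
theorem diamond (m : ℕ) : ∀ (s : TSort) (t : Tgt s), t.size < m → Diamond s t := by
  induction m with
  | zero => exact fun _ _ h => absurd h (by omega)
  | succ m ih =>
    intro s t ht
    have ih' : ∀ (s' : TSort) (t' : Tgt s'), t'.size < t.size → Diamond s' t' :=
      fun s' t' h => ih s' t' (by omega)
    cases t with
    | var x => intro u v hu hv; cases hu; cases hv; exact ⟨_, .var x, .var x⟩
    | cvar x => intro u v hu hv; cases hu; cases hv; exact ⟨_, .cvar x, .cvar x⟩
    | lamT b => exact diamond_lamT b ih'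
    | lamW b => exact diamond_lamW b ih'
    | lamK b => exact diamond_lamK b ih'
    | appTK a b => exact diamond_appTK a b ih'
    | appWW a b => exact diamond_appWW a b ih'
    | appKW a b => exact diamond_appKW a b ih'

theorem reds_of_par {s : TSort} {t u : Tgt s} (h : Relation.ReflTransGen (Par s) t u) :
    Reds t u := by
  induction h with
  | refl => exact .refl
  | tail _ h ih => exact ih.trans h.reds

theorem confluence {s : TSort} {t u v : Tgt s} (h : Reds t u) (h' : Reds t v) :
    Relation.Join Reds u v := by
  have key : ∀ {t u : Tgt s}, Reds t u → Relation.ReflTransGen (Par s) t u :=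
    by
    intro t u h
    induction h with
    | refl => exact .refl
    | tail _ h ih => exact ih.tail (Par.of_step h)
  obtain ⟨w, h1, h2⟩ := Relation.church_rosser (r := Par s) (fun a b c hb hc => by
    obtain ⟨d, h1, h2⟩ := diamond _ s a (Nat.lt_succ_self _) hb hc
    exact ⟨d, .single h1, .single h2⟩) (key h) (key h')
  exact ⟨w, reds_of_par h1, reds_of_par h2⟩

theorem Conv.of_reds {s : TSort} {t u : Tgt s} (h : Reds t u) : Conv t u := by
  induction h with
  | refl => exact .refl _
  | tail _ h ih => exact ih.trans (.of_step h)

theorem Conv.join {s : TSort} {t u : Tgt s} (h : Conv t u) : Relation.Join Reds t u := by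
  induction h with
  | rel _ _ h => exact ⟨_, .single h, .refl⟩
  | refl => exact ⟨_, .refl, .refl⟩
  | symm _ _ _ ih =>
    obtain ⟨w, h1, h2⟩ := ih
    exact ⟨w, h2, h1⟩
  | trans _ _ _ _ _ ih ih' =>
    obtain ⟨w, h1, h2⟩ := ih
    obtain ⟨w', h3, h4⟩ := ih'
    obtain ⟨z, h5, h6⟩ := confluence h2 h3
    exact ⟨z, h1.trans h5, h4.trans h6⟩

/-- The irreducible form of `u` is joinable with `t`, and the common reduct must be that form
itself. -/
theorem Conv.normalizable {s : TSort} {t u : Tgt s} (h : Conv t u)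
    (hu : Normalizable (BetaEta s) u) : Normalizable (BetaEta s) t := by
  obtain ⟨b, h1, h2⟩ := hu
  obtain ⟨w, h3, h4⟩ := (h.trans (Conv.of_reds h1)).join
  rcases h4.cases_head with rfl | ⟨c, hc, -⟩
  · exact ⟨_, h3, h2⟩
  · exact absurd hc (h2 c)

end Tgt

end CCV

-- Transfer of normalizability between the two calculi.

namespace CCV

open Tm

/-- An empty reduction sequence stays at `P` on the nose, so the endpoint is reached only up to
identification. -/
theorem Sim.exists_reflTransGen {p : Prop} {s : Kind} {P Q : Tm s} (h : Sim p P Q) :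
    ∃ Q', Relation.ReflTransGen Step P Q' ∧ Ident Q' Q := by
  rcases h with h | ⟨-, h⟩
  · exact ⟨Q, h.to_reflTransGen, .refl Q⟩
  · exact ⟨P, .refl, h⟩

theorem Sim.ident_of_irreducible {p : Prop} {s : Kind} {P Q : Tm s} (h : Sim p P Q)
    (hP : ∀ R, ¬ Step P R) : p ∧ Ident P Q := by
  rcases h with h | h
  · obtain ⟨R, hR, -⟩ := Relation.TransGen.head'_iff.1 h
    exact absurd hR (hP R)
  · exact h

theorem red_of_reds {t u : Tgt .T} (h : Tgt.Reds t u) : Red (back t) (back u) := by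
  induction h with
  | refl => exact .refl _
  | tail _ h ih => exact Red.trans ih (Sim.mono (fun _ => trivial) (back_step h))

/-- Reductions that start from a target term with an irreducible inverse translation shrink the
term. -/
theorem normalizable_of_irreducible_back (m : ℕ) : ∀ t : Tgt .T, t.size < m →
    (∀ R, ¬ Step (back t) R) → Normalizable (Tgt.BetaEta .T) t := by
  induction m with
  | zero => exact fun _ h => absurd h (by omega)
  | succ m ih =>
    intro t ht hR
    by_cases h : ∃ u, Tgt.BetaEta .T t u
    · obtain ⟨u, hu⟩ := h
      -- No source step is available, so the simulation must be the identification, whose label says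
      -- that `u` is smaller than `t`. Irreducibility then passes to `back u`.
      obtain ⟨h1, h2⟩ := Sim.ident_of_irreducible (back_step hu) hR
      obtain ⟨b, h3, h4⟩ := ih u (by omega) fun R h => hR R (h.ident_left h2)
      exact ⟨b, .head hu h3, h4⟩
    · exact ⟨t, .refl, fun u hu => h ⟨u, hu⟩⟩

theorem conv_cps_of_steps {M N : Tm .term} (h : Relation.ReflTransGen Step M N) :
    Tgt.Conv (cps M) (cps N) := by
  induction h with
  | refl => exact .refl _
  | tail _ h ih => exact ih.trans (Step.conv_cps h)

end CCV

theorem mainTheorem3 (M : CCV.Tm .term) :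
    CCV.Normalizable (CCV.Tm.Step (s := .term)) M ↔
      CCV.Normalizable (CCV.Tgt.BetaEta .T) (CCV.cps M) := by
  constructor
  · rintro ⟨N, h1, h2⟩
    refine (CCV.conv_cps_of_steps h1).normalizable ?_
    -- As `N` is irreducible, its reduction to `back (cps N)` is an identification, so `back (cps
    -- N)` is irreducible as well.
    refine CCV.normalizable_of_irreducible_back _ _ (Nat.lt_succ_self _) fun R hR => ?_
    exact h2 R (hR.ident_left (CCV.Sim.ident_of_irreducible (CCV.red_back_cps N) h2).2)
  · rintro ⟨t, h1, h2⟩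
    obtain ⟨N, h3, h4⟩ := CCV.Sim.exists_reflTransGen
      ((CCV.red_back_cps M).trans (CCV.red_of_reds h1))
    exact ⟨N, h3, fun R hR => CCV.Tm.IsNormal.not_step (CCV.normalSem_back t h2)
      (hR.ident_left h4.symm)⟩
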